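/- For $\lambda\in\mathbb R$ let $q_1=\tfrac12(-\lambda+\sqrt{4+\lambda^2})$ and, for $q\ge q_1$, let $$f_\lambda(q)=-\frac12\int_{q_1}^q\frac{u\,du}{\sqrt{u^3-u+\lambda u^2}},\qquad z_\lambda(q)=\frac12\int_{q_1}^q\frac{du}{\sqrt{u^3-u+\lambda u^2}}.$$ Let $A_\lambda=\lim_{q\to\infty}(f_\lambda(q)+\sqrt q,\,0,\,z_\lambda(q))\in\mathbb R^3$, and let $r,r'$ be the lines parallel to the $x_2$-axis through $A_\lambda$ and $-A_\lambda$. The Riemann minimal example $R_\lambda\subset\mathbb R^3$ is the smallest set that contains $r$, $r'$ and all points $(\pm f_\lambda(q)+\sqrt q\cos v,\ \sqrt q\sin v,\ \pm z_\lambda(q))$ (equal signs, $q\ge q_1$, $v\in\mathbb R$) and that is invariant under the rotations by $180^\circ$ about $r$ and about $r'$. Let $\sigma>0$. On the elliptic curve $w^2=z(z-1)(z+\sigma)$ without the points $(0,0)$ and $(\infty,\infty)$ take $$g=\frac{z}{\sqrt\sigma},\quad \phi_3=\frac{dz}{w},\quad \phi_1=\frac12\Big(\frac1g-g\Big)\phi_3,\quad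 \phi_2=\frac i2\Big(\frac1g+g\Big)\phi_3,$$ and let $X(p)=\mathrm{Re}\int_{(1,0)}^p(\phi_1,\phi_2,\phi_3)$, which is multivalued. Let $M_\sigma\subset\mathbb R^3$ be the set of all values of $X$. Then the following hold. 1. The set of real periods $\mathrm{Re}\int_\gamma(\phi_1,\phi_2,\phi_3)$ over all loops $\gamma$ in the punctured curve is $\mathbb Z\,T$ for some $T\ne0$ in the plane $\{x_2=0\}$. Hence $X$ is well defined on an infinite cyclic covering of the punctured curve, on which the deck transformations change $X$ by integer multiples of $T$, and $M_\sigma+T=M_\sigma$. 2. The covering surface can be covered by holomorphic coordinates $\xi=x+iy$ with $\phi_3=d\xi$. In all such coordinates $X$ is a smooth conformal immersion with zero mean curvature and $dx_3=dx$, and its Shiffman function $S=\Lambda\,\partial\kappa_c/\partial y$ vanishes identically; here $\Lambda^2|d\xi|^2$ is the induced metric and $\kappa_c(y)$ is the curvature of the horizontal section $y\mapsto X(c+iy)$ as a planar curve. 3. The induced metric is complete: every divergent path on the covering surface has infinite length. 4. $M_\sigma$ is foliated by circles and lines in horizontal planes: every horizontal plane meets $M_\sigma$ exactly in one circle or exactly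 in one straight line. 5. There is exactly one $\lambda\in\mathbb R$ with $$\sigma=\left(\frac{2}{\sqrt{\lambda^2+4}-\lambda}\right)^2,$$ and for this $\lambda$ the surface $M_\sigma$ is $R_\lambda$ up to homothety and translation: $M_\sigma=\sigma^{-1/4}\,(R_\lambda-A_\lambda)$. -/

import Mathlib

open Set Filter Topology MeasureTheory
open scoped ContDiff

noncomputable section

namespace RiemannMinimal

/-- Euclidean three-space; the coordinates `x₁, x₂, x₃` are `x 0, x 1, x 2`. -/
abbrev E3 : Type := EuclideanSpace ℝ (Fin 3)

/-! ### Weierstrass data on the elliptic curve -/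

/-- The elliptic curve `w² = z (z - 1) (z + σ)` without its two points `(0, 0)` and `(∞, ∞)`;
a point is a pair `(z, w)`. -/
def puncturedCurve (σ : ℝ) : Set (ℂ × ℂ) :=
  {p | p.2 ^ 2 = p.1 * (p.1 - 1) * (p.1 + σ) ∧ p.1 ≠ 0}

/-- The meromorphic function `g = z / √σ`. -/
def gaussMap (σ : ℝ) (p : ℂ × ℂ) : ℂ := p.1 / (√σ : ℂ)

/-- The derivative of the polynomial `z (z - 1) (z + σ) = z³ + (σ - 1) z² - σ z`. -/
def cubicDeriv (σ : ℝ) (z : ℂ) : ℂ := 3 * z ^ 2 + 2 * ((σ : ℂ) - 1) * z - σ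

open Classical in
/-- The holomorphic one-form `φ₃ = dz / w` on the curve, at the point `p`, applied to a tangent
vector `v = (ż, ẇ)`. Differentiating the equation of the curve gives `2 w dw = P'(z) dz` with
`P(z) = z (z - 1) (z + σ)`, so at the branch points, where `w = 0`, the form is `2 dw / P'(z)`. -/
def phi3 (σ : ℝ) (p v : ℂ × ℂ) : ℂ :=
  if p.2 = 0 then 2 * v.2 / cubicDeriv σ p.1 else v.1 / p.2

/-- `φ₁ = (1/2) (1/g - g) φ₃`. -/
def phi1 (σ : ℝ) (p v : ℂ × ℂ) : ℂ :=
  1 / 2 * (1 / gaussMap σ p - gaussMap σ p) * phi3 σ p v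

/-- `φ₂ = (i/2) (1/g + g) φ₃`. -/
def phi2 (σ : ℝ) (p v : ℂ × ℂ) : ℂ :=
  Complex.I / 2 * (1 / gaussMap σ p + gaussMap σ p) * phi3 σ p v

/-- The real part of the Weierstrass form `(φ₁, φ₂, φ₃)`. -/
def reForm (σ : ℝ) (p v : ℂ × ℂ) : E3 :=
  !₂[(phi1 σ p v).re, (phi2 σ p v).re, (phi3 σ p v).re]

/-- `γ`, restricted to `[0, 1]`, is a path of class `C¹` in the punctured curve. -/
def IsCurvePath (σ : ℝ) (γ : ℝ → ℂ × ℂ) : Prop :=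
  ContDiff ℝ 1 γ ∧ ∀ t ∈ Icc (0 : ℝ) 1, γ t ∈ puncturedCurve σ

/-- `Re ∫_γ (φ₁, φ₂, φ₃)`. -/
def reIntegral (σ : ℝ) (γ : ℝ → ℂ × ℂ) : E3 :=
  ∫ t in (0 : ℝ)..1, reForm σ (γ t) (deriv γ t)

/-- The real periods of the Weierstrass data: all `Re ∫_γ (φ₁, φ₂, φ₃)` with `γ` a loop. -/
def periods (σ : ℝ) : Set E3 :=
  {x | ∃ γ, IsCurvePath σ γ ∧ γ 0 = γ 1 ∧ reIntegral σ γ = x}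

/-- The covering of the punctured curve on which `X = Re ∫ (φ₁, φ₂, φ₃)`, based at `(1, 0)`, is
single valued: pairs `(p, x)` such that `x` is a value of the integral from `(1, 0)` to `p`.
It carries the topology induced from `(ℂ × ℂ) × ℝ³`. The covering projection is `(p, x) ↦ p`, and
`X` is `(p, x) ↦ x`. -/
def weierstrassCover (σ : ℝ) : Set ((ℂ × ℂ) × E3) :=
  {q | ∃ γ, IsCurvePath σ γ ∧ γ 0 = (1, 0) ∧ γ 1 = q.1 ∧ reIntegral σ γ = q.2}

/-- The covering projection. -/
def coverProj (σ : ℝ) (q : weierstrassCover σ) : ℂ × ℂ := q.1.1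

/-- The immersion `X`. -/
def immersion (σ : ℝ) (q : weierstrassCover σ) : E3 := q.1.2

/-- The surface `M_σ` in space: the image of the immersion. -/
def surfaceM (σ : ℝ) : Set E3 := range (immersion σ)

/-- A chart `ξ` of the covering surface that is holomorphic with `φ₃ = dξ`. -/
def IsHeightChart (σ : ℝ) (e : OpenPartialHomeomorph (weierstrassCover σ) ℂ) : Prop :=
  DifferentiableOn ℂ (fun ξ => coverProj σ (e.symm ξ)) e.target ∧
    ∀ ξ ∈ e.target,
      phi3 σ (coverProj σ (e.symm ξ)) (deriv (fun η => coverProj σ (e.symm η)) ξ) = 1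

/-- The immersion in a chart. -/
def inChart (σ : ℝ) (e : OpenPartialHomeomorph (weierstrassCover σ) ℂ) (ξ : ℂ) : E3 :=
  immersion σ (e.symm ξ)

/-! ### Parameterized surfaces `Y(x + i y)` in space -/

/-- `Y_x`. -/
def dX (Y : ℂ → E3) (ξ : ℂ) : E3 := fderiv ℝ Y ξ 1

/-- `Y_y`. -/
def dY (Y : ℂ → E3) (ξ : ℂ) : E3 := fderiv ℝ Y ξ Complex.I

/-- The determinant of three vectors of space. -/
def det3 (a b c : E3) : ℝ := Matrix.det (Matrix.of fun i j : Fin 3 => ![a, b, c] i j)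

/-- `E = ⟨Y_x, Y_x⟩`. -/
def coeffE (Y : ℂ → E3) (ξ : ℂ) : ℝ := inner ℝ (dX Y ξ) (dX Y ξ)

/-- `F = ⟨Y_x, Y_y⟩`. -/
def coeffF (Y : ℂ → E3) (ξ : ℂ) : ℝ := inner ℝ (dX Y ξ) (dY Y ξ)

/-- `G = ⟨Y_y, Y_y⟩`. -/
def coeffG (Y : ℂ → E3) (ξ : ℂ) : ℝ := inner ℝ (dY Y ξ) (dY Y ξ)

/-- `|Y_x ∧ Y_y| = √(E G - F²)`. -/
def areaDensity (Y : ℂ → E3) (ξ : ℂ) : ℝ :=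
  √(coeffE Y ξ * coeffG Y ξ - coeffF Y ξ ^ 2)

/-- The coefficient `det (Y_x, Y_y, Y_xx) / |Y_x ∧ Y_y|` of the second fundamental form. -/
def coeffL (Y : ℂ → E3) (ξ : ℂ) : ℝ :=
  det3 (dX Y ξ) (dY Y ξ) (dX (dX Y) ξ) / areaDensity Y ξ

/-- The coefficient `det (Y_x, Y_y, Y_xy) / |Y_x ∧ Y_y|` of the second fundamental form. -/
def coeffM (Y : ℂ → E3) (ξ : ℂ) : ℝ :=
  det3 (dX Y ξ) (dY Y ξ) (dY (dX Y) ξ) / areaDensity Y ξ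

/-- The coefficient `det (Y_x, Y_y, Y_yy) / |Y_x ∧ Y_y|` of the second fundamental form. -/
def coeffN (Y : ℂ → E3) (ξ : ℂ) : ℝ :=
  det3 (dX Y ξ) (dY Y ξ) (dY (dY Y) ξ) / areaDensity Y ξ

/-- `Y` is a smooth immersion of `U` with zero mean curvature. -/
def IsMinimalImmersionOn (Y : ℂ → E3) (U : Set ℂ) : Prop :=
  ContDiffOn ℝ ∞ Y U ∧ ∀ ξ ∈ U,
    LinearIndependent ℝ ![dX Y ξ, dY Y ξ] ∧
    coeffL Y ξ * coeffG Y ξ - 2 * coeffM Y ξ * coeffF Y ξ + coeffN Y ξ * coeffE Y ξ = 0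

/-- The coordinate `ξ = x + i y` is conformal for the metric induced by `Y`, and the height
function satisfies `dx₃ = dx`; in particular the tangent plane is nowhere horizontal, and the
horizontal sections are the images of the lines `x = c`. -/
def IsConformalHeightOn (Y : ℂ → E3) (U : Set ℂ) : Prop :=
  ∀ ξ ∈ U, coeffE Y ξ = coeffG Y ξ ∧ coeffF Y ξ = 0 ∧ dX Y ξ 2 = 1 ∧ dY Y ξ 2 = 0

/-- The signed curvature of the curve `(c₁, c₂)`, for a curve `c` in a horizontal plane. -/
def planarCurvature (c : ℝ → E3) (y : ℝ) : ℝ :=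
  (deriv (fun s => c s 0) y * deriv (deriv fun s => c s 1) y -
      deriv (fun s => c s 1) y * deriv (deriv fun s => c s 0) y) /
    √(deriv (fun s => c s 0) y ^ 2 + deriv (fun s => c s 1) y ^ 2) ^ 3

/-- The curvature `κ_c(y)`, `c = Re ξ`, `y = Im ξ`, of the section by a horizontal plane,
parameterized by `y ↦ Y(c + i y)`. -/
def levelCurvature (Y : ℂ → E3) (ξ : ℂ) : ℝ :=
  planarCurvature (fun s => Y ⟨ξ.re, s⟩) ξ.im

/-- The Shiffman function `Λ ∂κ_c/∂y`, where the induced metric is `Λ² |dξ|²`. -/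
def shiffman (Y : ℂ → E3) (ξ : ℂ) : ℝ :=
  ‖dX Y ξ‖ * deriv (fun s : ℝ => levelCurvature Y ⟨ξ.re, s⟩) ξ.im

/-! ### Completeness and horizontal foliations -/

/-- The covering surface with the metric induced by the immersion is complete: every divergent
path of class `C¹` has infinite length. -/
def IsCompleteSurface (σ : ℝ) : Prop :=
  ∀ Γ : ℝ → weierstrassCover σ,
    ContDiffOn ℝ 1 (fun t => ((Γ t : weierstrassCover σ) : (ℂ × ℂ) × E3)) (Ico 0 1) →
    Tendsto Γ (𝓝[<] 1) (cocompact (weierstrassCover σ)) →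
    ∫⁻ t in Ico (0 : ℝ) 1, ‖deriv (fun s => immersion σ (Γ s)) t‖ₑ = ⊤

/-- The circle with centre `a` and radius `r` in the horizontal plane through `a`. -/
def horizontalCircle (a : E3) (r : ℝ) : Set E3 := {x | x 2 = a 2 ∧ dist x a = r}

/-- The horizontal line through `a` with direction `(cos θ, sin θ, 0)`. -/
def horizontalLine (a : E3) (θ : ℝ) : Set E3 :=
  range fun s : ℝ => a + s • (!₂[Real.cos θ, Real.sin θ, 0] : E3)

/-- Every horizontal plane meets `S` exactly in a circle or exactly in a straight line. -/
def FoliatedByCirclesAndLines (S : Set E3) : Prop :=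
  ∀ c : ℝ,
    (∃ (a : E3) (r : ℝ), 0 < r ∧ S ∩ {x | x 2 = c} = horizontalCircle a r) ∨
    (∃ (a : E3) (θ : ℝ), S ∩ {x | x 2 = c} = horizontalLine a θ)

/-! ### The Riemann minimal examples -/

/-- The radicand `u³ - u + lam u²`. -/
def radicand (lam u : ℝ) : ℝ := u ^ 3 - u + lam * u ^ 2

/-- The squared radius of the smallest circle, the positive zero of the radicand. -/
def qMin (lam : ℝ) : ℝ := (-lam + √(4 + lam ^ 2)) / 2

/-- The first coordinate of the centre of the circle of squared radius `q`. -/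
def centre (lam q : ℝ) : ℝ := -(1 / 2) * ∫ u in qMin lam..q, u / √(radicand lam u)

/-- The height of the circle of squared radius `q`. -/
def height (lam q : ℝ) : ℝ := 1 / 2 * ∫ u in qMin lam..q, 1 / √(radicand lam u)

/-- The limit point `A` of the points `(centre + √q, 0, height)` as `q → ∞`
(both limits exist). -/
def pointA (lam : ℝ) : E3 :=
  !₂[limUnder atTop (fun q => centre lam q + √q), 0, limUnder atTop (height lam)]

/-- The rotation by 180 degrees about the line through `a` parallel to the `x₂`-axis. -/
def halfTurn (a x : E3) : E3 := !₂[2 * a 0 - x 0, x 1, 2 * a 2 - x 2]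

/-- Membership in the Riemann minimal example. The `upper` and `lower` pieces are the circles
obtained from the positive and the negative square root; they are completed by the two lines
through `A` and `-A` parallel to the `x₂`-axis, and the result is extended indefinitely by
half-turns about these two lines. -/
inductive MemRiemann (lam : ℝ) : E3 → Prop
  | upper (q v : ℝ) (hq : qMin lam ≤ q) :
      MemRiemann lam !₂[centre lam q + √q * Real.cos v, √q * Real.sin v, height lam q]
  | lower (q v : ℝ) (hq : qMin lam ≤ q) :
      MemRiemann lam !₂[-centre lam q + √q * Real.cos v, √q * Real.sin v, -height lam q]
  | line (s : ℝ) : MemRiemann lam (pointA lam + !₂[0, s, 0])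
  | line' (s : ℝ) : MemRiemann lam (-pointA lam + !₂[0, s, 0])
  | turn (x : E3) : MemRiemann lam x → MemRiemann lam (halfTurn (pointA lam) x)
  | turn' (x : E3) : MemRiemann lam x → MemRiemann lam (halfTurn (-pointA lam) x)

/-- The Riemann minimal example `R_lam`. -/
def riemannExample (lam : ℝ) : Set E3 := {x | MemRiemann lam x}

end RiemannMinimal

end

noncomputable section

namespace RiemannMinimal

/-! ### Real coordinates on the punctured curve -/

/-! Everything rests on a real integral of the Weierstrass data. Put h = w/z and let ξ be a local
primitive of φ₃, so that dz/dξ = w, log z has derivative h, and h² = z - σ/z + σ - 1. With k, m =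
(|z| ± σ/|z|)/2, the function μ = Re h / k (`bend`) satisfies dμ = -ν dx₃, where ν is `cobend`: the
dependence on Im ξ cancels (`hasDerivAt_bend`). As the horizontal sections have curvature √σ μ
(`levelCurvature_eq`), each has constant curvature and the Shiffman function is zero.

The pair (μ, ν) runs on the compact oval ν² = (1 - μ²)(1 + σ μ²) (`oval_eq`), parameterized by an
angle a through μ = sin a, ν = -cos a · δ(a), with δ = √(1 + σ sin² a). Along any path da = δ(a)
dx₃, so the height is an elliptic integral of a. The whole Weierstrass integral has the closed form
`position` in a, m and v = Im h (`hasDerivAt_position`). For a fixed angle, the points of the curve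
form a conic in (m, v), and the first two coordinates of X are affine functions of m and v: the
section is a circle when sin a ≠ 0 and a line when sin a = 0. Since the height is an increasing
bijection in a, every horizontal plane meets exactly one section.

The punctured curve fibres over the circle of angles with connected fibres and a smooth section.
Hence paths with prescribed end angles exist (`angleJoined`), a loop changes the angle by an
arbitrary multiple of 2π, and the periods are the multiples of the change of `position` under a ↦ a
+ 2π. The covering surface is the curve together with a choice of angle
(`mem_weierstrassCover_iff`). In these coordinates bounded sets in space have bounded a, m and v, so
X is proper; properness gives completeness.

For the Riemann example write σ = ρ⁴. The substitution sin a = 1/(ρ √q) turns the integrals defining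
`centre` and `height` into the elliptic integrals in a, and gives A = ρT/4. After x ↦ ρ x + A the
angles in [-π, 0] give the two lines and the two families of circles; half-turns about the lines
send a to -a and to -a - 2π, which generates all remaining angles. -/

/-- The function `w / z`, the logarithmic derivative of `z` along `φ₃`. -/
def hQuot (p : ℂ × ℂ) : ℂ := p.2 / p.1

/-- `Re z / |z|`. -/
def cosArg (p : ℂ × ℂ) : ℝ := p.1.re / ‖p.1‖

/-- `Im z / |z|`. -/
def sinArg (p : ℂ × ℂ) : ℝ := p.1.im / ‖p.1‖

/-- `(|z| + σ / |z|) / 2`. -/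
def plusPart (σ : ℝ) (p : ℂ × ℂ) : ℝ := (‖p.1‖ + σ / ‖p.1‖) / 2

/-- `(|z| - σ / |z|) / 2`. -/
def minusPart (σ : ℝ) (p : ℂ × ℂ) : ℝ := (‖p.1‖ - σ / ‖p.1‖) / 2

/-- The curvature of the horizontal sections, up to the factor `√σ`. -/
def bend (σ : ℝ) (p : ℂ × ℂ) : ℝ := (hQuot p).re / plusPart σ p

/-- The negative of the derivative of `bend` with respect to the height. -/
def cobend (σ : ℝ) (p : ℂ × ℂ) : ℝ := minusPart σ p * bend σ p ^ 2 - cosArg p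

variable {σ : ℝ} {p : ℂ × ℂ}

theorem plusPart_pos (hσ : 0 < σ) (hp : p.1 ≠ 0) : 0 < plusPart σ p := by
  have : 0 < ‖p.1‖ := norm_pos_iff.2 hp
  unfold plusPart; positivity

theorem plusPart_sq (hp : p.1 ≠ 0) : plusPart σ p ^ 2 = minusPart σ p ^ 2 + σ := by
  have : ‖p.1‖ ≠ 0 := norm_ne_zero_iff.2 hp
  unfold plusPart minusPart; field_simp; ring

theorem cosArg_sq_add_sinArg_sq (hp : p.1 ≠ 0) : cosArg p ^ 2 + sinArg p ^ 2 = 1 := by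
  have : ‖p.1‖ ≠ 0 := norm_ne_zero_iff.2 hp
  have h2 := Complex.sq_norm p.1
  rw [Complex.normSq_apply] at h2
  unfold cosArg sinArg; field_simp; linarith

theorem fst_eq (hp : p.1 ≠ 0) : p.1 = ‖p.1‖ * (cosArg p + sinArg p * Complex.I) := by
  have : ‖p.1‖ ≠ 0 := norm_ne_zero_iff.2 hp
  unfold cosArg sinArg
  apply Complex.ext <;> simp <;> field_simp

theorem snd_eq (hp : p.1 ≠ 0) : p.2 = hQuot p * p.1 := by
  unfold hQuot; field_simp

theorem fst_inv_eq (hp : p.1 ≠ 0) :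
    1 / p.1 = (1 / ‖p.1‖ : ℝ) * (cosArg p - sinArg p * Complex.I) := by
  have : (‖p.1‖ : ℂ) ≠ 0 := by exact_mod_cast norm_ne_zero_iff.2 hp
  have h2 := cosArg_sq_add_sinArg_sq hp
  rw [one_div, inv_eq_iff_eq_inv]
  symm; apply inv_eq_of_mul_eq_one_left; rw [mul_comm]
  refine (congrArg (((1 / ‖p.1‖ : ℝ) * (cosArg p - sinArg p * Complex.I) : ℂ) * ·)
    (fst_eq hp)).trans ?_
  push_cast
  field_simp
  have h3 : (cosArg p : ℂ) ^ 2 + (sinArg p : ℂ) ^ 2 = 1 := by exact_mod_cast h2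
  linear_combination h3 - (sinArg p : ℂ) ^ 2 * Complex.I_sq

theorem fst_sub_div (hp : p.1 ≠ 0) : p.1 - σ / p.1 =
    2 * (minusPart σ p * cosArg p + plusPart σ p * sinArg p * Complex.I) := by
  have h1 := fst_inv_eq hp
  have h2 := fst_eq hp
  rw [div_eq_mul_one_div (σ : ℂ), h1]
  nth_rewrite 1 [h2]
  unfold minusPart plusPart
  push_cast; ring

theorem fst_add_div (hp : p.1 ≠ 0) : p.1 + σ / p.1 =
    2 * (plusPart σ p * cosArg p + minusPart σ p * sinArg p * Complex.I) := by
  have h1 := fst_inv_eq hp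
  have h2 := fst_eq hp
  rw [div_eq_mul_one_div (σ : ℂ), h1]
  nth_rewrite 1 [h2]
  unfold minusPart plusPart
  push_cast; ring

/-- Divide the equation of the curve by z². Only z - σ/z remains, whose real and imaginary parts are
products of `minusPart`, `plusPart` and the argument of z. -/
theorem hQuot_sq (hp : p ∈ puncturedCurve σ) : hQuot p ^ 2 = p.1 - σ / p.1 + (σ - 1) := by
  have h1 := hp.1
  have h2 := hp.2
  unfold hQuot
  rw [div_pow, h1]; field_simp; ring

theorem hQuot_re_sq_sub (hp : p ∈ puncturedCurve σ) :
    (hQuot p).re ^ 2 - (hQuot p).im ^ 2 = 2 * minusPart σ p * cosArg p + (σ - 1) := by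
  have h := congrArg Complex.re (hQuot_sq hp)
  rw [fst_sub_div hp.2] at h
  simp [pow_two] at h
  linarith

theorem hQuot_re_mul_im (hp : p ∈ puncturedCurve σ) :
    (hQuot p).re * (hQuot p).im = plusPart σ p * sinArg p := by
  have h := congrArg Complex.im (hQuot_sq hp)
  rw [fst_sub_div hp.2] at h
  simp [pow_two] at h
  linarith

theorem hQuot_re (hσ : 0 < σ) (hp : p.1 ≠ 0) : (hQuot p).re = plusPart σ p * bend σ p := by
  have := (plusPart_pos hσ hp).ne'
  unfold bend; field_simp

/-- The imaginary part of h² carries the factor `plusPart`, as does Re h; it cancels. -/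
theorem bend_mul_im (hσ : 0 < σ) (hp : p ∈ puncturedCurve σ) :
    bend σ p * (hQuot p).im = sinArg p := by
  have h0 := (plusPart_pos hσ hp.2).ne'
  have h := hQuot_re_mul_im hp
  rw [hQuot_re hσ hp.2] at h
  apply mul_left_cancel₀ h0; linarith

/-- This is the real part of h², with Re h = kμ and k² = m² + σ. For fixed (μ, ν) it is a conic in m
and Im h, and this conic becomes a horizontal section of the surface. -/
theorem conic_eq (hσ : 0 < σ) (hp : p ∈ puncturedCurve σ) :
    bend σ p ^ 2 * minusPart σ p ^ 2 - 2 * minusPart σ p * cobend σ p + (hQuot p).im ^ 2 + (σ - 1)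
      - σ * bend σ p ^ 2 = 0 := by
  have h := hQuot_re_sq_sub hp
  rw [hQuot_re hσ hp.2, mul_pow, plusPart_sq hp.2] at h
  unfold cobend; linear_combination -h

/-- Substitute cos = mμ² - ν and sin = μ Im h into cos² + sin² = 1. Subtracting μ² times the conic
eliminates both m and Im h. -/
theorem oval_eq (hσ : 0 < σ) (hp : p ∈ puncturedCurve σ) :
    cobend σ p ^ 2 = (1 - bend σ p ^ 2) * (1 + σ * bend σ p ^ 2) := by
  have h := conic_eq hσ hp
  have h1 := cosArg_sq_add_sinArg_sq hp.2
  rw [← bend_mul_im hσ hp] at h1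
  have h2 : cosArg p = minusPart σ p * bend σ p ^ 2 - cobend σ p := by unfold cobend; ring
  rw [h2] at h1
  linear_combination h1 - bend σ p ^ 2 * h

/-! ### Derivatives along curves -/

/-- Half the derivative of the cubic; the second component of the vector field dual to `φ₃`. -/
def flowField (σ : ℝ) (p : ℂ × ℂ) : ℂ × ℂ := (p.2, cubicDeriv σ p.1 / 2)

/-- The zeros 1 and -σ of the cubic are simple. Hence `flowField` has no zeros on the punctured
curve. -/
theorem cubicDeriv_ne_zero (hσ : 0 < σ) (hp : p ∈ puncturedCurve σ) (hw : p.2 = 0) :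
    cubicDeriv σ p.1 ≠ 0 := by
  have h1 := hp.1
  have hz := hp.2
  rw [hw] at h1
  have hs : (σ : ℂ) ≠ 0 := by exact_mod_cast hσ.ne'
  have hs1 : (1 + σ : ℂ) ≠ 0 := by exact_mod_cast (by positivity : (1 + σ : ℝ) ≠ 0)
  have h2 : (p.1 - 1) * (p.1 + σ) = 0 := by
    have : p.1 * ((p.1 - 1) * (p.1 + σ)) = 0 := by linear_combination -h1
    exact (mul_eq_zero.1 this).resolve_left hz
  unfold cubicDeriv
  rcases mul_eq_zero.1 h2 with h | h
  · have : p.1 = 1 := by linear_combination h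
    rw [this]; intro h3; apply hs1; linear_combination h3
  · have : p.1 = -σ := by linear_combination h
    rw [this]; intro h3; apply mul_ne_zero hs hs1; linear_combination h3

/-- A tangent vector of the curve is the multiple of the dual vector field by the value of `φ₃`. -/
theorem eq_phi3_smul_flowField (hσ : 0 < σ) (hp : p ∈ puncturedCurve σ) {v : ℂ × ℂ}
    (hv : 2 * p.2 * v.2 = cubicDeriv σ p.1 * v.1) : v = phi3 σ p v • flowField σ p := by
  unfold phi3 flowField
  split_ifs with h
  · have := cubicDeriv_ne_zero hσ hp h
    rw [h] at hv
    have h1 : v.1 = 0 := by simpa [this] using hv.symm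
    ext1
    · simp [h, h1]
    · simp; field_simp
  · ext1
    · simp; field_simp
    · simp; field_simp; linear_combination hv

theorem phi3_smul_flowField (hσ : 0 < σ) (hp : p ∈ puncturedCurve σ) (ζ : ℂ) :
    phi3 σ p (ζ • flowField σ p) = ζ := by
  unfold phi3 flowField
  split_ifs with h
  · have := cubicDeriv_ne_zero hσ hp h
    simp; field_simp
  · simp; field_simp

theorem tangent_of_hasDerivAt {γ : ℝ → ℂ × ℂ} {v : ℂ × ℂ} {t : ℝ} (hγ : HasDerivAt γ v t)
    (hc : ∀ᶠ s in 𝓝 t, γ s ∈ puncturedCurve σ) :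
    2 * (γ t).2 * v.2 = cubicDeriv σ (γ t).1 * v.1 := by
  have h1 : HasDerivAt (fun s => (γ s).1) v.1 t := hγ.fst
  have h2 : HasDerivAt (fun s => (γ s).2) v.2 t := hγ.snd
  have h3 := h2.pow 2
  have h4 := (h1.mul (h1.sub_const (1 : ℂ))).mul (h1.add_const (σ : ℂ))
  have h5 := h3.congr_of_eventuallyEq
    (f₁ := (fun s => (γ s).1) * (fun s => (γ s).1 - 1) * fun s => (γ s).1 + (σ : ℂ))
    (by filter_upwards [hc] with s hs; exact hs.1.symm)
  have h6 := h4.unique h5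
  unfold cubicDeriv
  simp at h6
  linear_combination -h6

section Flow

variable {γ : ℝ → ℂ × ℂ} {ζ : ℂ} {t : ℝ}

/-- Formally this differentiates h² = z - σ/z + σ - 1 and cancels h. The quotient rule for w/z is
used instead, so zeros of h need no separate argument. -/
theorem hasDerivAt_hQuot (hp : γ t ∈ puncturedCurve σ)
    (hγ : HasDerivAt γ (ζ • flowField σ (γ t)) t) :
    HasDerivAt (fun s => hQuot (γ s)) (((plusPart σ (γ t) * cosArg (γ t) : ℝ) +
      (minusPart σ (γ t) * sinArg (γ t) : ℝ) * Complex.I) * ζ) t := by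
  have h1 : HasDerivAt (fun s => (γ s).1) _ t := hγ.fst
  have h2 : HasDerivAt (fun s => (γ s).2) _ t := hγ.snd
  refine (h2.div h1 hp.2).congr_deriv ?_
  have h3 := fst_add_div (σ := σ) hp.2
  have hz := hp.2
  have h4 := hp.1
  push_cast
  have h5 : ((plusPart σ (γ t) : ℂ) * cosArg (γ t) + minusPart σ (γ t) * sinArg (γ t) * Complex.I)
    = ((γ t).1 + σ / (γ t).1) / 2 := by rw [h3]; ring
  rw [h5]
  simp only [flowField, cubicDeriv, Prod.smul_fst, Prod.smul_snd, smul_eq_mul]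
  field_simp
  linear_combination (-2) * ζ * h4

/-- Since z' = z h ζ, the logarithmic derivative of |z| is Re (h ζ), and the argument of z turns at
the rate Im (h ζ). All formulas below follow from these two rates. -/
theorem hasDerivAt_norm_fst (hp : γ t ∈ puncturedCurve σ)
    (hγ : HasDerivAt γ (ζ • flowField σ (γ t)) t) :
    HasDerivAt (fun s => ‖(γ s).1‖) (‖(γ t).1‖ * (hQuot (γ t) * ζ).re) t := by
  have h1 : HasDerivAt (fun s => (γ s).1) _ t := hγ.fst
  have hr : HasDerivAt (fun s => (γ s).1.re) _ t :=
    (Complex.reCLM.hasFDerivAt.comp_hasDerivAt t h1)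
  have hi : HasDerivAt (fun s => (γ s).1.im) _ t :=
    (Complex.imCLM.hasFDerivAt.comp_hasDerivAt t h1)
  have hn : (fun s => ‖(γ s).1‖) = fun s => √((γ s).1.re ^ 2 + (γ s).1.im ^ 2) := by
    funext s; rw [Complex.norm_eq_sqrt_sq_add_sq]
  have h3 : ‖(γ t).1‖ ^ 2 = (γ t).1.re ^ 2 + (γ t).1.im ^ 2 := by
    rw [Complex.sq_norm, Complex.normSq_apply]; ring
  have hpos : (γ t).1.re ^ 2 + (γ t).1.im ^ 2 ≠ 0 := by
    rw [← h3]; exact pow_ne_zero 2 (norm_ne_zero_iff.2 hp.2)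
  have h0 : ‖(γ t).1‖ ≠ 0 := norm_ne_zero_iff.2 hp.2
  rw [hn]
  refine (((hr.pow 2).add (hi.pow 2)).sqrt hpos).congr_deriv ?_
  simp only [Pi.add_apply, Pi.pow_apply]
  rw [← Complex.norm_eq_sqrt_sq_add_sq]
  have hv : (ζ • flowField σ (γ t)).1 = (γ t).1 * (hQuot (γ t) * ζ) := by
    simp only [flowField, Prod.smul_fst, smul_eq_mul]
    nth_rewrite 1 [snd_eq hp.2]; ring
  simp only [Complex.reCLM_apply, Complex.imCLM_apply, hv]
  generalize hQuot (γ t) * ζ = q at *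
  simp only [Complex.mul_re, Complex.mul_im]
  field_simp
  push_cast
  rw [h3]; ring

theorem hasDerivAt_minusPart (hp : γ t ∈ puncturedCurve σ)
    (hγ : HasDerivAt γ (ζ • flowField σ (γ t)) t) :
    HasDerivAt (fun s => minusPart σ (γ s)) (plusPart σ (γ t) * (hQuot (γ t) * ζ).re) t := by
  have h := hasDerivAt_norm_fst hp hγ
  have h0 : ‖(γ t).1‖ ≠ 0 := norm_ne_zero_iff.2 hp.2
  refine ((h.sub ((hasDerivAt_const t σ).div h h0)).div_const 2).congr_deriv ?_
  unfold plusPart; field_simp; ring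

theorem hasDerivAt_plusPart (hp : γ t ∈ puncturedCurve σ)
    (hγ : HasDerivAt γ (ζ • flowField σ (γ t)) t) :
    HasDerivAt (fun s => plusPart σ (γ s)) (minusPart σ (γ t) * (hQuot (γ t) * ζ).re) t := by
  have h := hasDerivAt_norm_fst hp hγ
  have h0 : ‖(γ t).1‖ ≠ 0 := norm_ne_zero_iff.2 hp.2
  refine ((h.add ((hasDerivAt_const t σ).div h h0)).div_const 2).congr_deriv ?_
  unfold minusPart; field_simp; ring

theorem hasDerivAt_cosArg (hp : γ t ∈ puncturedCurve σ)
    (hγ : HasDerivAt γ (ζ • flowField σ (γ t)) t) :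
    HasDerivAt (fun s => cosArg (γ s)) (-sinArg (γ t) * (hQuot (γ t) * ζ).im) t := by
  have h := hasDerivAt_norm_fst hp hγ
  have h0 : ‖(γ t).1‖ ≠ 0 := norm_ne_zero_iff.2 hp.2
  have h1 : HasDerivAt (fun s => (γ s).1) _ t := hγ.fst
  have hr : HasDerivAt (fun s => (γ s).1.re) _ t :=
    (Complex.reCLM.hasFDerivAt.comp_hasDerivAt t h1)
  refine (hr.div h h0).congr_deriv ?_
  have hv : (ζ • flowField σ (γ t)).1 = (γ t).1 * (hQuot (γ t) * ζ) := by
    simp only [flowField, Prod.smul_fst, smul_eq_mul]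
    nth_rewrite 1 [snd_eq hp.2]; ring
  simp only [Complex.reCLM_apply, hv]
  generalize hQuot (γ t) * ζ = q at *
  simp only [Complex.mul_re, sinArg]
  field_simp; ring

theorem hasDerivAt_sinArg (hp : γ t ∈ puncturedCurve σ)
    (hγ : HasDerivAt γ (ζ • flowField σ (γ t)) t) :
    HasDerivAt (fun s => sinArg (γ s)) (cosArg (γ t) * (hQuot (γ t) * ζ).im) t := by
  have h := hasDerivAt_norm_fst hp hγ
  have h0 : ‖(γ t).1‖ ≠ 0 := norm_ne_zero_iff.2 hp.2
  have h1 : HasDerivAt (fun s => (γ s).1) _ t := hγ.fst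
  have hr : HasDerivAt (fun s => (γ s).1.im) _ t :=
    (Complex.imCLM.hasFDerivAt.comp_hasDerivAt t h1)
  refine (hr.div h h0).congr_deriv ?_
  have hv : (ζ • flowField σ (γ t)).1 = (γ t).1 * (hQuot (γ t) * ζ) := by
    simp only [flowField, Prod.smul_fst, smul_eq_mul]
    nth_rewrite 1 [snd_eq hp.2]; ring
  simp only [Complex.imCLM_apply, hv]
  generalize hQuot (γ t) * ζ = q at *
  simp only [Complex.mul_im, cosArg]
  field_simp; ring

theorem hasDerivAt_hQuot_re (hp : γ t ∈ puncturedCurve σ)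
    (hγ : HasDerivAt γ (ζ • flowField σ (γ t)) t) :
    HasDerivAt (fun s => (hQuot (γ s)).re) (plusPart σ (γ t) * cosArg (γ t) * ζ.re -
      minusPart σ (γ t) * sinArg (γ t) * ζ.im) t := by
  refine (Complex.reCLM.hasFDerivAt.comp_hasDerivAt t (hasDerivAt_hQuot hp hγ)).congr_deriv ?_
  simp

theorem hasDerivAt_hQuot_im (hp : γ t ∈ puncturedCurve σ)
    (hγ : HasDerivAt γ (ζ • flowField σ (γ t)) t) :
    HasDerivAt (fun s => (hQuot (γ s)).im) (plusPart σ (γ t) * cosArg (γ t) * ζ.im +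
      minusPart σ (γ t) * sinArg (γ t) * ζ.re) t := by
  refine (Complex.imCLM.hasFDerivAt.comp_hasDerivAt t (hasDerivAt_hQuot hp hγ)).congr_deriv ?_
  simp

/-- The crucial cancellation: the contributions of Im ζ from Re h and from `plusPart` are equal
because sin = μ Im h. So `bend` varies with the height alone, which is the vanishing of the Shiffman
function. -/
theorem hasDerivAt_bend (hσ : 0 < σ) (hp : γ t ∈ puncturedCurve σ)
    (hγ : HasDerivAt γ (ζ • flowField σ (γ t)) t) :
    HasDerivAt (fun s => bend σ (γ s)) (-cobend σ (γ t) * ζ.re) t := by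
  have h0 := (plusPart_pos hσ hp.2).ne'
  refine ((hasDerivAt_hQuot_re hp hγ).div (hasDerivAt_plusPart hp hγ) h0).congr_deriv ?_
  have h1 := hQuot_re hσ hp.2
  have h2 := bend_mul_im hσ hp
  simp only [Complex.mul_re]
  rw [h1, ← h2]
  have h3 : cosArg (γ t) = minusPart σ (γ t) * bend σ (γ t) ^ 2 - cobend σ (γ t) := by
    unfold cobend; ring
  rw [h3]
  field_simp
  ring

/-- Together with μ' = -ν this is an autonomous equation in the height; it is compatible with the
derivative of the oval equation. -/
theorem hasDerivAt_cobend (hσ : 0 < σ) (hp : γ t ∈ puncturedCurve σ)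
    (hγ : HasDerivAt γ (ζ • flowField σ (γ t)) t) :
    HasDerivAt (fun s => cobend σ (γ s))
      ((2 * σ * bend σ (γ t) ^ 3 - (σ - 1) * bend σ (γ t)) * ζ.re) t := by
  refine (((hasDerivAt_minusPart hp hγ).mul ((hasDerivAt_bend hσ hp hγ).pow 2)).sub
    (hasDerivAt_cosArg hp hγ)).congr_deriv ?_
  have h1 := hQuot_re hσ hp.2
  have h2 := bend_mul_im hσ hp
  have h4 := conic_eq hσ hp
  have h5 := plusPart_sq (σ := σ) hp.2
  simp only [Complex.mul_re, Complex.mul_im]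
  rw [h1, ← h2]
  simp
  linear_combination bend σ (γ t) * ζ.re * h4 + bend σ (γ t) ^ 3 * ζ.re * h5

end Flow

end RiemannMinimal

namespace RiemannMinimal

/-! ### Curves in space -/

theorem hasDerivAt_e3 {a b c : ℝ → ℝ} {a' b' c' t : ℝ} (ha : HasDerivAt a a' t)
    (hb : HasDerivAt b b' t) (hc : HasDerivAt c c' t) :
    HasDerivAt (fun s => (!₂[a s, b s, c s] : E3)) !₂[a', b', c'] t := by
  have h : HasDerivAt (fun s => ![a s, b s, c s]) ![a', b', c'] t := by
    rw [hasDerivAt_pi]; intro i; fin_cases i <;> assumption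
  exact (PiLp.hasFDerivAt_toLp 2 _).comp_hasDerivAt t h

theorem continuousOn_e3 {X : Type*} [TopologicalSpace X] {a b c : X → ℝ} {s : Set X}
    (ha : ContinuousOn a s) (hb : ContinuousOn b s) (hc : ContinuousOn c s) :
    ContinuousOn (fun x => (!₂[a x, b x, c x] : E3)) s := by
  refine (PiLp.continuous_toLp 2 _).comp_continuousOn ?_
  rw [continuousOn_pi]; intro i; fin_cases i <;> assumption

theorem hasDerivAt_e3_apply {f : ℝ → E3} {f' : E3} {t : ℝ} (h : HasDerivAt f f' t) (i : Fin 3) :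
    HasDerivAt (fun s => f s i) (f' i) t :=
  (PiLp.hasFDerivAt_apply (𝕜 := ℝ) 2 (f t) i).comp_hasDerivAt t h

/-! ### The height and the shift of the axis as functions of an angle -/

/-- `√(1 + σ sin² a)`. -/
def delta (σ a : ℝ) : ℝ := √(1 + σ * Real.sin a ^ 2)

/-- The height at angle `a`, an elliptic integral of the first kind. -/
def heightFn (σ a : ℝ) : ℝ := ∫ x in (0 : ℝ)..a, 1 / delta σ x

/-- The shift of the circles at angle `a` in the direction of the first axis. -/
def shiftFn (σ a : ℝ) : ℝ := ∫ x in (0 : ℝ)..a, √σ * Real.sin x ^ 2 / delta σ x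

/-- `a` is an angular coordinate of the real oval `ν² = (1 - μ²) (1 + σ μ²)` at the point with
coordinates `bend`, `cobend`. -/
def IsAngle (σ : ℝ) (p : ℂ × ℂ) (a : ℝ) : Prop :=
  bend σ p = Real.sin a ∧ cobend σ p = -(Real.cos a * delta σ a)

/-- The value of the Weierstrass integral at the point `p` of the curve, for the angle `a`. -/
def position (σ : ℝ) (p : ℂ × ℂ) (a : ℝ) : E3 :=
  !₂[shiftFn σ a - minusPart σ p * bend σ p / √σ, -(hQuot p).im / √σ, heightFn σ a]

/-- The real part of the Weierstrass form on a vector on which `φ₃` takes the value `ζ`. -/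
def weierVec (σ : ℝ) (p : ℂ × ℂ) (ζ : ℂ) : E3 :=
  !₂[(1 / 2 * (1 / gaussMap σ p - gaussMap σ p) * ζ).re,
    (Complex.I / 2 * (1 / gaussMap σ p + gaussMap σ p) * ζ).re, ζ.re]

theorem reForm_eq (σ : ℝ) (p v : ℂ × ℂ) : reForm σ p v = weierVec σ p (phi3 σ p v) := rfl

variable {σ : ℝ} {p : ℂ × ℂ} {a : ℝ}

theorem delta_arg_pos (hσ : 0 < σ) (a : ℝ) : 0 < 1 + σ * Real.sin a ^ 2 := by positivity

theorem delta_pos (hσ : 0 < σ) (a : ℝ) : 0 < delta σ a := Real.sqrt_pos.2 (delta_arg_pos hσ a)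

theorem delta_sq (hσ : 0 < σ) (a : ℝ) : delta σ a ^ 2 = 1 + σ * Real.sin a ^ 2 :=
  Real.sq_sqrt (delta_arg_pos hσ a).le

theorem contDiff_delta (hσ : 0 < σ) : ContDiff ℝ ∞ (delta σ) :=
  (contDiff_const.add (contDiff_const.mul (Real.contDiff_sin.pow 2))).sqrt
    fun x => (delta_arg_pos hσ x).ne'

theorem contDiff_heightFn_deriv (hσ : 0 < σ) : ContDiff ℝ ∞ (fun x => 1 / delta σ x) :=
  contDiff_const.div (contDiff_delta hσ) fun x => (delta_pos hσ x).ne'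

theorem contDiff_shiftFn_deriv (hσ : 0 < σ) :
    ContDiff ℝ ∞ (fun x => √σ * Real.sin x ^ 2 / delta σ x) :=
  (contDiff_const.mul (Real.contDiff_sin.pow 2)).div (contDiff_delta hσ)
    fun x => (delta_pos hσ x).ne'

theorem hasDerivAt_heightFn (hσ : 0 < σ) (a : ℝ) :
    HasDerivAt (heightFn σ) (1 / delta σ a) a :=
  ((contDiff_heightFn_deriv hσ).continuous.integral_hasStrictDerivAt 0 a).hasDerivAt

theorem hasDerivAt_shiftFn (hσ : 0 < σ) (a : ℝ) :
    HasDerivAt (shiftFn σ) (√σ * Real.sin a ^ 2 / delta σ a) a :=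
  ((contDiff_shiftFn_deriv hσ).continuous.integral_hasStrictDerivAt 0 a).hasDerivAt

theorem contDiff_heightFn (hσ : 0 < σ) : ContDiff ℝ ∞ (heightFn σ) := by
  rw [contDiff_infty_iff_deriv]
  refine ⟨fun x => (hasDerivAt_heightFn hσ x).differentiableAt, ?_⟩
  rw [funext fun x => (hasDerivAt_heightFn hσ x).deriv]
  exact contDiff_heightFn_deriv hσ

theorem contDiff_shiftFn (hσ : 0 < σ) : ContDiff ℝ ∞ (shiftFn σ) := by
  rw [contDiff_infty_iff_deriv]
  refine ⟨fun x => (hasDerivAt_shiftFn hσ x).differentiableAt, ?_⟩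
  rw [funext fun x => (hasDerivAt_shiftFn hσ x).deriv]
  exact contDiff_shiftFn_deriv hσ

theorem delta_add_pi (σ a : ℝ) : delta σ (a + Real.pi) = delta σ a := by
  simp [delta, Real.sin_add_pi]

theorem delta_neg (σ a : ℝ) : delta σ (-a) = delta σ a := by simp [delta]

theorem eq_of_hasDerivAt_eq {f g : ℝ → ℝ} {f' : ℝ → ℝ} (hf : ∀ x, HasDerivAt f (f' x) x)
    (hg : ∀ x, HasDerivAt g (f' x) x) (x₀ : ℝ) (h₀ : f x₀ = g x₀) : f = g := by
  have h : ∀ x, HasDerivAt (f - g) 0 x := fun x => by simpa using (hf x).sub (hg x)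
  funext x
  have := is_const_of_deriv_eq_zero (fun x => (h x).differentiableAt) (fun x => (h x).deriv) x x₀
  simp [h₀] at this
  linarith

theorem heightFn_zero (σ : ℝ) : heightFn σ 0 = 0 := by simp [heightFn]

theorem shiftFn_zero (σ : ℝ) : shiftFn σ 0 = 0 := by simp [shiftFn]

theorem heightFn_neg (hσ : 0 < σ) (a : ℝ) : heightFn σ (-a) = -heightFn σ a := by
  have := eq_of_hasDerivAt_eq (f := fun a => heightFn σ (-a)) (g := fun a => -heightFn σ a)
    (f' := fun x => -(1 / delta σ x))
    (fun x => by simpa [delta_neg, Function.comp_def] using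
      (hasDerivAt_heightFn hσ (-x)).comp x (hasDerivAt_neg x))
    (fun x => (hasDerivAt_heightFn hσ x).neg) 0 (by simp [heightFn_zero])
  exact congrFun this a

theorem shiftFn_neg (hσ : 0 < σ) (a : ℝ) : shiftFn σ (-a) = -shiftFn σ a := by
  have := eq_of_hasDerivAt_eq (f := fun a => shiftFn σ (-a)) (g := fun a => -shiftFn σ a)
    (f' := fun x => -(√σ * Real.sin x ^ 2 / delta σ x))
    (fun x => by simpa [delta_neg, Function.comp_def] using
      (hasDerivAt_shiftFn hσ (-x)).comp x (hasDerivAt_neg x))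
    (fun x => (hasDerivAt_shiftFn hσ x).neg) 0 (by simp [shiftFn_zero])
  exact congrFun this a

/-- The integrand has period π, so the difference is constant. Oddness evaluates it at -π/2. -/
theorem heightFn_add_pi (hσ : 0 < σ) (a : ℝ) :
    heightFn σ (a + Real.pi) = heightFn σ a + 2 * heightFn σ (Real.pi / 2) := by
  have := eq_of_hasDerivAt_eq (f := fun a => heightFn σ (a + Real.pi))
    (g := fun a => heightFn σ a + 2 * heightFn σ (Real.pi / 2)) (f' := fun x => 1 / delta σ x)
    (fun x => by simpa [delta_add_pi] using (hasDerivAt_heightFn hσ (x + Real.pi)).comp_add_const x _)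
    (fun x => (hasDerivAt_heightFn hσ x).add_const _) (-(Real.pi / 2)) (by
      rw [heightFn_neg hσ, show -(Real.pi / 2) + Real.pi = Real.pi / 2 by ring]; ring)
  exact congrFun this a

theorem shiftFn_add_pi (hσ : 0 < σ) (a : ℝ) :
    shiftFn σ (a + Real.pi) = shiftFn σ a + 2 * shiftFn σ (Real.pi / 2) := by
  have := eq_of_hasDerivAt_eq (f := fun a => shiftFn σ (a + Real.pi))
    (g := fun a => shiftFn σ a + 2 * shiftFn σ (Real.pi / 2))
    (f' := fun x => √σ * Real.sin x ^ 2 / delta σ x)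
    (fun x => by simpa [delta_add_pi] using (hasDerivAt_shiftFn hσ (x + Real.pi)).comp_add_const x _)
    (fun x => (hasDerivAt_shiftFn hσ x).add_const _) (-(Real.pi / 2)) (by
      rw [shiftFn_neg hσ, show -(Real.pi / 2) + Real.pi = Real.pi / 2 by ring]; ring)
  exact congrFun this a

theorem strictMono_heightFn (hσ : 0 < σ) : StrictMono (heightFn σ) :=
  strictMono_of_deriv_pos fun x => by
    rw [(hasDerivAt_heightFn hσ x).deriv]; exact one_div_pos.2 (delta_pos hσ x)

theorem heightFn_pi_div_two_pos (hσ : 0 < σ) : 0 < heightFn σ (Real.pi / 2) := by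
  rw [← heightFn_zero σ]; exact strictMono_heightFn hσ (by positivity)

theorem heightFn_add_two_pi_mul (hσ : 0 < σ) (a : ℝ) (k : ℤ) :
    heightFn σ (a + k * (2 * Real.pi)) = heightFn σ a + k * (4 * heightFn σ (Real.pi / 2)) := by
  have h2 : ∀ a, heightFn σ (a + 2 * Real.pi) = heightFn σ a + 4 * heightFn σ (Real.pi / 2) :=
    fun a => by rw [show a + 2 * Real.pi = a + Real.pi + Real.pi by ring, heightFn_add_pi hσ,
      heightFn_add_pi hσ]; ring
  induction k using Int.induction_on with
  | zero => simp
  | succ n ih =>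
    have := h2 (a + n * (2 * Real.pi))
    push_cast at ih ⊢
    rw [show a + (n + 1) * (2 * Real.pi) = a + n * (2 * Real.pi) + 2 * Real.pi by ring, this, ih]
    ring
  | pred n ih =>
    have := h2 (a + (-n - 1) * (2 * Real.pi))
    push_cast at ih ⊢
    rw [show a + (-n - 1) * (2 * Real.pi) + 2 * Real.pi = a + -n * (2 * Real.pi) by ring, ih] at this
    linarith

theorem shiftFn_add_two_pi_mul (hσ : 0 < σ) (a : ℝ) (k : ℤ) :
    shiftFn σ (a + k * (2 * Real.pi)) = shiftFn σ a + k * (4 * shiftFn σ (Real.pi / 2)) := by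
  have h2 : ∀ a, shiftFn σ (a + 2 * Real.pi) = shiftFn σ a + 4 * shiftFn σ (Real.pi / 2) :=
    fun a => by rw [show a + 2 * Real.pi = a + Real.pi + Real.pi by ring, shiftFn_add_pi hσ,
      shiftFn_add_pi hσ]; ring
  induction k using Int.induction_on with
  | zero => simp
  | succ n ih =>
    have := h2 (a + n * (2 * Real.pi))
    push_cast at ih ⊢
    rw [show a + (n + 1) * (2 * Real.pi) = a + n * (2 * Real.pi) + 2 * Real.pi by ring, this, ih]
    ring
  | pred n ih =>
    have := h2 (a + (-n - 1) * (2 * Real.pi))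
    push_cast at ih ⊢
    rw [show a + (-n - 1) * (2 * Real.pi) + 2 * Real.pi = a + -n * (2 * Real.pi) by ring, ih] at this
    linarith

theorem surjective_heightFn (hσ : 0 < σ) : Function.Surjective (heightFn σ) := by
  have hK := heightFn_pi_div_two_pos hσ
  have hc : Continuous (heightFn σ) := (contDiff_heightFn hσ).continuous
  intro y
  obtain ⟨n, hn⟩ := exists_nat_gt (|y| / (4 * heightFn σ (Real.pi / 2)))
  rw [div_lt_iff₀ (by positivity)] at hn
  have h1 := heightFn_add_two_pi_mul hσ 0 n
  have h2 := heightFn_neg hσ (0 + (n : ℤ) * (2 * Real.pi))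
  rw [h1, heightFn_zero] at h2
  rw [heightFn_zero] at h1
  push_cast at h1 h2
  refine mem_range_of_exists_le_of_exists_ge hc ⟨_, h2.le.trans ?_⟩ ⟨_, le_trans ?_ h1.ge⟩
  · linarith [neg_abs_le y]
  · linarith [le_abs_self y]

/-- The angle as a function of the height. -/
def heightHomeo (hσ : 0 < σ) : ℝ ≃ₜ ℝ :=
  ((strictMono_heightFn hσ).orderIsoOfSurjective _ (surjective_heightFn hσ)).toHomeomorph

theorem heightHomeo_apply (hσ : 0 < σ) (a : ℝ) : heightHomeo hσ a = heightFn σ a := rfl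

/-! ### Angles of points of the curve -/

/-- Dividing ν by √(1 + σ μ²) turns the oval into the unit circle; the angle is the argument of the
resulting point. -/
theorem exists_isAngle (hσ : 0 < σ) (hp : p ∈ puncturedCurve σ) : ∃ a, IsAngle σ p a := by
  have h1 : 0 < 1 + σ * bend σ p ^ 2 := by positivity
  have h2 := oval_eq hσ hp
  set D := √(1 + σ * bend σ p ^ 2) with hD
  have hD0 : 0 < D := Real.sqrt_pos.2 h1
  have hD2 : D ^ 2 = 1 + σ * bend σ p ^ 2 := Real.sq_sqrt h1.le
  set u : ℂ := ⟨-cobend σ p / D, bend σ p⟩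
  have hu : ‖u‖ = 1 := by
    rw [Complex.norm_eq_sqrt_sq_add_sq, Real.sqrt_eq_one]
    simp only [u]
    rw [div_pow, neg_sq, h2, ← hD2]; field_simp; ring
  have hu0 : u ≠ 0 := by intro h; simp [h] at hu
  have hs : bend σ p = Real.sin u.arg := by rw [Complex.sin_arg, hu]; simp [u]
  refine ⟨u.arg, hs, ?_⟩
  rw [delta, ← hs, ← hD, Complex.cos_arg hu0, hu]
  simp only [u]; field_simp

theorem IsAngle.cos_eq (hσ : 0 < σ) (h : IsAngle σ p a) :
    Real.cos a = -cobend σ p / √(1 + σ * bend σ p ^ 2) := by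
  have := (delta_pos hσ a).ne'
  rw [h.2, h.1, ← delta]; field_simp

theorem IsAngle.eq_add_two_pi_mul (hσ : 0 < σ) {b : ℝ} (ha : IsAngle σ p a) (hb : IsAngle σ p b) :
    ∃ k : ℤ, b = a + k * (2 * Real.pi) := by
  have h1 : Real.cos a = Real.cos b := (ha.cos_eq hσ).trans (hb.cos_eq hσ).symm
  have h2 : Real.sin a = Real.sin b := ha.1.symm.trans hb.1
  have h3 := Real.Angle.cos_sin_inj h1 h2
  obtain ⟨k, hk⟩ := Real.Angle.angle_eq_iff_two_pi_dvd_sub.1 h3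
  exact ⟨-k, by push_cast; linarith⟩

theorem IsAngle.add_two_pi_mul (h : IsAngle σ p a) (k : ℤ) :
    IsAngle σ p (a + k * (2 * Real.pi)) := by
  unfold IsAngle delta at *
  rw [Real.sin_add_int_mul_two_pi, Real.cos_add_int_mul_two_pi]; exact h

/-- The generator of the real periods. -/
def periodVec (σ : ℝ) : E3 :=
  !₂[4 * shiftFn σ (Real.pi / 2), 0, 4 * heightFn σ (Real.pi / 2)]

/-- Only the two elliptic integrals see the choice of angle, so changing it is a translation. This
identifies the period vector. -/
theorem position_add_two_pi_mul (hσ : 0 < σ) (p : ℂ × ℂ) (a : ℝ) (k : ℤ) :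
    position σ p (a + k * (2 * Real.pi)) = position σ p a + k • periodVec σ := by
  unfold position periodVec
  rw [shiftFn_add_two_pi_mul hσ, heightFn_add_two_pi_mul hσ]
  ext i; fin_cases i <;> (simp; try ring)

/-! ### The Weierstrass integral along paths -/

theorem one_div_gaussMap_sub (hσ : 0 < σ) (hp : p.1 ≠ 0) :
    1 / gaussMap σ p - gaussMap σ p =
      -(2 / √σ : ℝ) * (minusPart σ p * cosArg p + plusPart σ p * sinArg p * Complex.I) := by
  have h := fst_sub_div (σ := σ) hp
  have h0 : (√σ : ℂ) ≠ 0 := by exact_mod_cast (Real.sqrt_pos.2 hσ).ne'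
  have h1 : (σ : ℂ) = √σ * √σ := by exact_mod_cast (Real.mul_self_sqrt hσ.le).symm
  have h2 : (minusPart σ p * cosArg p + plusPart σ p * sinArg p * Complex.I : ℂ) =
    (p.1 - σ / p.1) / 2 := by rw [h]; ring
  rw [h2, h1]
  unfold gaussMap
  push_cast
  field_simp
  ring

theorem one_div_gaussMap_add (hσ : 0 < σ) (hp : p.1 ≠ 0) :
    1 / gaussMap σ p + gaussMap σ p =
      (2 / √σ : ℝ) * (plusPart σ p * cosArg p + minusPart σ p * sinArg p * Complex.I) := by
  have h := fst_add_div (σ := σ) hp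
  have h0 : (√σ : ℂ) ≠ 0 := by exact_mod_cast (Real.sqrt_pos.2 hσ).ne'
  have h1 : (σ : ℂ) = √σ * √σ := by exact_mod_cast (Real.mul_self_sqrt hσ.le).symm
  have h2 : (plusPart σ p * cosArg p + minusPart σ p * sinArg p * Complex.I : ℂ) =
    (p.1 + σ / p.1) / 2 := by rw [h]; ring
  rw [h2, h1]
  unfold gaussMap
  push_cast
  field_simp
  ring

theorem weierVec_eq (hσ : 0 < σ) (hp : p.1 ≠ 0) (ζ : ℂ) :
    weierVec σ p ζ = !₂[(plusPart σ p * sinArg p * ζ.im - minusPart σ p * cosArg p * ζ.re) / √σ,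
      -(plusPart σ p * cosArg p * ζ.im + minusPart σ p * sinArg p * ζ.re) / √σ, ζ.re] := by
  unfold weierVec
  rw [one_div_gaussMap_sub hσ hp, one_div_gaussMap_add hσ hp]
  have h0 : √σ ≠ 0 := (Real.sqrt_pos.2 hσ).ne'
  ext i; fin_cases i
  · simp; field_simp
  · simp; field_simp; ring
  · simp

/-- The derivative of -mμ/√σ differs from Re φ₁ by exactly √σ μ² Re ζ, because k² - m² = σ. With
angular speed δ Re ζ this defect is the derivative of `shiftFn`, which explains its integrand. -/
theorem hasDerivAt_position (hσ : 0 < σ) {γ : ℝ → ℂ × ℂ} {ζ : ℂ} {t : ℝ} {α : ℝ → ℝ}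
    (hp : γ t ∈ puncturedCurve σ) (hγ : HasDerivAt γ (ζ • flowField σ (γ t)) t)
    (hα : IsAngle σ (γ t) (α t)) (hd : HasDerivAt α (delta σ (α t) * ζ.re) t) :
    HasDerivAt (fun s => position σ (γ s) (α s)) (weierVec σ (γ t) ζ) t := by
  have h0 : √σ ≠ 0 := (Real.sqrt_pos.2 hσ).ne'
  have h00 : √σ ^ 2 = σ := Real.sq_sqrt hσ.le
  have hD := (delta_pos hσ (α t)).ne'
  rw [weierVec_eq hσ hp.2]
  refine hasDerivAt_e3 ?_ ?_ ?_
  · refine (((hasDerivAt_shiftFn hσ (α t)).comp t hd).sub (((hasDerivAt_minusPart hp hγ).mul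
      (hasDerivAt_bend hσ hp hγ)).div_const _)).congr_deriv ?_
    rw [← hα.1, ← bend_mul_im hσ hp]
    simp only [Complex.mul_re]
    rw [hQuot_re hσ hp.2]
    have h3 : cobend σ (γ t) = minusPart σ (γ t) * bend σ (γ t) ^ 2 - cosArg (γ t) := rfl
    have h5 := plusPart_sq (σ := σ) hp.2
    rw [h3]
    field_simp
    rw [h00]
    linear_combination - bend σ (γ t) ^ 2 * ζ.re * h5
  · exact ((hasDerivAt_hQuot_im hp hγ).neg.div_const _)
  · refine ((hasDerivAt_heightFn hσ (α t)).comp t hd).congr_deriv ?_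
    field_simp

/-- The cosine of an angular coordinate. -/
def angleCos (σ : ℝ) (p : ℂ × ℂ) : ℝ := -cobend σ p / √(1 + σ * bend σ p ^ 2)

theorem hasDerivAt_angleCos (hσ : 0 < σ) {γ : ℝ → ℂ × ℂ} {ζ : ℂ} {t : ℝ}
    (hp : γ t ∈ puncturedCurve σ) (hγ : HasDerivAt γ (ζ • flowField σ (γ t)) t) :
    HasDerivAt (fun s => angleCos σ (γ s))
      (-(bend σ (γ t) * (√(1 + σ * bend σ (γ t) ^ 2) * ζ.re))) t := by
  have h1 : 0 < 1 + σ * bend σ (γ t) ^ 2 := by positivity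
  have h2 := oval_eq hσ hp
  have hb := hasDerivAt_bend hσ hp hγ
  have hD : HasDerivAt (fun s => √(1 + σ * bend σ (γ s) ^ 2)) _ t :=
    (((hb.pow 2).const_mul σ).const_add 1).sqrt h1.ne'
  have hD0 : 0 < √(1 + σ * bend σ (γ t) ^ 2) := Real.sqrt_pos.2 h1
  have hD2 : √(1 + σ * bend σ (γ t) ^ 2) ^ 2 = 1 + σ * bend σ (γ t) ^ 2 := Real.sq_sqrt h1.le
  refine ((hasDerivAt_cobend hσ hp hγ).neg.div hD hD0.ne').congr_deriv ?_
  simp only [Pi.pow_apply]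
  generalize √(1 + σ * bend σ (γ t) ^ 2) = D at *
  field_simp
  simp
  linear_combination -(2 * ζ.re * σ * bend σ (γ t)) * h2 + 2 * ζ.re * bend σ (γ t) *
    (σ - 1 - 2 * σ * bend σ (γ t) ^ 2 + D ^ 2 + 1 + σ * bend σ (γ t) ^ 2) * hD2

theorem angleCos_sq_add_bend_sq (hσ : 0 < σ) (hp : p ∈ puncturedCurve σ) :
    angleCos σ p ^ 2 + bend σ p ^ 2 = 1 := by
  have h1 : 0 < 1 + σ * bend σ p ^ 2 := by positivity
  rw [angleCos, div_pow, neg_sq, oval_eq hσ hp, Real.sq_sqrt h1.le]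
  field_simp; ring

theorem isAngle_iff (hσ : 0 < σ) :
    IsAngle σ p a ↔ angleCos σ p = Real.cos a ∧ bend σ p = Real.sin a := by
  refine ⟨fun h => ⟨(h.cos_eq hσ).symm, h.1⟩, fun h => ⟨h.2, ?_⟩⟩
  have := (delta_pos hσ a).ne'
  rw [← h.1, angleCos, h.2, ← delta]; field_simp

/-- Differentiating sin a and cos a along the curve gives cos a · a' and sin a · a'. The combination
with cos² + sin² = 1 determines a' without division. -/
theorem hasDerivAt_angle (hσ : 0 < σ) {γ : ℝ → ℂ × ℂ} {ζ : ℂ} {t : ℝ} {α : ℝ → ℝ}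
    (hp : γ t ∈ puncturedCurve σ) (hγ : HasDerivAt γ (ζ • flowField σ (γ t)) t)
    (hα : ∀ᶠ s in 𝓝 t, IsAngle σ (γ s) (α s)) (hd : DifferentiableAt ℝ α t) :
    HasDerivAt α (delta σ (α t) * ζ.re) t := by
  have hαt := hα.self_of_nhds
  have h1 := (hasDerivAt_bend hσ hp hγ).unique (hd.hasDerivAt.sin.congr_of_eventuallyEq
    (by filter_upwards [hα] with s hs using hs.1))
  have h2 := (hasDerivAt_angleCos hσ hp hγ).unique (hd.hasDerivAt.cos.congr_of_eventuallyEq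
    (by filter_upwards [hα] with s hs using ((isAngle_iff hσ).1 hs).1))
  rw [hαt.1] at h2
  rw [hαt.2] at h1
  rw [← delta] at h2
  refine hd.hasDerivAt.congr_deriv ?_
  linear_combination -Real.cos (α t) * h1 + Real.sin (α t) * h2 -
    (deriv α t - delta σ (α t) * ζ.re) * Real.sin_sq_add_cos_sq (α t)

end RiemannMinimal

namespace RiemannMinimal

/-! ### Continuity of the real coordinates -/

section Continuity

variable {σ : ℝ} {X : Type*} [TopologicalSpace X] {f : X → ℂ × ℂ} {s : Set X}

theorem continuousOn_norm_fst (hf : ContinuousOn f s) : ContinuousOn (fun x => ‖(f x).1‖) s :=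
  (continuous_fst.comp_continuousOn hf).norm

theorem continuousOn_hQuot (hf : ContinuousOn f s) (h0 : ∀ x ∈ s, (f x).1 ≠ 0) :
    ContinuousOn (fun x => hQuot (f x)) s :=
  (continuous_snd.comp_continuousOn hf).div (continuous_fst.comp_continuousOn hf) h0

theorem continuousOn_plusPart (hf : ContinuousOn f s) (h0 : ∀ x ∈ s, (f x).1 ≠ 0) :
    ContinuousOn (fun x => plusPart σ (f x)) s :=
  ((continuousOn_norm_fst hf).add (continuousOn_const.div (continuousOn_norm_fst hf)
    fun x hx => norm_ne_zero_iff.2 (h0 x hx))).div_const _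

theorem continuousOn_minusPart (hf : ContinuousOn f s) (h0 : ∀ x ∈ s, (f x).1 ≠ 0) :
    ContinuousOn (fun x => minusPart σ (f x)) s :=
  ((continuousOn_norm_fst hf).sub (continuousOn_const.div (continuousOn_norm_fst hf)
    fun x hx => norm_ne_zero_iff.2 (h0 x hx))).div_const _

theorem continuousOn_cosArg (hf : ContinuousOn f s) (h0 : ∀ x ∈ s, (f x).1 ≠ 0) :
    ContinuousOn (fun x => cosArg (f x)) s :=
  (Complex.continuous_re.comp_continuousOn (continuous_fst.comp_continuousOn hf)).div
    (continuousOn_norm_fst hf) fun x hx => norm_ne_zero_iff.2 (h0 x hx)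

theorem continuousOn_bend (hσ : 0 < σ) (hf : ContinuousOn f s) (h0 : ∀ x ∈ s, (f x).1 ≠ 0) :
    ContinuousOn (fun x => bend σ (f x)) s :=
  (Complex.continuous_re.comp_continuousOn (continuousOn_hQuot hf h0)).div
    (continuousOn_plusPart hf h0) fun x hx => (plusPart_pos hσ (h0 x hx)).ne'

theorem continuousOn_cobend (hσ : 0 < σ) (hf : ContinuousOn f s) (h0 : ∀ x ∈ s, (f x).1 ≠ 0) :
    ContinuousOn (fun x => cobend σ (f x)) s :=
  ((continuousOn_minusPart hf h0).mul ((continuousOn_bend hσ hf h0).pow 2)).sub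
    (continuousOn_cosArg hf h0)

theorem continuousOn_angleCos (hσ : 0 < σ) (hf : ContinuousOn f s) (h0 : ∀ x ∈ s, (f x).1 ≠ 0) :
    ContinuousOn (fun x => angleCos σ (f x)) s :=
  (continuousOn_cobend hσ hf h0).neg.div
    (continuousOn_const.add (continuousOn_const.mul ((continuousOn_bend hσ hf h0).pow 2))).sqrt
    fun x _ => (Real.sqrt_pos.2 (by positivity)).ne'

theorem continuousOn_position (hσ : 0 < σ) (hf : ContinuousOn f s) (h0 : ∀ x ∈ s, (f x).1 ≠ 0)
    {α : X → ℝ} (hα : ContinuousOn α s) : ContinuousOn (fun x => position σ (f x) (α x)) s :=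
  continuousOn_e3
    (((contDiff_shiftFn hσ).continuous.comp_continuousOn hα).sub
      (((continuousOn_minusPart hf h0).mul (continuousOn_bend hσ hf h0)).div_const _))
    ((Complex.continuous_im.comp_continuousOn (continuousOn_hQuot hf h0)).neg.div_const _)
    ((contDiff_heightFn hσ).continuous.comp_continuousOn hα)

theorem continuousOn_weierVec (hσ : 0 < σ) (hf : ContinuousOn f s) (h0 : ∀ x ∈ s, (f x).1 ≠ 0)
    {ζ : X → ℂ} (hζ : ContinuousOn ζ s) : ContinuousOn (fun x => weierVec σ (f x) (ζ x)) s := by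
  have hs : (√σ : ℂ) ≠ 0 := by exact_mod_cast (Real.sqrt_pos.2 hσ).ne'
  have hg : ContinuousOn (fun x => gaussMap σ (f x)) s :=
    (continuous_fst.comp_continuousOn hf).div_const _
  have hg' : ContinuousOn (fun x => 1 / gaussMap σ (f x)) s :=
    continuousOn_const.div hg fun x hx => div_ne_zero (h0 x hx) hs
  exact continuousOn_e3
    (Complex.continuous_re.comp_continuousOn ((continuousOn_const.mul (hg'.sub hg)).mul hζ))
    (Complex.continuous_re.comp_continuousOn ((continuousOn_const.mul (hg'.add hg)).mul hζ))
    (Complex.continuous_re.comp_continuousOn hζ)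

end Continuity

/-! ### Integration along paths of the curve -/

/-- A formula for `φ₃` on tangent vectors that is visibly continuous. -/
def phi3Reg (σ : ℝ) (p v : ℂ × ℂ) : ℂ :=
  (star p.2 * v.1 + star (cubicDeriv σ p.1 / 2) * v.2) /
    (star p.2 * p.2 + star (cubicDeriv σ p.1 / 2) * (cubicDeriv σ p.1 / 2))

variable {σ : ℝ} {p : ℂ × ℂ} {a : ℝ}

theorem phi3Reg_denom_ne_zero (hσ : 0 < σ) (hp : p ∈ puncturedCurve σ) :
    star p.2 * p.2 + star (cubicDeriv σ p.1 / 2) * (cubicDeriv σ p.1 / 2) ≠ 0 := by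
  have h : ∀ z : ℂ, star z * z = (Complex.normSq z : ℝ) := fun z => by
    rw [mul_comm]; exact Complex.mul_conj z
  rw [h, h]
  intro h2
  have h3 : Complex.normSq p.2 + Complex.normSq (cubicDeriv σ p.1 / 2) = 0 := by exact_mod_cast h2
  have h4 := Complex.normSq_nonneg p.2
  have h5 := Complex.normSq_nonneg (cubicDeriv σ p.1 / 2)
  have h6 : p.2 = 0 := Complex.normSq_eq_zero.1 (by linarith)
  have h7 : cubicDeriv σ p.1 / 2 = 0 := Complex.normSq_eq_zero.1 (by linarith)
  exact cubicDeriv_ne_zero hσ hp h6 (by simpa using h7)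

/-- `phi3Reg` is the coefficient of the Hermitian projection onto `flowField`, so it agrees with
`phi3` on multiples of that field. Unlike the case distinction at w = 0 it is continuous across the
branch points. -/
theorem phi3_eq_phi3Reg (hσ : 0 < σ) (hp : p ∈ puncturedCurve σ) {v : ℂ × ℂ}
    (hv : v = phi3 σ p v • flowField σ p) : phi3 σ p v = phi3Reg σ p v := by
  have h := phi3Reg_denom_ne_zero hσ hp
  rw [phi3Reg, eq_div_iff h]
  have h1 : v.1 = phi3 σ p v * p.2 := congrArg Prod.fst hv
  have h2 : v.2 = phi3 σ p v * (cubicDeriv σ p.1 / 2) := congrArg Prod.snd hv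
  generalize phi3 σ p v = ζ at *
  rw [h1, h2]
  ring

section Paths

variable {γ : ℝ → ℂ × ℂ}

/-- The path lies on the curve only for parameters in [0, 1], so its velocity is known to be tangent
only in the interior. -/
theorem IsCurvePath.hasDerivAt (hσ : 0 < σ) (hγ : IsCurvePath σ γ) {t : ℝ}
    (ht : t ∈ Ioo (0 : ℝ) 1) :
    HasDerivAt γ (phi3Reg σ (γ t) (deriv γ t) • flowField σ (γ t)) t ∧
      reForm σ (γ t) (deriv γ t) = weierVec σ (γ t) (phi3Reg σ (γ t) (deriv γ t)) := by
  have h1 : HasDerivAt γ (deriv γ t) t := (hγ.1.differentiable one_ne_zero t).hasDerivAt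
  have h2 : ∀ᶠ s in 𝓝 t, γ s ∈ puncturedCurve σ := by
    filter_upwards [Ioo_mem_nhds ht.1 ht.2] with s hs using hγ.2 s (Ioo_subset_Icc_self hs)
  have hp := hγ.2 t (Ioo_subset_Icc_self ht)
  have h3 := eq_phi3_smul_flowField hσ hp (tangent_of_hasDerivAt h1 h2)
  have h4 := phi3_eq_phi3Reg hσ hp h3
  rw [reForm_eq, ← h4]
  exact ⟨h3 ▸ h1, rfl⟩

theorem IsCurvePath.continuousOn_phi3Reg (hσ : 0 < σ) (hγ : IsCurvePath σ γ) :
    ContinuousOn (fun t => phi3Reg σ (γ t) (deriv γ t)) (Icc 0 1) := by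
  have h1 : Continuous γ := hγ.1.continuous
  have h2 : Continuous (deriv γ) := hγ.1.continuous_deriv le_rfl
  have hP : Continuous fun t => cubicDeriv σ (γ t).1 / 2 := by unfold cubicDeriv; fun_prop
  refine ContinuousOn.div (Continuous.continuousOn ?_) (Continuous.continuousOn ?_)
    fun t ht => phi3Reg_denom_ne_zero hσ (hγ.2 t ht)
  · exact (h1.snd.star.mul h2.fst).add (hP.star.mul h2.snd)
  · exact (h1.snd.star.mul h1.snd).add (hP.star.mul hP)

theorem IsCurvePath.reIntegral_eq (hσ : 0 < σ) (hγ : IsCurvePath σ γ) {α : ℝ → ℝ}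
    (hc : ContinuousOn α (Icc 0 1)) (hd : ∀ t ∈ Ioo (0 : ℝ) 1, DifferentiableAt ℝ α t)
    (hα : ∀ t ∈ Icc (0 : ℝ) 1, IsAngle σ (γ t) (α t)) :
    reIntegral σ γ = position σ (γ 1) (α 1) - position σ (γ 0) (α 0) := by
  have h1 : ContinuousOn γ (Icc 0 1) := hγ.1.continuous.continuousOn
  have h0 : ∀ t ∈ Icc (0 : ℝ) 1, (γ t).1 ≠ 0 := fun t ht => (hγ.2 t ht).2
  have hV := continuousOn_weierVec hσ h1 h0 (hγ.continuousOn_phi3Reg hσ)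
  have hae : ∀ᵐ t, t ∈ uIoc (0 : ℝ) 1 → reForm σ (γ t) (deriv γ t) =
      weierVec σ (γ t) (phi3Reg σ (γ t) (deriv γ t)) := by
    -- The integral runs over (0, 1], and tangency is available on (0, 1); the single endpoint 1 is
    -- discarded.
    have : ∀ᵐ t : ℝ, t ≠ 1 := by simp [ae_iff]
    filter_upwards [this] with t ht1 ht
    rw [uIoc_of_le zero_le_one] at ht
    exact (hγ.hasDerivAt hσ ⟨ht.1, lt_of_le_of_ne ht.2 ht1⟩).2
  unfold reIntegral
  rw [intervalIntegral.integral_congr_ae hae]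
  refine intervalIntegral.integral_eq_sub_of_hasDerivAt_of_le
    (f := fun t => position σ (γ t) (α t)) zero_le_one (continuousOn_position hσ h1 h0 hc)
    (fun t ht => ?_) (hV.intervalIntegrable_of_Icc zero_le_one)
  have h2 := (hγ.hasDerivAt hσ ht).1
  have hp := hγ.2 t (Ioo_subset_Icc_self ht)
  refine hasDerivAt_position hσ hp h2 (hα t (Ioo_subset_Icc_self ht))
    (hasDerivAt_angle hσ hp h2 ?_ (hd t ht))
  filter_upwards [Ioo_mem_nhds ht.1 ht.2] with s hs using hα s (Ioo_subset_Icc_self hs)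

/-- Lifting of paths to the angular coordinate. -/
theorem IsCurvePath.exists_angle (hσ : 0 < σ) (hγ : IsCurvePath σ γ) (ha : IsAngle σ (γ 0) a) :
    ∃ α : ℝ → ℝ, α 0 = a ∧ Continuous α ∧ (∀ t ∈ Ioo (0 : ℝ) 1, DifferentiableAt ℝ α t) ∧
      ∀ t ∈ Icc (0 : ℝ) 1, IsAngle σ (γ t) (α t) := by
  have h1 : ContinuousOn γ (Icc 0 1) := hγ.1.continuous.continuousOn
  have h0 : ∀ t ∈ Icc (0 : ℝ) 1, (γ t).1 ≠ 0 := fun t ht => (hγ.2 t ht).2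
  have hb := continuousOn_bend hσ h1 h0
  have hcs := continuousOn_angleCos hσ h1 h0
  -- This is the required angular speed δ Re ζ, with δ expressed by `bend`. It does not involve the
  -- unknown angle, so α is a plain integral and no differential equation has to be solved.
  set f : ℝ → ℝ := fun t => √(1 + σ * bend σ (γ t) ^ 2) * (phi3Reg σ (γ t) (deriv γ t)).re with hf
  have hfc : ContinuousOn f (Icc 0 1) :=
    (continuousOn_const.add (continuousOn_const.mul (hb.pow 2))).sqrt.mul
      (Complex.continuous_re.comp_continuousOn (hγ.continuousOn_phi3Reg hσ))
  set F : ℝ → ℝ := IccExtend zero_le_one ((Icc (0 : ℝ) 1).domRestrict f)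
  have hFc : Continuous F := hfc.domRestrict.Icc_extend'
  have hFf : ∀ t ∈ Icc (0 : ℝ) 1, F t = f t := fun t ht => IccExtend_of_mem _ _ ht
  set α : ℝ → ℝ := fun t => a + ∫ x in (0 : ℝ)..t, F x
  have hαd : ∀ t, HasDerivAt α (F t) t := fun t =>
    (hFc.integral_hasStrictDerivAt 0 t).hasDerivAt.const_add a
  have hα0 : α 0 = a := by simp [α]
  have hαc : Continuous α := continuous_iff_continuousAt.2 fun t => (hαd t).continuousAt
  refine ⟨α, hα0, hαc, fun t _ => (hαd t).differentiableAt, ?_⟩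
  -- The cosine of the difference between α and the angle of γ. Both turn at the same speed, so g
  -- keeps its initial value 1.
  set g : ℝ → ℝ := fun t => angleCos σ (γ t) * Real.cos (α t) + bend σ (γ t) * Real.sin (α t)
  have hgc : ContinuousOn g (Icc 0 1) :=
    (hcs.mul (Real.continuous_cos.comp hαc).continuousOn).add
      (hb.mul (Real.continuous_sin.comp hαc).continuousOn)
  have hgd : ∀ t ∈ Ioo (0 : ℝ) 1, HasDerivAt g 0 t := fun t ht => by
    have h2 := (hγ.hasDerivAt hσ ht).1
    have hp := hγ.2 t (Ioo_subset_Icc_self ht)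
    have h3 := hαd t
    rw [hFf t (Ioo_subset_Icc_self ht)] at h3
    refine (((hasDerivAt_angleCos hσ hp h2).mul h3.cos).add
      ((hasDerivAt_bend hσ hp h2).mul h3.sin)).congr_deriv ?_
    have hD : √(1 + σ * bend σ (γ t) ^ 2) ≠ 0 := (Real.sqrt_pos.2 (by positivity)).ne'
    have h4 : cobend σ (γ t) = -(angleCos σ (γ t) * √(1 + σ * bend σ (γ t) ^ 2)) := by
      unfold angleCos; field_simp
    rw [h4]; simp only [hf]; ring
  have hg0 : g 0 = 1 := by
    have h2 := (isAngle_iff hσ).1 ha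
    simp only [g, hα0, h2.1, h2.2]
    linarith [Real.sin_sq_add_cos_sq a]
  intro t ht
  have hgt : g t = 1 := by
    have := intervalIntegral.integral_eq_sub_of_hasDerivAt_of_le (f := g) (f' := fun _ => 0) ht.1
      (hgc.mono (Icc_subset_Icc_right ht.2)) (fun x hx => hgd x ⟨hx.1, hx.2.trans_le ht.2⟩)
      intervalIntegrable_const
    simp at this
    linarith
  have h5 := angleCos_sq_add_bend_sq hσ (hγ.2 t ht)
  have h6 := Real.sin_sq_add_cos_sq (α t)
  -- The squared distance between two points of the unit circle is 2 - 2g.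
  have h7 : (angleCos σ (γ t) - Real.cos (α t)) ^ 2 + (bend σ (γ t) - Real.sin (α t)) ^ 2 = 0 := by
    linear_combination h5 + h6 - 2 * hgt
  rw [isAngle_iff hσ]
  constructor
  · nlinarith [sq_nonneg (angleCos σ (γ t) - Real.cos (α t)),
      sq_nonneg (bend σ (γ t) - Real.sin (α t))]
  · nlinarith [sq_nonneg (angleCos σ (γ t) - Real.cos (α t)),
      sq_nonneg (bend σ (γ t) - Real.sin (α t))]

theorem IsCurvePath.exists_reIntegral_eq (hσ : 0 < σ) (hγ : IsCurvePath σ γ)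
    (ha : IsAngle σ (γ 0) a) :
    ∃ b, IsAngle σ (γ 1) b ∧ reIntegral σ γ = position σ (γ 1) b - position σ (γ 0) a := by
  obtain ⟨α, h0, h1, h2, h3⟩ := hγ.exists_angle hσ ha
  refine ⟨α 1, h3 1 (by simp), ?_⟩
  rw [hγ.reIntegral_eq hσ h1.continuousOn h2 h3, h0]

end Paths

/-! ### Recovering a point of the curve from its real coordinates -/

/-- The point of the curve with coordinates `bend = μ`, `cobend = ν`, `minusPart = m` and
`Im (w / z) = v`. -/
def curvePoint (σ μ ν m v : ℝ) : ℂ × ℂ :=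
  (((m + √(m ^ 2 + σ) : ℝ) : ℂ) * ((m * μ ^ 2 - ν : ℝ) + (μ * v : ℝ) * Complex.I),
    ((m + √(m ^ 2 + σ) : ℝ) : ℂ) * ((m * μ ^ 2 - ν : ℝ) + (μ * v : ℝ) * Complex.I) *
      ((√(m ^ 2 + σ) * μ : ℝ) + (v : ℝ) * Complex.I))

/-- The equation of the fibre of `(bend, cobend)` in the coordinates `minusPart`, `Im (w / z)`. -/
def IsConic (σ μ ν m v : ℝ) : Prop :=
  μ ^ 2 * m ^ 2 - 2 * m * ν + v ^ 2 + (σ - 1) - σ * μ ^ 2 = 0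

section CurvePoint

variable {μ ν m v : ℝ}

theorem add_sqrt_pos (hσ : 0 < σ) (m : ℝ) : 0 < m + √(m ^ 2 + σ) := by
  have : |m| < √(m ^ 2 + σ) := by
    rw [← Real.sqrt_sq_eq_abs]; exact Real.sqrt_lt_sqrt (sq_nonneg m) (by linarith)
  linarith [neg_abs_le m]

/-- The oval equation plus μ² times the conic says that the second factor of z has modulus 1. The
first factor is the positive solution r of r - σ/r = 2m. -/
theorem norm_curvePoint_fst (hσ : 0 < σ) (ho : ν ^ 2 = (1 - μ ^ 2) * (1 + σ * μ ^ 2))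
    (hc : IsConic σ μ ν m v) : ‖(curvePoint σ μ ν m v).1‖ = m + √(m ^ 2 + σ) := by
  have h1 : (m * μ ^ 2 - ν) ^ 2 + (μ * v) ^ 2 = 1 := by
    unfold IsConic at hc; linear_combination ho + μ ^ 2 * hc
  have h2 := add_sqrt_pos hσ m
  unfold curvePoint
  rw [norm_mul, Complex.norm_real, Real.norm_of_nonneg h2.le, Complex.norm_add_mul_I, h1]
  simp

theorem curvePoint_fst_ne_zero (hσ : 0 < σ) (ho : ν ^ 2 = (1 - μ ^ 2) * (1 + σ * μ ^ 2))
    (hc : IsConic σ μ ν m v) : (curvePoint σ μ ν m v).1 ≠ 0 := by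
  rw [← norm_pos_iff, norm_curvePoint_fst hσ ho hc]; exact add_sqrt_pos hσ m

theorem curvePoint_mem (hσ : 0 < σ) (ho : ν ^ 2 = (1 - μ ^ 2) * (1 + σ * μ ^ 2))
    (hc : IsConic σ μ ν m v) : curvePoint σ μ ν m v ∈ puncturedCurve σ := by
  refine ⟨?_, curvePoint_fst_ne_zero hσ ho hc⟩
  have hk : √(m ^ 2 + σ) ^ 2 = m ^ 2 + σ := Real.sq_sqrt (by positivity)
  have h1 : (m * μ ^ 2 - ν) ^ 2 + (μ * v) ^ 2 = 1 := by
    unfold IsConic at hc; linear_combination ho + μ ^ 2 * hc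
  unfold curvePoint
  generalize √(m ^ 2 + σ) = k at *
  unfold IsConic at hc
  have hkc : (k : ℂ) ^ 2 = m ^ 2 + σ := by exact_mod_cast hk
  have h1c : ((m : ℂ) * μ ^ 2 - ν) ^ 2 + (μ * v) ^ 2 = 1 := by exact_mod_cast h1
  have hcc : (μ : ℂ) ^ 2 * m ^ 2 - 2 * m * ν + v ^ 2 + (σ - 1) - σ * μ ^ 2 = 0 := by
    exact_mod_cast hc
  have hI := Complex.I_sq
  push_cast
  set c : ℂ := (m : ℂ) * μ ^ 2 - ν with hcdef
  set s : ℂ := (μ : ℂ) * v with hs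
  -- With w = h z, the equation of the curve divided by z reads h² z = (z - 1)(z + σ). The conic
  -- gives h², and σ/z comes from (m + k)(k - m) = σ and the unit modulus of c + s i.
  have e1 : ((k : ℂ) * μ + v * Complex.I) ^ 2 * ((m + k) * (c + s * Complex.I)) =
      ((m + k) * (c + s * Complex.I) - 1) * ((m + k) * (c + s * Complex.I) + σ) := by
    have e2 : ((k : ℂ) * μ + v * Complex.I) ^ 2 = 2 * m * c + 2 * k * s * Complex.I + (σ - 1) := by
      rw [hcdef, hs]
      linear_combination (v : ℂ) ^ 2 * hI + (μ : ℂ) ^ 2 * hkc - hcc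
    have e3 : ((m : ℂ) + k) * (k - m) = σ := by linear_combination hkc
    have e4 : (c + s * Complex.I) * (c - s * Complex.I) = 1 := by
      linear_combination h1c - s ^ 2 * hI
    rw [e2]
    linear_combination -((m : ℂ) + k) * (k - m) * e4 - e3
  linear_combination ((m : ℂ) + k) * (c + s * Complex.I) * e1

theorem hQuot_curvePoint (hσ : 0 < σ) (ho : ν ^ 2 = (1 - μ ^ 2) * (1 + σ * μ ^ 2))
    (hc : IsConic σ μ ν m v) :
    hQuot (curvePoint σ μ ν m v) = (√(m ^ 2 + σ) * μ : ℝ) + (v : ℝ) * Complex.I := by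
  have h := curvePoint_fst_ne_zero hσ ho hc
  rw [hQuot, div_eq_iff h, mul_comm]; rfl

theorem div_add_sqrt (hσ : 0 < σ) (m : ℝ) : σ / (m + √(m ^ 2 + σ)) = √(m ^ 2 + σ) - m := by
  rw [div_eq_iff (add_sqrt_pos hσ m).ne']
  have hk : √(m ^ 2 + σ) ^ 2 = m ^ 2 + σ := Real.sq_sqrt (by positivity)
  linear_combination -hk

theorem minusPart_curvePoint (hσ : 0 < σ) (ho : ν ^ 2 = (1 - μ ^ 2) * (1 + σ * μ ^ 2))
    (hc : IsConic σ μ ν m v) : minusPart σ (curvePoint σ μ ν m v) = m := by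
  rw [minusPart, norm_curvePoint_fst hσ ho hc, div_add_sqrt hσ]; ring

theorem bend_curvePoint (hσ : 0 < σ) (ho : ν ^ 2 = (1 - μ ^ 2) * (1 + σ * μ ^ 2))
    (hc : IsConic σ μ ν m v) : bend σ (curvePoint σ μ ν m v) = μ := by
  have h0 : 0 < √(m ^ 2 + σ) := Real.sqrt_pos.2 (by positivity)
  rw [bend, plusPart, norm_curvePoint_fst hσ ho hc, div_add_sqrt hσ, hQuot_curvePoint hσ ho hc]
  generalize √(m ^ 2 + σ) = k at *
  rw [show (m + k + (k - m)) / 2 = k by ring]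
  simp
  field_simp

theorem cobend_curvePoint (hσ : 0 < σ) (ho : ν ^ 2 = (1 - μ ^ 2) * (1 + σ * μ ^ 2))
    (hc : IsConic σ μ ν m v) : cobend σ (curvePoint σ μ ν m v) = ν := by
  have h2 := (add_sqrt_pos hσ m).ne'
  rw [cobend, bend_curvePoint hσ ho hc, minusPart_curvePoint hσ ho hc, cosArg,
    norm_curvePoint_fst hσ ho hc]
  simp [curvePoint]
  field_simp
  simp [← Complex.ofReal_pow]

/-- No point of the curve is lost: the oval coordinates together with m and Im h determine it. -/
theorem eq_curvePoint (hσ : 0 < σ) (hp : p ∈ puncturedCurve σ) :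
    p = curvePoint σ (bend σ p) (cobend σ p) (minusPart σ p) (hQuot p).im := by
  have h1 : √(minusPart σ p ^ 2 + σ) = plusPart σ p := by
    rw [← plusPart_sq hp.2]; exact Real.sqrt_sq (plusPart_pos hσ hp.2).le
  have h2 : minusPart σ p + plusPart σ p = ‖p.1‖ := by unfold minusPart plusPart; ring
  have h3 : minusPart σ p * bend σ p ^ 2 - cobend σ p = cosArg p := by unfold cobend; ring
  have h4 := fst_eq hp.2
  have h5 : hQuot p = ((hQuot p).re : ℂ) + (hQuot p).im * Complex.I := (Complex.re_add_im _).symm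
  unfold curvePoint
  rw [h1, h2, h3, bend_mul_im hσ hp, ← hQuot_re hσ hp.2, ← h4, ← h5]
  ext1
  · rfl
  · rw [mul_comm]; exact snd_eq hp.2

theorem oval_of_angle (hσ : 0 < σ) (a : ℝ) : (-(Real.cos a * delta σ a)) ^ 2 =
    (1 - Real.sin a ^ 2) * (1 + σ * Real.sin a ^ 2) := by
  rw [neg_sq, mul_pow, delta_sq hσ, Real.cos_sq']

end CurvePoint

end RiemannMinimal

namespace RiemannMinimal

/-! ### Joining points of the curve with prescribed angles -/

variable {σ : ℝ} {p q : ℂ × ℂ} {a b : ℝ}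

/-- There is a path of the curve from `p` to `q` along which the angle varies from `a` to `b`. -/
def AngleJoined (σ : ℝ) (p : ℂ × ℂ) (a : ℝ) (q : ℂ × ℂ) (b : ℝ) : Prop :=
  ∃ (γ : ℝ → ℂ × ℂ) (α : ℝ → ℝ), IsCurvePath σ γ ∧ Differentiable ℝ α ∧
    (∀ t ∈ Icc (0 : ℝ) 1, IsAngle σ (γ t) (α t)) ∧ γ 0 = p ∧ α 0 = a ∧ γ 1 = q ∧ α 1 = b

theorem AngleJoined.trans {r : ℂ × ℂ} {c : ℝ} (h₁ : AngleJoined σ p a q b)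
    (h₂ : AngleJoined σ q b r c) : AngleJoined σ p a r c := by
  obtain ⟨γ₁, α₁, hγ₁, hα₁, ha₁, rfl, rfl, hq₁, hb₁⟩ := h₁
  obtain ⟨γ₂, α₂, hγ₂, hα₂, ha₂, hq₂, hb₂, rfl, rfl⟩ := h₂
  -- The first path is run in [0, 1/3] and the second in [2/3, 1], with a pause between. All
  -- derivatives of the reparameterizations vanish at the junctions, so adding the paths and
  -- subtracting the common point gives one C¹ formula.
  set φ₁ : ℝ → ℝ := fun t => Real.smoothTransition (3 * t)
  set φ₂ : ℝ → ℝ := fun t => Real.smoothTransition (3 * t - 2)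
  have hφ₁ : ContDiff ℝ 1 φ₁ := Real.smoothTransition.contDiff.comp (by fun_prop)
  have hφ₂ : ContDiff ℝ 1 φ₂ := Real.smoothTransition.contDiff.comp (by fun_prop)
  have m₁ : ∀ t, φ₁ t ∈ Icc (0 : ℝ) 1 := fun t =>
    ⟨Real.smoothTransition.nonneg _, Real.smoothTransition.le_one _⟩
  have m₂ : ∀ t, φ₂ t ∈ Icc (0 : ℝ) 1 := fun t =>
    ⟨Real.smoothTransition.nonneg _, Real.smoothTransition.le_one _⟩
  set γ : ℝ → ℂ × ℂ := fun t => γ₁ (φ₁ t) + γ₂ (φ₂ t) - q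
  set α : ℝ → ℝ := fun t => α₁ (φ₁ t) + α₂ (φ₂ t) - b
  have e₁ : ∀ t, t ≤ 1 / 2 → γ t = γ₁ (φ₁ t) ∧ α t = α₁ (φ₁ t) := fun t ht => by
    have : φ₂ t = 0 := Real.smoothTransition.zero_of_nonpos (by linarith)
    simp [γ, α, this, hq₂, hb₂]
  have e₂ : ∀ t, 1 / 2 ≤ t → γ t = γ₂ (φ₂ t) ∧ α t = α₂ (φ₂ t) := fun t ht => by
    have : φ₁ t = 1 := Real.smoothTransition.one_of_one_le (by linarith)
    simp [γ, α, this, hq₁, hb₁]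
  have z₁ : φ₁ 0 = 0 := Real.smoothTransition.zero_of_nonpos (by simp)
  have z₂ : φ₂ 1 = 1 := Real.smoothTransition.one_of_one_le (by norm_num)
  refine ⟨γ, α, ⟨?_, fun t _ => ?_⟩, ?_, fun t _ => ?_, ?_, ?_, ?_, ?_⟩
  · exact ((hγ₁.1.comp hφ₁).add (hγ₂.1.comp hφ₂)).sub contDiff_const
  · rcases le_total t (1 / 2) with ht | ht
    · rw [(e₁ t ht).1]; exact hγ₁.2 _ (m₁ t)
    · rw [(e₂ t ht).1]; exact hγ₂.2 _ (m₂ t)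
  · exact ((hα₁.comp (hφ₁.differentiable one_ne_zero)).add
      (hα₂.comp (hφ₂.differentiable one_ne_zero))).sub_const _
  · rcases le_total t (1 / 2) with ht | ht
    · rw [(e₁ t ht).1, (e₁ t ht).2]; exact ha₁ _ (m₁ t)
    · rw [(e₂ t ht).1, (e₂ t ht).2]; exact ha₂ _ (m₂ t)
  · rw [(e₁ 0 (by norm_num)).1, z₁]
  · rw [(e₁ 0 (by norm_num)).2, z₁]
  · rw [(e₂ 1 (by norm_num)).1, z₂]
  · rw [(e₂ 1 (by norm_num)).2, z₂]

/-- The point of the curve with angle `a` and the coordinates `minusPart = m`,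
`Im (w / z) = v`. -/
def anglePoint (σ a m v : ℝ) : ℂ × ℂ :=
  curvePoint σ (Real.sin a) (-(Real.cos a * delta σ a)) m v

/-- The equation of the fibre over the angle `a`. -/
def IsAngleConic (σ a m v : ℝ) : Prop :=
  IsConic σ (Real.sin a) (-(Real.cos a * delta σ a)) m v

theorem anglePoint_mem (hσ : 0 < σ) {m v : ℝ} (h : IsAngleConic σ a m v) :
    anglePoint σ a m v ∈ puncturedCurve σ := curvePoint_mem hσ (oval_of_angle hσ a) h

theorem isAngle_anglePoint (hσ : 0 < σ) {m v : ℝ} (h : IsAngleConic σ a m v) :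
    IsAngle σ (anglePoint σ a m v) a :=
  ⟨bend_curvePoint hσ (oval_of_angle hσ a) h, cobend_curvePoint hσ (oval_of_angle hσ a) h⟩

theorem eq_anglePoint (hσ : 0 < σ) (hp : p ∈ puncturedCurve σ) (ha : IsAngle σ p a) :
    p = anglePoint σ a (minusPart σ p) (hQuot p).im := by
  unfold anglePoint; rw [← ha.1, ← ha.2]; exact eq_curvePoint hσ hp

theorem isAngleConic_of_isAngle (hσ : 0 < σ) (hp : p ∈ puncturedCurve σ) (ha : IsAngle σ p a) :
    IsAngleConic σ a (minusPart σ p) (hQuot p).im := by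
  unfold IsAngleConic IsConic; rw [← ha.1, ← ha.2]; exact conic_eq hσ hp

theorem contDiff_anglePoint {n : ℕ∞} (hσ : 0 < σ) {α m v : ℝ → ℝ} (hα : ContDiff ℝ n α)
    (hm : ContDiff ℝ n m) (hv : ContDiff ℝ n v) :
    ContDiff ℝ n (fun t => anglePoint σ (α t) (m t) (v t)) := by
  have hμ : ContDiff ℝ n fun t => Real.sin (α t) := Real.contDiff_sin.comp hα
  have hν : ContDiff ℝ n fun t => -(Real.cos (α t) * delta σ (α t)) :=
    ((Real.contDiff_cos.comp hα).mul
      (((contDiff_delta hσ).of_le (by exact_mod_cast le_top)).comp hα)).neg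
  have hk : ContDiff ℝ n fun t => √(m t ^ 2 + σ) :=
    ((hm.pow 2).add contDiff_const).sqrt fun t => by positivity
  have hof : ∀ {f : ℝ → ℝ}, ContDiff ℝ n f → ContDiff ℝ n fun t => (f t : ℂ) := fun hf =>
    Complex.ofRealCLM.contDiff.comp hf
  have hz := (hof (hm.add hk)).mul
    ((hof ((hm.mul (hμ.pow 2)).sub hν)).add ((hof (hμ.mul hv)).mul (contDiff_const : ContDiff ℝ n fun _ : ℝ => Complex.I)))
  exact hz.prodMk (hz.mul ((hof (hk.mul hμ)).add ((hof hv).mul (contDiff_const : ContDiff ℝ n fun _ : ℝ => Complex.I))))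

theorem angleJoined_of_functions (hσ : 0 < σ) {α m v : ℝ → ℝ} (hα : ContDiff ℝ 1 α)
    (hm : ContDiff ℝ 1 m) (hv : ContDiff ℝ 1 v) (hc : ∀ t, IsAngleConic σ (α t) (m t) (v t)) :
    AngleJoined σ (anglePoint σ (α 0) (m 0) (v 0)) (α 0) (anglePoint σ (α 1) (m 1) (v 1)) (α 1) :=
  ⟨fun t => anglePoint σ (α t) (m t) (v t), α,
    ⟨contDiff_anglePoint (n := 1) hσ hα hm hv, fun t _ => anglePoint_mem hσ (hc t)⟩,
    hα.differentiable one_ne_zero, fun t _ => isAngle_anglePoint hσ (hc t), rfl, rfl, rfl, rfl⟩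

/-- Multiply the conic by sin² a and complete the square; the oval equation makes the constant equal
to 1. This exhibits the fibre as an ellipse. -/
theorem isAngleConic_iff_of_sin_ne_zero (hσ : 0 < σ) (h : Real.sin a ≠ 0) {m v : ℝ} :
    IsAngleConic σ a m v ↔
      (m * Real.sin a ^ 2 - -(Real.cos a * delta σ a)) ^ 2 + (Real.sin a * v) ^ 2 = 1 := by
  have ho := oval_of_angle hσ a
  unfold IsAngleConic IsConic
  constructor
  · intro hc; linear_combination ho + Real.sin a ^ 2 * hc
  · intro hc
    apply mul_left_cancel₀ (pow_ne_zero 2 h)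
    linear_combination hc - ho

/-- When sin a = 0 the conic is the graph of a quadratic function of v, since ν ≠ 0; otherwise it is
an ellipse, run through by an eccentric angle. Either way the fibre is connected. -/
theorem angleJoined_fibre (hσ : 0 < σ) {m v m' v' : ℝ} (h : IsAngleConic σ a m v)
    (h' : IsAngleConic σ a m' v') :
    AngleJoined σ (anglePoint σ a m v) a (anglePoint σ a m' v') a := by
  by_cases hs : Real.sin a = 0
  · have hν : -(Real.cos a * delta σ a) ≠ 0 := by
      intro h0
      have ho := oval_of_angle hσ a
      rw [h0, hs] at ho; norm_num at ho
    set ν := -(Real.cos a * delta σ a) with hνdef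
    have key : ∀ x y, IsAngleConic σ a x y ↔ x = (y ^ 2 + (σ - 1)) / (2 * ν) := fun x y => by
      unfold IsAngleConic IsConic
      rw [hs, ← hνdef, eq_div_iff (by simpa using hν)]
      constructor <;> intro h <;> linear_combination -h
    have := angleJoined_of_functions hσ (α := fun _ => a)
      (m := fun t => ((v + t * (v' - v)) ^ 2 + (σ - 1)) / (2 * ν))
      (v := fun t => v + t * (v' - v)) (by fun_prop) (by fun_prop) (by fun_prop)
      fun t => (key _ _).2 rfl
    simp only [zero_mul, one_mul, add_zero, add_sub_cancel] at this
    rwa [← (key m v).1 h, ← (key m' v').1 h'] at this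
  · have key := fun x y => isAngleConic_iff_of_sin_ne_zero hσ hs (m := x) (v := y)
    set ν := -(Real.cos a * delta σ a) with hνdef
    have param : ∀ x y, IsAngleConic σ a x y → ∃ θ, x = (Real.cos θ + ν) / Real.sin a ^ 2 ∧
        y = Real.sin θ / Real.sin a := fun x y hc => by
      have h1 := (key x y).1 hc
      have hn : ‖(⟨x * Real.sin a ^ 2 - ν, Real.sin a * y⟩ : ℂ)‖ = 1 := by
        rw [Complex.norm_eq_sqrt_sq_add_sq, Real.sqrt_eq_one]; exact h1
      refine ⟨Complex.arg ⟨x * Real.sin a ^ 2 - ν, Real.sin a * y⟩, ?_, ?_⟩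
      · rw [Complex.cos_arg (norm_pos_iff.1 (by rw [hn]; exact one_pos)), hn]
        field_simp; ring
      · rw [Complex.sin_arg, hn]; field_simp
    obtain ⟨θ, hm, hv⟩ := param m v h
    obtain ⟨θ', hm', hv'⟩ := param m' v' h'
    have := angleJoined_of_functions hσ (α := fun _ => a)
      (m := fun t => (Real.cos (θ + t * (θ' - θ)) + ν) / Real.sin a ^ 2)
      (v := fun t => Real.sin (θ + t * (θ' - θ)) / Real.sin a)
      (by fun_prop) (by fun_prop) (by fun_prop) fun t => (key _ _).2 (by
        field_simp; linear_combination Real.sin_sq_add_cos_sq (θ + t * (θ' - θ)))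
    simp only [zero_mul, one_mul, add_zero, add_sub_cancel] at this
    rwa [← hm, ← hv, ← hm', ← hv'] at this

/-- The first coordinate of a section of the family of fibres. -/
def sectionM (σ a : ℝ) : ℝ :=
  σ / 2 * (-(Real.cos a * delta σ a)) / (1 + σ / 2 * Real.sin a ^ 2)

/-- The second coordinate of a section of the family of fibres. -/
def sectionV (σ a : ℝ) : ℝ :=
  √(1 + (σ ^ 2 / 4 + σ) * Real.sin a ^ 2) / (1 + σ / 2 * Real.sin a ^ 2)

/-- The centre m = ν/μ² of the ellipse escapes to infinity as μ → 0. Replacing μ² by μ² + 2/σ keeps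
m bounded, and the conic then makes v² strictly positive for every angle, so a smooth square root
exists even where the ellipse opens to a parabola. -/
theorem isAngleConic_section (hσ : 0 < σ) (a : ℝ) :
    IsAngleConic σ a (sectionM σ a) (sectionV σ a) := by
  have ho := oval_of_angle hσ a
  have h1 : (1 + σ / 2 * Real.sin a ^ 2) ≠ 0 := by positivity
  have h2 : √(1 + (σ ^ 2 / 4 + σ) * Real.sin a ^ 2) ^ 2 = 1 + (σ ^ 2 / 4 + σ) * Real.sin a ^ 2 :=
    Real.sq_sqrt (by positivity)
  unfold IsAngleConic IsConic sectionM sectionV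
  generalize -(Real.cos a * delta σ a) = ν at *
  generalize √(1 + (σ ^ 2 / 4 + σ) * Real.sin a ^ 2) = r at *
  generalize Real.sin a = μ at *
  have h3 : (2 + σ * μ ^ 2) ≠ 0 := by positivity
  have e1 : σ / 2 * ν / (1 + σ / 2 * μ ^ 2) = σ * ν / (2 + σ * μ ^ 2) := by field_simp
  have e2 : r / (1 + σ / 2 * μ ^ 2) = 2 * r / (2 + σ * μ ^ 2) := by field_simp
  rw [e1, e2]
  field_simp
  linear_combination (μ ^ 2 * σ ^ 2 - 2 * σ * (2 + σ * μ ^ 2)) * ho + 4 * h2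

theorem angleJoined_section (hσ : 0 < σ) (a b : ℝ) :
    AngleJoined σ (anglePoint σ a (sectionM σ a) (sectionV σ a)) a
      (anglePoint σ b (sectionM σ b) (sectionV σ b)) b := by
  have hα : ContDiff ℝ 1 fun t : ℝ => a + t * (b - a) := by fun_prop
  have hs : ContDiff ℝ 1 fun t : ℝ => Real.sin (a + t * (b - a)) := Real.contDiff_sin.comp hα
  have hd : ContDiff ℝ 1 fun t : ℝ => 1 + σ / 2 * Real.sin (a + t * (b - a)) ^ 2 :=
    contDiff_const.add (contDiff_const.mul (hs.pow 2))
  have hd0 : ∀ t : ℝ, 1 + σ / 2 * Real.sin (a + t * (b - a)) ^ 2 ≠ 0 := fun t => by positivity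
  have := angleJoined_of_functions hσ (α := fun t => a + t * (b - a))
    (m := fun t => sectionM σ (a + t * (b - a))) (v := fun t => sectionV σ (a + t * (b - a))) hα
    ((contDiff_const.mul ((Real.contDiff_cos.comp hα).mul
      (((contDiff_delta hσ).of_le (by exact_mod_cast le_top)).comp hα)).neg).div hd hd0)
    (((contDiff_const.add (contDiff_const.mul (hs.pow 2))).sqrt
      fun t => (by positivity : 0 < 1 + (σ ^ 2 / 4 + σ) * _).ne').div hd hd0)
    fun t => isAngleConic_section hσ _
  simpa using this

/-- Move inside the fibre to the section, along the section to the other angle, and inside that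
fibre to q. -/
theorem angleJoined (hσ : 0 < σ) (hp : p ∈ puncturedCurve σ) (hq : q ∈ puncturedCurve σ)
    (ha : IsAngle σ p a) (hb : IsAngle σ q b) : AngleJoined σ p a q b := by
  rw [eq_anglePoint hσ hp ha, eq_anglePoint hσ hq hb]
  exact ((angleJoined_fibre hσ (isAngleConic_of_isAngle hσ hp ha)
    (isAngleConic_section hσ a)).trans (angleJoined_section hσ a b)).trans
    (angleJoined_fibre hσ (isAngleConic_section hσ b) (isAngleConic_of_isAngle hσ hq hb))

theorem exists_path (hσ : 0 < σ) (hp : p ∈ puncturedCurve σ) (hq : q ∈ puncturedCurve σ)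
    (ha : IsAngle σ p a) (hb : IsAngle σ q b) :
    ∃ γ, IsCurvePath σ γ ∧ γ 0 = p ∧ γ 1 = q ∧
      reIntegral σ γ = position σ q b - position σ p a := by
  obtain ⟨γ, α, hγ, hα, h, rfl, rfl, rfl, rfl⟩ := angleJoined hσ hp hq ha hb
  exact ⟨γ, hγ, rfl, rfl, hγ.reIntegral_eq hσ hα.continuous.continuousOn (fun t _ => hα t) h⟩

/-! ### The covering surface and the periods -/

theorem base_mem (σ : ℝ) : ((1, 0) : ℂ × ℂ) ∈ puncturedCurve σ := by simp [puncturedCurve]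

theorem isAngle_base (σ : ℝ) : IsAngle σ (1, 0) 0 := by
  simp [IsAngle, bend, cobend, hQuot, cosArg, delta]

theorem position_base (σ : ℝ) : position σ (1, 0) 0 = 0 := by
  ext i; fin_cases i <;> simp [position, bend, hQuot, shiftFn_zero, heightFn_zero]

/-- One direction lifts the angle along the path, the other joins the base point, with angle 0, to p
with the prescribed angle. The covering thereby becomes the set of points with a chosen angle. -/
theorem mem_weierstrassCover_iff (hσ : 0 < σ) {x : E3} : (p, x) ∈ weierstrassCover σ ↔
    p ∈ puncturedCurve σ ∧ ∃ a, IsAngle σ p a ∧ x = position σ p a := by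
  constructor
  · rintro ⟨γ, hγ, h0, h1, h2⟩
    simp only at h1 h2
    obtain ⟨b, hb, h⟩ := hγ.exists_reIntegral_eq hσ (a := 0) (h0 ▸ isAngle_base σ)
    rw [h0, h1, position_base, sub_zero, h2] at h
    exact ⟨h1 ▸ hγ.2 1 (by simp), b, h1 ▸ hb, h⟩
  · rintro ⟨hp, a, ha, rfl⟩
    obtain ⟨γ, hγ, h0, h1, h2⟩ := exists_path hσ (base_mem σ) hp (isAngle_base σ) ha
    exact ⟨γ, hγ, h0, h1, by rw [h2, position_base, sub_zero]⟩

/-- Around a loop the angle can change only by a multiple of 2π, and every multiple is realised by a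
loop at the base point. -/
theorem periods_eq (hσ : 0 < σ) :
    periods σ = (AddSubgroup.zmultiples (periodVec σ) : Set E3) := by
  ext x
  simp only [periods, mem_ofPred_eq, SetLike.mem_coe, AddSubgroup.mem_zmultiples_iff]
  constructor
  · rintro ⟨γ, hγ, h01, rfl⟩
    obtain ⟨a, ha⟩ := exists_isAngle hσ (hγ.2 0 (by simp))
    obtain ⟨b, hb, h⟩ := hγ.exists_reIntegral_eq hσ ha
    rw [← h01] at hb h
    obtain ⟨k, rfl⟩ := ha.eq_add_two_pi_mul hσ hb
    exact ⟨k, by rw [h, position_add_two_pi_mul hσ, add_sub_cancel_left]⟩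
  · rintro ⟨k, rfl⟩
    obtain ⟨γ, hγ, h0, h1, h2⟩ := exists_path hσ (base_mem σ) (base_mem σ) (isAngle_base σ)
      ((isAngle_base σ).add_two_pi_mul k)
    exact ⟨γ, hγ, h0.trans h1.symm, by
      rw [h2, position_add_two_pi_mul hσ, add_sub_cancel_left]⟩

theorem periodVec_ne_zero (hσ : 0 < σ) : periodVec σ ≠ 0 := by
  intro h
  have h1 : periodVec σ 2 = 0 := by rw [h]; rfl
  have := heightFn_pi_div_two_pos hσ
  simp [periodVec] at h1
  linarith

theorem weierstrassCover_fibre (hσ : 0 < σ) (hp : p ∈ puncturedCurve σ) :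
    ∃ x, (p, x) ∈ weierstrassCover σ ∧
      ∀ y, (p, y) ∈ weierstrassCover σ ↔ ∃ k : ℤ, y = x + k • periodVec σ := by
  obtain ⟨a, ha⟩ := exists_isAngle hσ hp
  refine ⟨position σ p a, (mem_weierstrassCover_iff hσ).2 ⟨hp, a, ha, rfl⟩, fun y => ?_⟩
  rw [mem_weierstrassCover_iff hσ]
  constructor
  · rintro ⟨-, b, hb, rfl⟩
    obtain ⟨k, rfl⟩ := ha.eq_add_two_pi_mul hσ hb
    exact ⟨k, position_add_two_pi_mul hσ _ _ _⟩
  · rintro ⟨k, rfl⟩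
    exact ⟨hp, _, ha.add_two_pi_mul k, (position_add_two_pi_mul hσ _ _ _).symm⟩

/-! ### The surface in space -/

/-- The equation of the horizontal section at angle `a`, where `X` is the first coordinate
relative to the axis and `Y` is the second coordinate. -/
def IsLevel (σ a X Y : ℝ) : Prop :=
  σ * Real.sin a * (X ^ 2 + Y ^ 2) + 2 * √σ * (-(Real.cos a * delta σ a)) * X +
    Real.sin a * (σ - 1 - σ * Real.sin a ^ 2) = 0

theorem sin_or_cos (hσ : 0 < σ) (a : ℝ) : Real.sin a ≠ 0 ∨ -(Real.cos a * delta σ a) ≠ 0 := by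
  by_contra! h
  have ho := oval_of_angle hσ a
  rw [h.1, h.2] at ho
  norm_num at ho

/-- The planar coordinates are multiples of m sin a and v, so sin a times the conic is an equation
in them alone. -/
theorem isLevel_of_isAngleConic (hσ : 0 < σ) {m v : ℝ} (h : IsAngleConic σ a m v) :
    IsLevel σ a (-(m * Real.sin a / √σ)) (-v / √σ) := by
  have h0 : √σ ≠ 0 := (Real.sqrt_pos.2 hσ).ne'
  have h1 : √σ ^ 2 = σ := Real.sq_sqrt hσ.le
  have e1 : σ * ((-(m * Real.sin a / √σ)) ^ 2 + (-v / √σ) ^ 2) = m ^ 2 * Real.sin a ^ 2 + v ^ 2 := by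
    nth_rewrite 1 [← h1]; field_simp
  have e2 : √σ * -(m * Real.sin a / √σ) = -(m * Real.sin a) := by field_simp
  unfold IsLevel
  unfold IsAngleConic IsConic at h
  linear_combination Real.sin a * e1 + 2 * (-(Real.cos a * delta σ a)) * e2 + Real.sin a * h

/-- The two linear equations for m are compatible by `IsLevel`, and sin a and ν do not vanish
together, so one of them can be solved. On a line section X is zero and carries no information on m;
there the second equation supplies it. -/
theorem exists_isAngleConic_of_isLevel (hσ : 0 < σ) {X Y : ℝ} (h : IsLevel σ a X Y) :
    ∃ m, IsAngleConic σ a m (-(√σ * Y)) ∧ m * Real.sin a = -(√σ * X) ∧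
      2 * m * (-(Real.cos a * delta σ a)) = σ * (X ^ 2 + Y ^ 2) + (σ - 1) - σ * Real.sin a ^ 2 := by
  have h0 : √σ ≠ 0 := (Real.sqrt_pos.2 hσ).ne'
  have h1 : √σ ^ 2 = σ := Real.sq_sqrt hσ.le
  suffices H : ∃ m, m * Real.sin a = -(√σ * X) ∧
      2 * m * (-(Real.cos a * delta σ a)) =
        σ * (X ^ 2 + Y ^ 2) + (σ - 1) - σ * Real.sin a ^ 2 by
    obtain ⟨m, e1, e2⟩ := H
    refine ⟨m, ?_, e1, e2⟩
    unfold IsAngleConic IsConic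
    linear_combination (m * Real.sin a - √σ * X) * e1 - e2 + (X ^ 2 + Y ^ 2) * h1
  unfold IsLevel at h
  by_cases hs : Real.sin a = 0
  · have hν := (sin_or_cos hσ a).resolve_left (by simpa using hs)
    generalize -(Real.cos a * delta σ a) = ν at *
    have hX : X = 0 := by
      rw [hs] at h
      have : √σ * ν * X = 0 := by linear_combination h / 2
      simpa [h0, hν] using this
    refine ⟨(σ * (X ^ 2 + Y ^ 2) + (σ - 1) - σ * Real.sin a ^ 2) / (2 * ν), ?_, ?_⟩
    · rw [hs, hX]; simp
    · field_simp
  · refine ⟨-(√σ * X) / Real.sin a, by field_simp, ?_⟩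
    generalize -(Real.cos a * delta σ a) = ν at *
    field_simp
    linear_combination -h

/-- This eliminates the complex curve: foliation, periodicity and the comparison with the Riemann
example use only these equations. -/
theorem mem_surfaceM_iff (hσ : 0 < σ) {x : E3} : x ∈ surfaceM σ ↔
    ∃ a, x 2 = heightFn σ a ∧ IsLevel σ a (x 0 - shiftFn σ a) (x 1) := by
  constructor
  · rintro ⟨⟨⟨p, y⟩, hq⟩, rfl⟩
    obtain ⟨hp, a, ha, rfl⟩ := (mem_weierstrassCover_iff hσ).1 hq
    refine ⟨a, by simp [immersion, position], ?_⟩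
    convert isLevel_of_isAngleConic hσ (isAngleConic_of_isAngle hσ hp ha) using 1
    · simp [immersion, position, ha.1]
    · simp [immersion, position]
  · rintro ⟨a, h2, h⟩
    obtain ⟨m, hc, hm, -⟩ := exists_isAngleConic_of_isLevel hσ h
    have h0 : √σ ≠ 0 := (Real.sqrt_pos.2 hσ).ne'
    refine ⟨⟨(anglePoint σ a m (-(√σ * x 1)), x), (mem_weierstrassCover_iff hσ).2
      ⟨anglePoint_mem hσ hc, a, isAngle_anglePoint hσ hc, ?_⟩⟩, rfl⟩
    have e1 : bend σ (anglePoint σ a m (-(√σ * x 1))) = Real.sin a := (isAngle_anglePoint hσ hc).1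
    have e2 := minusPart_curvePoint hσ (oval_of_angle hσ a) hc
    have e3 := hQuot_curvePoint hσ (oval_of_angle hσ a) hc
    unfold position
    rw [e1]
    unfold anglePoint
    rw [e2, e3, hm]
    ext i; fin_cases i
    · simp; field_simp; ring
    · simp; field_simp
    · simpa using h2

/-- Complete the square in X. The oval equation reduces the remaining constant to the square of
1/(√σ sin a). -/
theorem isLevel_iff_circle (hσ : 0 < σ) (hs : Real.sin a ≠ 0) {X Y : ℝ} : IsLevel σ a X Y ↔
    (X - Real.cos a * delta σ a / (√σ * Real.sin a)) ^ 2 + Y ^ 2 =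
      (1 / (√σ * Real.sin a)) ^ 2 := by
  obtain ⟨s, h0, rfl⟩ : ∃ s, 0 < s ∧ σ = s ^ 2 := ⟨√σ, Real.sqrt_pos.2 hσ, (Real.sq_sqrt hσ.le).symm⟩
  have ho := oval_of_angle hσ a
  unfold IsLevel
  rw [Real.sqrt_sq h0.le]
  have e : (s ^ 2 * Real.sin a * (X ^ 2 + Y ^ 2) + 2 * s * (-(Real.cos a * delta (s ^ 2) a)) * X +
      Real.sin a * (s ^ 2 - 1 - s ^ 2 * Real.sin a ^ 2)) * Real.sin a =
      ((X - Real.cos a * delta (s ^ 2) a / (s * Real.sin a)) ^ 2 + Y ^ 2 -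
      (1 / (s * Real.sin a)) ^ 2) * (s ^ 2 * Real.sin a ^ 2) := by
    field_simp
    linear_combination -ho
  rw [← mul_left_inj' hs, e, zero_mul, mul_eq_zero, sub_eq_zero]
  have : s ^ 2 * Real.sin a ^ 2 ≠ 0 := by positivity
  tauto

theorem isLevel_iff_line (hσ : 0 < σ) (hs : Real.sin a = 0) {X Y : ℝ} :
    IsLevel σ a X Y ↔ X = 0 := by
  have h0 : √σ ≠ 0 := (Real.sqrt_pos.2 hσ).ne'
  have hν := (sin_or_cos hσ a).resolve_left (by simpa using hs)
  unfold IsLevel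
  rw [hs]
  generalize -(Real.cos a * delta σ a) = ν at *
  simp [h0, hν]

/-- The height is injective in the angle, so sections at different angles cannot share a plane. -/
theorem surfaceM_inter_plane (hσ : 0 < σ) (a : ℝ) :
    surfaceM σ ∩ {x | x 2 = heightFn σ a} =
      {x | x 2 = heightFn σ a ∧ IsLevel σ a (x 0 - shiftFn σ a) (x 1)} := by
  ext x
  simp only [mem_inter_iff, mem_ofPred_eq, mem_surfaceM_iff hσ]
  constructor
  · rintro ⟨⟨b, hb, h⟩, hx⟩
    have : b = a := (strictMono_heightFn hσ).injective (hb.symm.trans hx)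
    exact ⟨hx, this ▸ h⟩
  · rintro ⟨hx, h⟩
    exact ⟨⟨a, hx, h⟩, hx⟩

theorem foliatedByCirclesAndLines_surfaceM (hσ : 0 < σ) :
    FoliatedByCirclesAndLines (surfaceM σ) := by
  intro c
  obtain ⟨a, rfl⟩ := surjective_heightFn hσ c
  have h0 : 0 < √σ := Real.sqrt_pos.2 hσ
  rw [surfaceM_inter_plane hσ]
  by_cases hs : Real.sin a = 0
  · right
    refine ⟨!₂[shiftFn σ a, 0, heightFn σ a], Real.pi / 2, ?_⟩
    ext x
    simp only [mem_ofPred_eq, isLevel_iff_line hσ hs, horizontalLine, mem_range]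
    constructor
    · rintro ⟨h1, h2⟩
      refine ⟨x 1, ?_⟩
      ext i; fin_cases i
      · simp; linarith
      · simp
      · simp [h1]
    · rintro ⟨s, rfl⟩
      simp
  · left
    refine ⟨!₂[shiftFn σ a + Real.cos a * delta σ a / (√σ * Real.sin a), 0, heightFn σ a],
      1 / (√σ * |Real.sin a|), by positivity, ?_⟩
    ext x
    simp only [mem_ofPred_eq, isLevel_iff_circle hσ hs, horizontalCircle]
    change _ ↔ x 2 = heightFn σ a ∧ _
    refine and_congr_right fun hx => ?_
    rw [EuclideanSpace.dist_eq, Fin.sum_univ_three]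
    simp only [Real.dist_eq, sq_abs]
    have e1 : (1 / (√σ * |Real.sin a|)) ^ 2 = (1 / (√σ * Real.sin a)) ^ 2 := by
      rw [div_pow, div_pow, mul_pow, mul_pow, sq_abs]
    rw [← e1, Real.sqrt_eq_iff_mul_self_eq (by positivity) (by positivity)]
    simp [hx]
    constructor <;> intro h <;> linear_combination h
end RiemannMinimal

namespace RiemannMinimal

/-! ### Completeness -/

variable {σ : ℝ} {p : ℂ × ℂ} {a : ℝ}

/-- The angle of a point of the covering surface. -/
def coverAngle (hσ : 0 < σ) (q : weierstrassCover σ) : ℝ := (heightHomeo hσ).symm (q.1.2 2)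

theorem coverProj_mem (hσ : 0 < σ) (q : weierstrassCover σ) :
    coverProj σ q ∈ puncturedCurve σ := ((mem_weierstrassCover_iff hσ).1 q.2).1

theorem coverAngle_spec (hσ : 0 < σ) (q : weierstrassCover σ) :
    IsAngle σ (coverProj σ q) (coverAngle hσ q) ∧
      immersion σ q = position σ (coverProj σ q) (coverAngle hσ q) := by
  obtain ⟨-, a, ha, h⟩ := (mem_weierstrassCover_iff hσ).1 q.2
  have : coverAngle hσ q = a := by
    unfold coverAngle
    rw [h, Homeomorph.symm_apply_eq, heightHomeo_apply]; simp [position]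
  rw [this]
  exact ⟨ha, h⟩

theorem continuous_coverProj (σ : ℝ) : Continuous (coverProj σ) :=
  continuous_fst.comp continuous_subtype_val

theorem continuous_immersion (σ : ℝ) : Continuous (immersion σ) :=
  continuous_snd.comp continuous_subtype_val

theorem continuous_coverAngle (hσ : 0 < σ) : Continuous (coverAngle hσ) :=
  (heightHomeo hσ).symm.continuous.comp
    ((EuclideanSpace.proj (𝕜 := ℝ) (2 : Fin 3)).continuous.comp (continuous_immersion σ))

theorem continuous_anglePoint (hσ : 0 < σ) :
    Continuous fun x : ℝ × ℝ × ℝ => anglePoint σ x.1 x.2.1 x.2.2 := by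
  have hd : Continuous (delta σ) := (contDiff_delta hσ).continuous
  unfold anglePoint curvePoint
  fun_prop

theorem continuous_conic (hσ : 0 < σ) : Continuous fun x : ℝ × ℝ × ℝ =>
    Real.sin x.1 ^ 2 * x.2.1 ^ 2 - 2 * x.2.1 * (-(Real.cos x.1 * delta σ x.1)) + x.2.2 ^ 2 + (σ - 1)
      - σ * Real.sin x.1 ^ 2 := by
  have hd : Continuous (delta σ) := (contDiff_delta hσ).continuous
  fun_prop

/-- The immersion is proper. -/
theorem exists_isCompact_of_norm_le (hσ : 0 < σ) (R : ℝ) :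
    ∃ K : Set (weierstrassCover σ), IsCompact K ∧ ∀ q, ‖immersion σ q‖ ≤ R → q ∈ K := by
  set A := (heightHomeo hσ).symm '' Icc (-R) R with hA
  have hAc : IsCompact A := isCompact_Icc.image (heightHomeo hσ).symm.continuous
  obtain ⟨S, hS⟩ := (hAc.image (contDiff_shiftFn hσ).continuous).isBounded.exists_norm_le
  -- D will bound m²: its summands bound (m sin a)², through the first coordinate, and (2mν)²,
  -- through the conic.
  set D := σ * (R + S) ^ 2 + (σ * ((R + S) ^ 2 + R ^ 2) + 1 + 2 * σ) ^ 2
  set C : Set (ℝ × ℝ × ℝ) := (A ×ˢ (Icc (-(1 + D)) (1 + D) ×ˢ Icc (-(√σ * R)) (√σ * R))) ∩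
    {x | IsAngleConic σ x.1 x.2.1 x.2.2}
  have hC : IsCompact C := (hAc.prod (isCompact_Icc.prod isCompact_Icc)).inter_right
    (isClosed_eq (continuous_conic hσ) continuous_const)
  set Θ : ℝ × ℝ × ℝ → (ℂ × ℂ) × E3 := fun x =>
    (anglePoint σ x.1 x.2.1 x.2.2, position σ (anglePoint σ x.1 x.2.1 x.2.2) x.1)
  have hΘ : ContinuousOn Θ C := (continuous_anglePoint hσ).continuousOn.prodMk
    (continuousOn_position hσ (continuous_anglePoint hσ).continuousOn
      (fun x hx => (anglePoint_mem hσ hx.2).2) continuous_fst.continuousOn)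
  refine ⟨Subtype.val ⁻¹' (Θ '' C), ?_, fun q hq => ?_⟩
  · rw [Subtype.isCompact_iff, Subtype.image_preimage_coe, inter_eq_right.2]
    · exact hC.image_of_continuousOn hΘ
    · rintro _ ⟨x, hx, rfl⟩
      exact (mem_weierstrassCover_iff hσ).2
        ⟨anglePoint_mem hσ hx.2, x.1, isAngle_anglePoint hσ hx.2, rfl⟩
  · obtain ⟨ha, hx⟩ := coverAngle_spec hσ q
    have hp := coverProj_mem hσ q
    have hc := isAngleConic_of_isAngle hσ hp ha
    have hpe := eq_anglePoint hσ hp ha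
    have hcoord : ∀ i, |immersion σ q i| ≤ R := fun i =>
      (PiLp.norm_apply_le (immersion σ q) i).trans hq
    have haA : coverAngle hσ q ∈ A := ⟨_, abs_le.1 (hcoord 2), rfl⟩
    have hSa : |shiftFn σ (coverAngle hσ q)| ≤ S := hS _ ⟨_, haA, rfl⟩
    generalize coverAngle hσ q = a at *
    have h0 : 0 < √σ := Real.sqrt_pos.2 hσ
    have h1 : √σ ^ 2 = σ := Real.sq_sqrt hσ.le
    have e0 : immersion σ q 0 = shiftFn σ a - minusPart σ (coverProj σ q) * Real.sin a / √σ := by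
      rw [hx, ← ha.1]; simp [position]
    have e1 : immersion σ q 1 = -(hQuot (coverProj σ q)).im / √σ := by rw [hx]; simp [position]
    set m := minusPart σ (coverProj σ q)
    set v := (hQuot (coverProj σ q)).im
    have hR : 0 ≤ R := (norm_nonneg _).trans hq
    have hvR : |v| ≤ √σ * R := by
      have := hcoord 1
      rw [e1, abs_div, abs_neg, abs_of_pos h0, div_le_iff₀ h0] at this
      linarith
    have hms : |m * Real.sin a / √σ| ≤ R + S := by
      have e2 : m * Real.sin a / √σ = shiftFn σ a - immersion σ q 0 := by rw [e0]; ring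
      rw [e2]
      exact (abs_sub _ _).trans (by linarith [hcoord 0])
    have hms2 : (m * Real.sin a) ^ 2 ≤ σ * (R + S) ^ 2 := by
      have := sq_le_sq' (abs_le.1 hms).1 (abs_le.1 hms).2
      rw [div_pow, h1, div_le_iff₀ hσ] at this
      linarith
    have hv2 : v ^ 2 ≤ σ * R ^ 2 := by
      have := sq_le_sq' (abs_le.1 hvR).1 (abs_le.1 hvR).2
      rwa [mul_pow, h1] at this
    have ho := oval_of_angle hσ a
    have hm : |m| ≤ 1 + D := by
      have hs1 := Real.sin_sq_le_one a
      have hc' := hc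
      unfold IsAngleConic IsConic at hc'
      set ν := -(Real.cos a * delta σ a)
      have hmn : |2 * (m * ν)| ≤ σ * ((R + S) ^ 2 + R ^ 2) + 1 + 2 * σ := by
        have e3 : 2 * (m * ν) = (m * Real.sin a) ^ 2 + v ^ 2 + (σ - 1) - σ * Real.sin a ^ 2 := by
          linear_combination -hc'
        have h5 : 0 ≤ σ * Real.sin a ^ 2 := by positivity
        have h6 : σ * Real.sin a ^ 2 ≤ σ := by nlinarith
        rw [e3, abs_le]
        have h9 := sq_nonneg (m * Real.sin a)
        have h10 := sq_nonneg v
        have h11 : 0 ≤ σ * (R + S) ^ 2 := by positivity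
        have h12 : 0 ≤ σ * R ^ 2 := by positivity
        rw [mul_add]
        constructor <;> linarith
      have hmn2 := sq_le_sq' (abs_le.1 hmn).1 (abs_le.1 hmn).2
      -- By the oval equation sin² a + ν² ≥ 1, so the two bounds control m even at the line
      -- sections.
      have e4 : m ^ 2 ≤ (m * Real.sin a) ^ 2 + (m * ν) ^ 2 := by
        have e5 : (m * Real.sin a) ^ 2 + (m * ν) ^ 2 =
          m ^ 2 + m ^ 2 * (σ * Real.sin a ^ 2 * (1 - Real.sin a ^ 2)) := by
          linear_combination m ^ 2 * ho
        rw [e5]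
        have : 0 ≤ σ * Real.sin a ^ 2 * (1 - Real.sin a ^ 2) :=
          mul_nonneg (by positivity) (by linarith)
        linarith [mul_nonneg (sq_nonneg m) this]
      have e6 : m ^ 2 ≤ D := by
        have h7 : (2 * (m * ν)) ^ 2 = 4 * (m * ν) ^ 2 := by ring
        have h8 := sq_nonneg (m * ν)
        simp only [D]; linarith
      have : |m| ^ 2 ≤ D := by rwa [sq_abs]
      nlinarith [abs_nonneg m]
    refine ⟨(a, m, v), ⟨⟨haA, abs_le.1 hm, abs_le.1 hvR⟩, hc⟩, ?_⟩
    change (anglePoint σ a m v, position σ (anglePoint σ a m v) a) = _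
    rw [← hpe, ← hx]; rfl

/-- A path of finite length has bounded image in space. By properness of X it stays in a compact
subset of the covering, so it does not diverge. -/
theorem isCompleteSurface (hσ : 0 < σ) : IsCompleteSurface σ := by
  intro Γ hΓ hlim
  by_contra hfin
  have hf : ContDiffOn ℝ 1 (fun s => immersion σ (Γ s)) (Ico 0 1) := hΓ.snd
  set L := ∫⁻ t in Ico (0 : ℝ) 1, ‖deriv (fun s => immersion σ (Γ s)) t‖ₑ
  obtain ⟨K, hK, hK'⟩ := exists_isCompact_of_norm_le hσ (‖immersion σ (Γ 0)‖ + L.toReal)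
  have hin : ∀ t ∈ Ico (0 : ℝ) 1, Γ t ∈ K := fun t ht => by
    apply hK'
    have h1 := enorm_sub_le_lintegral_deriv_of_contDiffOn_Icc
      (hf.mono fun x hx => ⟨hx.1, hx.2.trans_lt ht.2⟩) ht.1
    have h2 : ‖immersion σ (Γ t) - immersion σ (Γ 0)‖ₑ ≤ L :=
      h1.trans (lintegral_mono_set fun x hx => ⟨hx.1, hx.2.trans_lt ht.2⟩)
    have h3 : ‖immersion σ (Γ t) - immersion σ (Γ 0)‖ ≤ L.toReal := by
      rw [← toReal_enorm]; exact ENNReal.toReal_mono hfin h2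
    have h4 := norm_add_le (immersion σ (Γ t) - immersion σ (Γ 0)) (immersion σ (Γ 0))
    rw [sub_add_cancel] at h4
    linarith
  have h1 := hlim.eventually hK.compl_mem_cocompact
  have h2 : ∀ᶠ t in 𝓝[<] (1 : ℝ), t ∈ Ico (0 : ℝ) 1 := Ico_mem_nhdsLT zero_lt_one
  obtain ⟨t, ht1, ht2⟩ := (h1.and h2).exists
  exact ht1 (hin t ht2)

end RiemannMinimal

namespace RiemannMinimal

/-! ### Smoothness of the real coordinates -/

section Smooth

variable {σ : ℝ} {E : Type*} [NormedAddCommGroup E] [NormedSpace ℝ E] {f : E → ℂ × ℂ} {x : E}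
  {n : WithTop ℕ∞}

theorem contDiffAt_norm_fst (hf : ContDiffAt ℝ n f x) (h0 : (f x).1 ≠ 0) :
    ContDiffAt ℝ n (fun y => ‖(f y).1‖) x := ((contDiffAt_fst (𝕜 := ℝ)).comp x hf).norm ℝ h0

theorem contDiffAt_hQuot (hf : ContDiffAt ℝ n f x) (h0 : (f x).1 ≠ 0) :
    ContDiffAt ℝ n (fun y => hQuot (f y)) x := by
  simp only [hQuot, div_eq_mul_inv]
  exact (contDiffAt_snd.comp x hf).mul ((contDiffAt_fst.comp x hf).inv h0)

theorem contDiffAt_plusPart (hf : ContDiffAt ℝ n f x) (h0 : (f x).1 ≠ 0) :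
    ContDiffAt ℝ n (fun y => plusPart σ (f y)) x :=
  ((contDiffAt_norm_fst hf h0).add (contDiffAt_const.div (contDiffAt_norm_fst hf h0)
    (norm_ne_zero_iff.2 h0))).div_const _

theorem contDiffAt_minusPart (hf : ContDiffAt ℝ n f x) (h0 : (f x).1 ≠ 0) :
    ContDiffAt ℝ n (fun y => minusPart σ (f y)) x :=
  ((contDiffAt_norm_fst hf h0).sub (contDiffAt_const.div (contDiffAt_norm_fst hf h0)
    (norm_ne_zero_iff.2 h0))).div_const _

theorem contDiffAt_bend (hσ : 0 < σ) (hf : ContDiffAt ℝ n f x) (h0 : (f x).1 ≠ 0) :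
    ContDiffAt ℝ n (fun y => bend σ (f y)) x :=
  (Complex.reCLM.contDiff.contDiffAt.comp x (contDiffAt_hQuot hf h0)).div
    (contDiffAt_plusPart hf h0) (plusPart_pos hσ h0).ne'

theorem contDiffAt_cobend (hσ : 0 < σ) (hf : ContDiffAt ℝ n f x) (h0 : (f x).1 ≠ 0) :
    ContDiffAt ℝ n (fun y => cobend σ (f y)) x :=
  ((contDiffAt_minusPart hf h0).mul ((contDiffAt_bend hσ hf h0).pow 2)).sub
    ((Complex.reCLM.contDiff.contDiffAt.comp x (contDiffAt_fst.comp x hf)).div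
      (contDiffAt_norm_fst hf h0) (norm_ne_zero_iff.2 h0))

theorem contDiffAt_angleCos (hσ : 0 < σ) (hf : ContDiffAt ℝ n f x) (h0 : (f x).1 ≠ 0) :
    ContDiffAt ℝ n (fun y => angleCos σ (f y)) x := by
  have h1 : 0 < 1 + σ * bend σ (f x) ^ 2 := by positivity
  exact (contDiffAt_cobend hσ hf h0).neg.div
    ((contDiffAt_const.add (contDiffAt_const.mul ((contDiffAt_bend hσ hf h0).pow 2))).sqrt h1.ne')
    (Real.sqrt_pos.2 h1).ne'

theorem contDiffAt_position (hσ : 0 < σ) (hf : ContDiffAt ℝ ∞ f x) (h0 : (f x).1 ≠ 0)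
    {α : E → ℝ} (hα : ContDiffAt ℝ ∞ α x) :
    ContDiffAt ℝ ∞ (fun y => position σ (f y) (α y)) x := by
  rw [contDiffAt_euclidean]
  intro i; fin_cases i
  · exact ((contDiff_shiftFn hσ).contDiffAt.comp x hα).sub
      (((contDiffAt_minusPart hf h0).mul (contDiffAt_bend hσ hf h0)).div_const _)
  · exact (Complex.imCLM.contDiff.contDiffAt.comp x (contDiffAt_hQuot hf h0)).neg.div_const _
  · exact (contDiff_heightFn hσ).contDiffAt.comp x hα

/-- A continuous choice of angles is smooth. -/
theorem contDiffAt_angle (hσ : 0 < σ) (hf : ContDiffAt ℝ ∞ f x) (h0 : (f x).1 ≠ 0)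
    {α : E → ℝ} (hc : ContinuousAt α x) (hα : ∀ᶠ y in 𝓝 x, IsAngle σ (f y) (α y)) :
    ContDiffAt ℝ ∞ α x := by
  -- This smooth function is exp (i (α y - α x)). Continuity of α keeps the exponent in the strip
  -- where the principal logarithm inverts the exponential.
  set u : E → ℂ := fun y => ((angleCos σ (f y) : ℂ) + (bend σ (f y) : ℂ) * Complex.I) *
    Complex.exp (-(α x) * Complex.I)
  have hu : ContDiffAt ℝ ∞ u x :=
    ((Complex.ofRealCLM.contDiff.contDiffAt.comp x (contDiffAt_angleCos hσ hf h0)).add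
      ((Complex.ofRealCLM.contDiff.contDiffAt.comp x (contDiffAt_bend hσ hf h0)).mul
        contDiffAt_const)).mul contDiffAt_const
  have hue : ∀ y, IsAngle σ (f y) (α y) → u y = Complex.exp (((α y - α x : ℝ) : ℂ) * Complex.I) :=
    fun y hy => by
      obtain ⟨h1, h2⟩ := (isAngle_iff hσ).1 hy
      simp only [u]
      rw [h1, h2, Complex.ofReal_cos, Complex.ofReal_sin, ← Complex.exp_mul_I, ← Complex.exp_add]
      congr 1; push_cast; ring
  have hux : u x = 1 := by rw [hue x hα.self_of_nhds]; simp
  have hlog : ContDiffAt ℝ ∞ (fun y => (Complex.log (u y)).im) x :=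
    Complex.imCLM.contDiff.contDiffAt.comp x
      (((Complex.contDiffAt_log (by rw [hux]; simp)).restrict_scalars ℝ).comp x hu)
  refine (contDiffAt_const (c := α x)|>.add hlog).congr_of_eventuallyEq ?_
  have hnear : ∀ᶠ y in 𝓝 x, α y ∈ Ioo (α x - Real.pi) (α x + Real.pi) :=
    hc (Ioo_mem_nhds (by linarith [Real.pi_pos]) (by linarith [Real.pi_pos]))
  filter_upwards [hα, hnear] with y hy hy2
  rw [hue y hy, Complex.log_exp]
  · simp
  · simp; linarith [hy2.1]
  · simp; linarith [hy2.2]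

end Smooth

/-! ### The immersion in charts -/

section Charts

variable {σ : ℝ} {e : OpenPartialHomeomorph (weierstrassCover σ) ℂ} {ξ : ℂ}

/-- The derivative in ξ is tangent to the curve, hence a multiple of `flowField`; the normalization
φ₃ = dξ makes the multiple 1. -/
theorem IsHeightChart.hasDerivAt (hσ : 0 < σ) (he : IsHeightChart σ e) (hξ : ξ ∈ e.target) :
    HasDerivAt (fun η => coverProj σ (e.symm η)) (flowField σ (coverProj σ (e.symm ξ))) ξ := by
  have h1 := (he.1.differentiableAt (e.open_target.mem_nhds hξ)).hasDerivAt
  have h2 : HasDerivAt (fun t : ℝ => coverProj σ (e.symm (ξ + t)))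
      (deriv (fun η => coverProj σ (e.symm η)) ξ) 0 := by
    have hl : HasDerivAt (fun t : ℝ => ξ + (t : ℂ)) 1 0 :=
      (Complex.ofRealCLM.hasDerivAt (x := 0)).const_add ξ
    have h1' : HasDerivAt (fun η => coverProj σ (e.symm η))
      (deriv (fun η => coverProj σ (e.symm η)) ξ) ((fun t : ℝ => ξ + (t : ℂ)) 0) := by simpa using h1
    simpa [Function.comp_def] using h1'.scomp (0 : ℝ) hl
  have h3 := tangent_of_hasDerivAt h2 (Eventually.of_forall fun t => coverProj_mem hσ _)
  have h4 := eq_phi3_smul_flowField hσ (coverProj_mem hσ _) h3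
  simp only [Complex.ofReal_zero, add_zero] at h4
  rw [he.2 ξ hξ, one_smul] at h4
  exact h4 ▸ h1

theorem IsHeightChart.hasDerivAt_comp (hσ : 0 < σ) (he : IsHeightChart σ e) {l : ℝ → ℂ} {d : ℂ}
    {t : ℝ} (hl : HasDerivAt l d t) (ht : l t ∈ e.target) :
    HasDerivAt (fun s => coverProj σ (e.symm (l s))) (d • flowField σ (coverProj σ (e.symm (l t))))
      t :=
  (he.hasDerivAt hσ ht).scomp t hl

theorem IsHeightChart.contDiffAt_proj (he : IsHeightChart σ e) (hξ : ξ ∈ e.target) :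
    ContDiffAt ℝ ∞ (fun η => coverProj σ (e.symm η)) ξ :=
  (he.1.contDiffOn e.open_target |>.contDiffAt (e.open_target.mem_nhds hξ)).restrict_scalars ℝ

theorem IsHeightChart.contDiffAt_coverAngle (hσ : 0 < σ) (he : IsHeightChart σ e)
    (hξ : ξ ∈ e.target) : ContDiffAt ℝ ∞ (fun η => coverAngle hσ (e.symm η)) ξ :=
  contDiffAt_angle hσ (he.contDiffAt_proj hξ) (coverProj_mem hσ _).2
    ((continuous_coverAngle hσ).continuousAt.comp (e.symm.continuousAt hξ))
    (Eventually.of_forall fun _ => (coverAngle_spec hσ _).1)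

theorem IsHeightChart.contDiffAt_inChart (hσ : 0 < σ) (he : IsHeightChart σ e)
    (hξ : ξ ∈ e.target) : ContDiffAt ℝ ∞ (inChart σ e) ξ := by
  have : inChart σ e = fun η => position σ (coverProj σ (e.symm η)) (coverAngle hσ (e.symm η)) :=
    funext fun η => (coverAngle_spec hσ _).2
  rw [this]
  exact contDiffAt_position hσ (he.contDiffAt_proj hξ) (coverProj_mem hσ _).2
    (he.contDiffAt_coverAngle hσ hξ)

theorem IsHeightChart.hasDerivAt_inChart_comp (hσ : 0 < σ) (he : IsHeightChart σ e) {l : ℝ → ℂ}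
    {d : ℂ} {t : ℝ} (hl : HasDerivAt l d t) (ht : l t ∈ e.target) :
    HasDerivAt (fun s => inChart σ e (l s)) (weierVec σ (coverProj σ (e.symm (l t))) d) t := by
  have h1 : ∀ q, immersion σ q = position σ (coverProj σ q) (coverAngle hσ q) :=
    fun q => (coverAngle_spec hσ q).2
  simp only [inChart, h1]
  have hα : DifferentiableAt ℝ (fun s => coverAngle hσ (e.symm (l s))) t :=
    ((he.contDiffAt_coverAngle hσ ht).differentiableAt (by simp)).comp t hl.differentiableAt
  exact hasDerivAt_position hσ (coverProj_mem hσ _) (he.hasDerivAt_comp hσ hl ht)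
    (coverAngle_spec hσ _).1 (hasDerivAt_angle hσ (coverProj_mem hσ _)
      (he.hasDerivAt_comp hσ hl ht) (Eventually.of_forall fun _ => (coverAngle_spec hσ _).1) hα)

theorem hasDerivAt_line (ξ d : ℂ) : HasDerivAt (fun t : ℝ => ξ + t * d) d 0 := by
  simpa using ((Complex.ofRealCLM.hasDerivAt (x := 0)).mul_const d).const_add ξ

theorem fderiv_eq_of_hasDerivAt_line {F : Type*} [NormedAddCommGroup F] [NormedSpace ℝ F]
    {Y : ℂ → F} {d : ℂ} {v : F} (hY : DifferentiableAt ℝ Y ξ)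
    (h : HasDerivAt (fun t : ℝ => Y (ξ + t * d)) v 0) : fderiv ℝ Y ξ d = v := by
  have h1 : HasFDerivAt Y (fderiv ℝ Y ξ) (ξ + ((0 : ℝ) : ℂ) * d) := by
    simpa using hY.hasFDerivAt
  exact (h1.comp_hasDerivAt (0 : ℝ) (hasDerivAt_line ξ d)).unique h

theorem IsHeightChart.fderiv_inChart (hσ : 0 < σ) (he : IsHeightChart σ e) (hξ : ξ ∈ e.target)
    (d : ℂ) : fderiv ℝ (inChart σ e) ξ d = weierVec σ (coverProj σ (e.symm ξ)) d := by
  refine fderiv_eq_of_hasDerivAt_line ((he.contDiffAt_inChart hσ hξ).differentiableAt (by simp)) ?_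
  have := he.hasDerivAt_inChart_comp hσ (hasDerivAt_line ξ d) (by simpa using hξ)
  simpa using this

/-- The derivative of `weierVec` along the flow. -/
def weierVec₂ (σ : ℝ) (p : ℂ × ℂ) (ζ : ℂ) : E3 :=
  !₂[(-(1 / 2) * (1 / gaussMap σ p + gaussMap σ p) * hQuot p * ζ).re,
    (-(Complex.I / 2) * (1 / gaussMap σ p - gaussMap σ p) * hQuot p * ζ).re, 0]

theorem weierVec₂_neg (σ : ℝ) (p : ℂ × ℂ) (ζ : ℂ) : weierVec₂ σ p (-ζ) = -weierVec₂ σ p ζ := by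
  ext i; fin_cases i <;> simp [weierVec₂]

/-- The logarithmic derivative of g is h, so differentiation exchanges 1/g - g and 1/g + g up to the
factor -h. The height component is constant. -/
theorem hasDerivAt_weierVec (hσ : 0 < σ) {γ : ℝ → ℂ × ℂ} {ζ : ℂ} {t : ℝ}
    (hp : γ t ∈ puncturedCurve σ) (hγ : HasDerivAt γ (ζ • flowField σ (γ t)) t) (d : ℂ) :
    HasDerivAt (fun s => weierVec σ (γ s) d) (weierVec₂ σ (γ t) (ζ * d)) t := by
  have hs : (√σ : ℂ) ≠ 0 := by exact_mod_cast (Real.sqrt_pos.2 hσ).ne'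
  have hz := hp.2
  have h1 : HasDerivAt (fun s => (γ s).1) _ t := hγ.fst
  have hg0 : gaussMap σ (γ t) ≠ 0 := div_ne_zero hp.2 hs
  have hg : HasDerivAt (fun s => gaussMap σ (γ s)) (gaussMap σ (γ t) * hQuot (γ t) * ζ) t := by
    refine (h1.div_const (√σ : ℂ)).congr_deriv ?_
    simp only [flowField, Prod.smul_fst, smul_eq_mul, gaussMap, hQuot]
    field_simp
  have hg' : HasDerivAt (fun s => 1 / gaussMap σ (γ s)) (-(1 / gaussMap σ (γ t)) *
      hQuot (γ t) * ζ) t := by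
    refine ((hasDerivAt_const t (1 : ℂ)).div hg hg0).congr_deriv ?_
    field_simp; ring
  refine hasDerivAt_e3 ?_ ?_ ?_
  · refine (Complex.reCLM.hasFDerivAt.comp_hasDerivAt t
      (((hg'.sub hg).const_mul (1 / 2 : ℂ)).mul_const d)).congr_deriv ?_
    rw [Complex.reCLM_apply]; congr 1; ring
  · refine (Complex.reCLM.hasFDerivAt.comp_hasDerivAt t
      (((hg'.add hg).const_mul (Complex.I / 2 : ℂ)).mul_const d)).congr_deriv ?_
    rw [Complex.reCLM_apply]; congr 1; ring
  · exact hasDerivAt_const _ _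

/-- Second derivatives depend only on the product of the two directions. Since 1 · 1 and i · i are
opposite, the immersion is harmonic. -/
theorem IsHeightChart.fderiv_fderiv_inChart (hσ : 0 < σ) (he : IsHeightChart σ e)
    (hξ : ξ ∈ e.target) (d d' : ℂ) :
    fderiv ℝ (fun η => fderiv ℝ (inChart σ e) η d) ξ d' =
      weierVec₂ σ (coverProj σ (e.symm ξ)) (d' * d) := by
  have hd : DifferentiableAt ℝ (fun η => fderiv ℝ (inChart σ e) η d) ξ :=
    ((((he.contDiffAt_inChart hσ hξ).fderiv_right (m := 1) (by norm_cast)).differentiableAt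
      one_ne_zero).clm_apply (differentiableAt_const d))
  refine fderiv_eq_of_hasDerivAt_line hd ?_
  have hl := hasDerivAt_line ξ d'
  have h0 : ξ + ((0 : ℝ) : ℂ) * d' ∈ e.target := by simpa using hξ
  have h1 := hasDerivAt_weierVec hσ (coverProj_mem hσ _) (he.hasDerivAt_comp hσ hl h0) d
  simp only [Complex.ofReal_zero, zero_mul, add_zero] at h1
  refine h1.congr_of_eventuallyEq ?_
  filter_upwards [hl.continuousAt.preimage_mem_nhds (e.open_target.mem_nhds h0)] with t ht
  exact he.fderiv_inChart hσ ht d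

/-! ### Conformality and zero mean curvature. -/

theorem inner_e3 (x y : E3) : inner ℝ x y = x 0 * y 0 + x 1 * y 1 + x 2 * y 2 := by
  rw [PiLp.inner_apply, Fin.sum_univ_three]
  simp [mul_comm]

/-- This is E = G in disguise; the summand 1 is the height component, balanced by k² = m² + σ. -/
theorem minusPart_sq_add (hσ : 0 < σ) {p : ℂ × ℂ} (hp : p.1 ≠ 0) :
    ((minusPart σ p * cosArg p) ^ 2 + (minusPart σ p * sinArg p) ^ 2) / σ + 1 =
      ((plusPart σ p * sinArg p) ^ 2 + (plusPart σ p * cosArg p) ^ 2) / σ := by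
  field_simp
  linear_combination (-plusPart σ p ^ 2 + minusPart σ p ^ 2) * cosArg_sq_add_sinArg_sq hp
    - plusPart_sq (σ := σ) hp

theorem IsHeightChart.isConformalHeightOn (hσ : 0 < σ) (he : IsHeightChart σ e) :
    IsConformalHeightOn (inChart σ e) e.target := by
  intro ξ hξ
  have hp := (coverProj_mem hσ (e.symm ξ)).2
  have h1 : √σ ^ 2 = σ := Real.sq_sqrt hσ.le
  have h2 := minusPart_sq_add hσ hp
  unfold coeffE coeffF coeffG dX dY
  rw [he.fderiv_inChart hσ hξ, he.fderiv_inChart hσ hξ, weierVec_eq hσ hp, weierVec_eq hσ hp,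
    inner_e3, inner_e3, inner_e3]
  refine ⟨?_, ?_, ?_, ?_⟩
  · simp
    rw [← pow_two, ← pow_two, ← pow_two, ← pow_two, div_pow, div_pow, div_pow, div_pow, h1]
    linear_combination h2
  · simp; ring
  · simp
  · simp

theorem det3_add_right (a b c d : E3) : det3 a b c + det3 a b d = det3 a b (c + d) := by
  simp [det3, Matrix.det_fin_three]; ring

theorem IsHeightChart.isMinimalImmersionOn (hσ : 0 < σ) (he : IsHeightChart σ e) :
    IsMinimalImmersionOn (inChart σ e) e.target := by
  refine ⟨fun ξ hξ => (he.contDiffAt_inChart hσ hξ).contDiffWithinAt, fun ξ hξ => ?_⟩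
  obtain ⟨h1, h2, h3, h4⟩ := he.isConformalHeightOn hσ ξ hξ
  constructor
  · rw [LinearIndependent.pair_iff]
    intro s t hst
    have e2 := congrFun (congrArg WithLp.ofLp hst) 2
    simp [h3, h4] at e2
    subst e2
    refine ⟨rfl, ?_⟩
    have hY : dY (inChart σ e) ξ ≠ 0 := by
      intro h0
      have : coeffE (inChart σ e) ξ = 0 := by rw [h1, coeffG, h0, inner_zero_left]
      rw [coeffE, inner_e3, h3] at this
      nlinarith [sq_nonneg (dX (inChart σ e) ξ 0), sq_nonneg (dX (inChart σ e) ξ 1)]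
    simpa [hY] using hst
  -- In conformal coordinates the mean curvature condition is L + N = 0, and the sum of the two
  -- determinants is the determinant with the Laplacian of the immersion, which is zero.
  · have hsum : dX (dX (inChart σ e)) ξ + dY (dY (inChart σ e)) ξ = 0 := by
      have e1 := he.fderiv_fderiv_inChart hσ hξ 1 1
      have e2 := he.fderiv_fderiv_inChart hσ hξ Complex.I Complex.I
      rw [Complex.I_mul_I, weierVec₂_neg] at e2
      rw [mul_one] at e1
      change fderiv ℝ (fun η => fderiv ℝ (inChart σ e) η 1) ξ 1 +
        fderiv ℝ (fun η => fderiv ℝ (inChart σ e) η Complex.I) ξ Complex.I = 0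
      rw [e1, e2, add_neg_cancel]
    have hdet := det3_add_right (dX (inChart σ e) ξ) (dY (inChart σ e) ξ)
      (dX (dX (inChart σ e)) ξ) (dY (dY (inChart σ e)) ξ)
    have hz : det3 (dX (inChart σ e) ξ) (dY (inChart σ e) ξ) 0 = 0 := by
      simp [det3, Matrix.det_fin_three]
    rw [hsum, hz] at hdet
    rw [h1, h2]
    unfold coeffL coeffN
    linear_combination coeffG (inChart σ e) ξ / areaDensity (inChart σ e) ξ * hdet

/-! ### Curvature of the horizontal sections and the Shiffman function. -/

theorem hasDerivAt_vertical (x y : ℝ) : HasDerivAt (fun s : ℝ => (⟨x, s⟩ : ℂ)) Complex.I y := by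
  have : (fun s : ℝ => (⟨x, s⟩ : ℂ)) = fun s : ℝ => (x : ℂ) + s * Complex.I := by
    funext s; exact Complex.mk_eq_add_mul_I x s
  rw [this]
  simpa using ((Complex.ofRealCLM.hasDerivAt (x := y)).mul_const Complex.I).const_add (x : ℂ)

/-- With z = |z| exp (iθ), the section has velocity (k/√σ)(sin θ, -cos θ). Its tangent turns at the
rate θ' = Re h, so the curvature is √σ Re h / k. -/
theorem IsHeightChart.levelCurvature_eq (hσ : 0 < σ) (he : IsHeightChart σ e)
    (hξ : ξ ∈ e.target) :
    levelCurvature (inChart σ e) ξ = √σ * bend σ (coverProj σ (e.symm ξ)) := by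
  have h0 : 0 < √σ := Real.sqrt_pos.2 hσ
  have h1 : √σ ^ 2 = σ := Real.sq_sqrt hσ.le
  have hnear : ∀ᶠ s in 𝓝 ξ.im, (⟨ξ.re, s⟩ : ℂ) ∈ e.target :=
    (hasDerivAt_vertical ξ.re ξ.im).continuousAt (e.open_target.mem_nhds hξ)
  set P : ℝ → ℂ × ℂ := fun s => coverProj σ (e.symm ⟨ξ.re, s⟩)
  have hP : ∀ s, P s ∈ puncturedCurve σ := fun s => coverProj_mem hσ _
  have hd : ∀ s, (⟨ξ.re, s⟩ : ℂ) ∈ e.target →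
      HasDerivAt (fun s => inChart σ e ⟨ξ.re, s⟩) (weierVec σ (P s) Complex.I) s := fun s hs =>
    he.hasDerivAt_inChart_comp hσ (hasDerivAt_vertical ξ.re s) hs
  have d0 : ∀ s, (⟨ξ.re, s⟩ : ℂ) ∈ e.target → deriv (fun s => inChart σ e ⟨ξ.re, s⟩ 0) s =
      plusPart σ (P s) * sinArg (P s) / √σ := fun s hs => by
    rw [(hasDerivAt_e3_apply (hd s hs) 0).deriv, weierVec_eq hσ (hP s).2]; simp
  have d1 : ∀ s, (⟨ξ.re, s⟩ : ℂ) ∈ e.target → deriv (fun s => inChart σ e ⟨ξ.re, s⟩ 1) s =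
      -(plusPart σ (P s) * cosArg (P s)) / √σ := fun s hs => by
    rw [(hasDerivAt_e3_apply (hd s hs) 1).deriv, weierVec_eq hσ (hP s).2]; simp
  have hflow : HasDerivAt P (Complex.I • flowField σ (P ξ.im)) ξ.im :=
    he.hasDerivAt_comp hσ (hasDerivAt_vertical ξ.re ξ.im) hξ
  have hk := hasDerivAt_plusPart (hP _) hflow
  have dd0 : deriv (deriv fun s => inChart σ e ⟨ξ.re, s⟩ 0) ξ.im = _ :=
    (((hk.mul (hasDerivAt_sinArg (hP _) hflow)).div_const √σ).congr_of_eventuallyEq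
      (by filter_upwards [hnear] with s hs using d0 s hs)).deriv
  have dd1 : deriv (deriv fun s => inChart σ e ⟨ξ.re, s⟩ 1) ξ.im = _ :=
    (((hk.mul (hasDerivAt_cosArg (hP _) hflow)).neg.div_const √σ).congr_of_eventuallyEq
      (by filter_upwards [hnear] with s hs using d1 s hs)).deriv
  have hself : (⟨ξ.re, ξ.im⟩ : ℂ) ∈ e.target := hξ
  have hk0 := plusPart_pos hσ (hP ξ.im).2
  have hcs := cosArg_sq_add_sinArg_sq (hP ξ.im).2
  have hu := hQuot_re hσ (hP ξ.im).2
  have hmain : coverProj σ (e.symm ξ) = P ξ.im := rfl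
  unfold levelCurvature planarCurvature
  rw [d0 _ hself, d1 _ hself, dd0, dd1, hmain]
  have hsq : √((plusPart σ (P ξ.im) * sinArg (P ξ.im) / √σ) ^ 2 +
      (-(plusPart σ (P ξ.im) * cosArg (P ξ.im)) / √σ) ^ 2) = plusPart σ (P ξ.im) / √σ := by
    rw [Real.sqrt_eq_iff_mul_self_eq (by positivity) (by positivity)]
    field_simp
    linear_combination hcs
  rw [hsq]
  simp only [Complex.mul_re, Complex.mul_im, Complex.I_re, Complex.I_im, hu]
  field_simp
  linear_combination plusPart σ (P ξ.im) ^ 2 * bend σ (P ξ.im) * hcs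

/-- The curvature is a multiple of `bend`, whose derivative has the factor Re ζ; along a section ζ =
i. -/
theorem IsHeightChart.shiffman_eq_zero (hσ : 0 < σ) (he : IsHeightChart σ e)
    (hξ : ξ ∈ e.target) : shiffman (inChart σ e) ξ = 0 := by
  have hv := hasDerivAt_vertical ξ.re ξ.im
  have hnear : ∀ᶠ s in 𝓝 ξ.im, (⟨ξ.re, s⟩ : ℂ) ∈ e.target :=
    hv.continuousAt (e.open_target.mem_nhds hξ)
  have h1 := (hasDerivAt_bend hσ (coverProj_mem hσ _) (he.hasDerivAt_comp hσ hv hξ)).const_mul √σ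
  have h2 := h1.congr_of_eventuallyEq
    (f₁ := fun s : ℝ => levelCurvature (inChart σ e) ⟨ξ.re, s⟩)
    (by filter_upwards [hnear] with s hs using he.levelCurvature_eq hσ hs)
  rw [shiffman, h2.deriv]
  simp

end Charts

end RiemannMinimal

namespace RiemannMinimal

/-! ### Existence of height charts -/

/-- The inverse function theorem for holomorphic functions of one variable. -/
theorem exists_local_inverse {f : ℂ → ℂ} {U : Set ℂ} {x₀ : ℂ} (hU : IsOpen U)
    (hf : DifferentiableOn ℂ f U) (hx : x₀ ∈ U) (h0 : deriv f x₀ ≠ 0) :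
    ∃ S : OpenPartialHomeomorph ℂ ℂ, x₀ ∈ S.source ∧ S.source ⊆ U ∧ (∀ x, S x = f x) ∧
      ∀ y ∈ S.target, HasDerivAt S.symm (deriv f (S.symm y))⁻¹ y := by
  have hcd : ContDiffAt ℂ 1 f x₀ := (hf.contDiffOn hU).contDiffAt (hU.mem_nhds hx)
  have hd : HasFDerivAt f ((ContinuousLinearEquiv.unitsEquivAut ℂ (Units.mk0 _ h0) : ℂ ≃L[ℂ] ℂ) :
      ℂ →L[ℂ] ℂ) x₀ :=
    (hf.differentiableAt (hU.mem_nhds hx)).hasDerivAt.hasFDerivAt_equiv h0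
  set R := hcd.toOpenPartialHomeomorph f hd one_ne_zero
  -- Restricting to the open set where the derivative of f is nonzero makes the inverse
  -- differentiable on the whole target, not only at the image of x₀.
  have hdc : ContinuousOn (deriv f) U := (hf.deriv hU).continuousOn
  set O := U ∩ deriv f ⁻¹' {0}ᶜ
  have hO : IsOpen O := hdc.isOpen_inter_preimage hU isOpen_compl_singleton
  refine ⟨R.restrOpen O hO, ⟨hcd.mem_toOpenPartialHomeomorph_source hd one_ne_zero, hx, h0⟩,
    fun x hx => hx.2.1, fun x => rfl, fun y hy => ?_⟩
  have hm := (R.restrOpen O hO).map_target hy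
  have hm2 : (R.restrOpen O hO).symm y ∈ O := hm.2
  exact (R.restrOpen O hO).hasDerivAt_symm hy hm2.2
    (hf.differentiableAt (hU.mem_nhds hm2.1)).hasDerivAt

variable {σ : ℝ} {p : ℂ × ℂ} {a : ℝ}

/-- The cubic polynomial `z (z - 1) (z + σ)`. -/
def cubic (σ : ℝ) (z : ℂ) : ℂ := z * (z - 1) * (z + σ)

theorem hasDerivAt_cubic (σ : ℝ) (z : ℂ) : HasDerivAt (cubic σ) (cubicDeriv σ z) z := by
  refine (((hasDerivAt_id z).mul ((hasDerivAt_id z).sub_const 1)).mul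
    ((hasDerivAt_id z).add_const (σ : ℂ))).congr_deriv ?_
  simp [cubicDeriv]; ring

/-- `ψ` is a holomorphic parameterization of the part of the curve in `O` by the values of the
linear form `c` in `V`. -/
structure IsCurveParam (σ : ℝ) (c : ℂ × ℂ →L[ℂ] ℂ) (ψ : ℂ → ℂ × ℂ) (O : Set (ℂ × ℂ))
    (V : Set ℂ) : Prop where
  isOpen_source : IsOpen O
  isOpen_target : IsOpen V
  differentiableOn : DifferentiableOn ℂ ψ V
  map_source : ∀ p ∈ O, p ∈ puncturedCurve σ → c p ∈ V ∧ ψ (c p) = p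
  map_target : ∀ t ∈ V, ψ t ∈ O ∧ ψ t ∈ puncturedCurve σ ∧ c (ψ t) = t

/-- Near a branch point w is the coordinate, because the cubic is locally invertible there;
elsewhere z is, with w a local square root of the cubic. Points with z = 0 are removed from the
parameter domain. -/
theorem exists_isCurveParam (hσ : 0 < σ) (hp : p ∈ puncturedCurve σ) :
    ∃ c ψ O V, IsCurveParam σ c ψ O V ∧ p ∈ O := by
  by_cases hw : p.2 = 0
  · obtain ⟨S, h1, -, h3, h4⟩ := exists_local_inverse (f := cubic σ) isOpen_univ
      (fun z _ => (hasDerivAt_cubic σ z).differentiableAt.differentiableWithinAt) (mem_univ p.1)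
      (by rw [(hasDerivAt_cubic σ p.1).deriv]; exact cubicDeriv_ne_zero hσ hp hw)
    have hsq : Continuous fun w : ℂ => w ^ 2 := by fun_prop
    have hT : IsOpen (S.target ∩ S.symm ⁻¹' {0}ᶜ) :=
      S.symm.isOpen_inter_preimage isOpen_compl_singleton
    refine ⟨ContinuousLinearMap.snd ℂ ℂ ℂ, fun w => (S.symm (w ^ 2), w),
      {q | q.1 ∈ S.source}, (fun w : ℂ => w ^ 2) ⁻¹' (S.target ∩ S.symm ⁻¹' {0}ᶜ),
      ⟨S.open_source.preimage continuous_fst, hT.preimage hsq, fun w hw => ?_,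
        fun q hq hqc => ?_, fun w hw => ?_⟩, h1⟩
    · exact (((h4 _ hw.1).differentiableAt.comp w (by fun_prop : DifferentiableAt ℂ (fun w : ℂ =>
        w ^ 2) w)).prodMk differentiableAt_id).differentiableWithinAt
    · have e1 : q.2 ^ 2 = S q.1 := by rw [h3]; exact hqc.1
      have e2 : S.symm (q.2 ^ 2) = q.1 := by rw [e1]; exact S.left_inv hq
      refine ⟨⟨?_, ?_⟩, ?_⟩
      · simp only [ContinuousLinearMap.coe_snd', e1]; exact S.map_source hq
      · simp only [ContinuousLinearMap.coe_snd', mem_preimage, e2]; exact hqc.2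
      · simp only [ContinuousLinearMap.coe_snd', e2]
    · refine ⟨S.map_target hw.1, ⟨?_, hw.2⟩, rfl⟩
      have := S.right_inv hw.1
      rw [h3] at this
      exact this.symm
  · obtain ⟨S, h1, -, h3, h4⟩ := exists_local_inverse (f := fun w : ℂ => w ^ 2) isOpen_univ
      (by fun_prop) (mem_univ p.2) (by simpa using hw)
    have hcub : Continuous (cubic σ) := by unfold cubic; fun_prop
    refine ⟨ContinuousLinearMap.fst ℂ ℂ ℂ, fun z => (z, S.symm (cubic σ z)),
      {q | q.2 ∈ S.source}, cubic σ ⁻¹' S.target ∩ {0}ᶜ,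
      ⟨S.open_source.preimage continuous_snd,
        (S.open_target.preimage hcub).inter isOpen_compl_singleton, fun z hz => ?_,
        fun q hq hqc => ?_, fun z hz => ?_⟩, h1⟩
    · exact (differentiableAt_id.prodMk ((h4 _ hz.1).differentiableAt.comp z
        (hasDerivAt_cubic σ z).differentiableAt)).differentiableWithinAt
    · have e1 : cubic σ q.1 = S q.2 := by rw [h3]; exact hqc.1.symm
      have e2 : S.symm (cubic σ q.1) = q.2 := by rw [e1]; exact S.left_inv hq
      refine ⟨⟨?_, hqc.2⟩, ?_⟩
      · simp only [ContinuousLinearMap.coe_fst', mem_preimage, e1]; exact S.map_source hq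
      · simp only [ContinuousLinearMap.coe_fst', e2]
    · refine ⟨S.map_target hz.1, ⟨?_, hz.2⟩, rfl⟩
      have := S.right_inv hz.1
      rw [h3] at this
      exact this

/-- The derivative of ψ is a multiple of `flowField`, and c ∘ ψ = id fixes the multiple. -/
theorem IsCurveParam.hasDerivAt (hσ : 0 < σ) {c : ℂ × ℂ →L[ℂ] ℂ} {ψ : ℂ → ℂ × ℂ}
    {O : Set (ℂ × ℂ)} {V : Set ℂ} (h : IsCurveParam σ c ψ O V) {t : ℂ} (ht : t ∈ V) :
    c (flowField σ (ψ t)) ≠ 0 ∧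
      HasDerivAt ψ ((1 / c (flowField σ (ψ t))) • flowField σ (ψ t)) t := by
  have hV := h.isOpen_target.mem_nhds ht
  have h1 := (h.differentiableOn.differentiableAt hV).hasDerivAt
  have hl := hasDerivAt_line t 1
  have h0 : t + ((0 : ℝ) : ℂ) * 1 = t := by simp
  have h2 : HasDerivAt (fun s : ℝ => ψ (t + s * 1)) (deriv ψ t) 0 := by
    have h1' : HasDerivAt ψ (deriv ψ t) (t + ((0 : ℝ) : ℂ) * 1) := by rw [h0]; exact h1
    simpa [Function.comp_def] using h1'.scomp (0 : ℝ) hl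
  have h3 := tangent_of_hasDerivAt (σ := σ) h2 (by
    filter_upwards [hl.continuousAt.preimage_mem_nhds (by rwa [h0])] with s hs
    exact (h.map_target _ hs).2.1)
  rw [h0] at h3
  have h4 := eq_phi3_smul_flowField hσ (h.map_target t ht).2.1 h3
  have h5 : HasDerivAt (fun s => c (ψ s)) (c (deriv ψ t)) t :=
    c.hasFDerivAt.comp_hasDerivAt t h1
  have h6 := h5.unique ((hasDerivAt_id t).congr_of_eventuallyEq (by
    filter_upwards [hV] with s hs using (h.map_target s hs).2.2))
  rw [h4, map_smul, smul_eq_mul] at h6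
  have h7 : c (flowField σ (ψ t)) ≠ 0 := right_ne_zero_of_mul_eq_one h6
  refine ⟨h7, ?_⟩
  rw [← eq_div_iff h7] at h6
  rw [← h6, ← h4]; exact h1

/-- The difference of the angle of a point and the angle `a`, as a point of the unit circle. -/
def angleUnit (σ a : ℝ) (p : ℂ × ℂ) : ℂ :=
  ((angleCos σ p : ℂ) + (bend σ p : ℂ) * Complex.I) * Complex.exp (-a * Complex.I)

theorem angleUnit_eq (hσ : 0 < σ) {b : ℝ} (h : IsAngle σ p b) :
    angleUnit σ a p = Complex.exp (((b - a : ℝ) : ℂ) * Complex.I) := by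
  obtain ⟨h1, h2⟩ := (isAngle_iff hσ).1 h
  rw [angleUnit, h1, h2, Complex.ofReal_cos, Complex.ofReal_sin, ← Complex.exp_mul_I,
    ← Complex.exp_add]
  congr 1; push_cast; ring

theorem arg_angleUnit (hσ : 0 < σ) {b : ℝ} (h : IsAngle σ p b) (hb : |b - a| < Real.pi) :
    (angleUnit σ a p).arg = b - a := by
  have := abs_lt.1 hb
  rw [angleUnit_eq hσ h, Complex.exp_mul_I, Complex.arg_cos_add_sin_mul_I ⟨this.1, this.2.le⟩]

theorem isAngle_add_arg (hσ : 0 < σ) (hp : p ∈ puncturedCurve σ) :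
    IsAngle σ p (a + (angleUnit σ a p).arg) := by
  obtain ⟨b, hb⟩ := exists_isAngle hσ hp
  have h1 : Complex.exp (((angleUnit σ a p).arg : ℂ) * Complex.I) =
      Complex.exp (((b - a : ℝ) : ℂ) * Complex.I) := by
    have h2 := Complex.norm_mul_exp_arg_mul_I (angleUnit σ a p)
    rw [← angleUnit_eq hσ hb]
    nth_rewrite 2 [← h2]
    rw [angleUnit_eq hσ hb, Complex.norm_exp_ofReal_mul_I]; simp
  obtain ⟨k, hk⟩ := Complex.exp_eq_exp_iff_exists_int.1 h1
  have h3 : (angleUnit σ a p).arg = b - a + k * (2 * Real.pi) := by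
    have h4 : ((angleUnit σ a p).arg : ℂ) * Complex.I =
        ((b - a + k * (2 * Real.pi) : ℝ) : ℂ) * Complex.I := by
      rw [hk]; push_cast; ring
    exact_mod_cast mul_right_cancel₀ Complex.I_ne_zero h4
  rw [h3, show a + (b - a + k * (2 * Real.pi)) = b + k * (2 * Real.pi) by ring]
  exact hb.add_two_pi_mul k

theorem continuousOn_angleUnit (hσ : 0 < σ) {X : Type*} [TopologicalSpace X] {f : X → ℂ × ℂ}
    {s : Set X} (hf : ContinuousOn f s) (h0 : ∀ x ∈ s, (f x).1 ≠ 0) :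
    ContinuousOn (fun x => angleUnit σ a (f x)) s :=
  ((Complex.continuous_ofReal.comp_continuousOn (continuousOn_angleCos hσ hf h0)).add
    ((Complex.continuous_ofReal.comp_continuousOn (continuousOn_bend hσ hf h0)).mul
      continuousOn_const)).mul continuousOn_const

theorem coverAngle_eq (hσ : 0 < σ) (h : (p, position σ p a) ∈ weierstrassCover σ) :
    coverAngle hσ ⟨(p, position σ p a), h⟩ = a := by
  unfold coverAngle
  rw [Homeomorph.symm_apply_eq, heightHomeo_apply]; simp [position]

/-- A parameterization of the curve lifts to the covering surface. -/
theorem IsCurveParam.exists_chart (hσ : 0 < σ) {c : ℂ × ℂ →L[ℂ] ℂ} {ψ : ℂ → ℂ × ℂ}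
    {O : Set (ℂ × ℂ)} {V : Set ℂ} (h : IsCurveParam σ c ψ O V) (q₀ : weierstrassCover σ)
    (hq₀ : coverProj σ q₀ ∈ O) :
    ∃ e : OpenPartialHomeomorph (weierstrassCover σ) ℂ, q₀ ∈ e.source ∧ e.target ⊆ V ∧
      ∀ t ∈ e.target, coverProj σ (e.symm t) = ψ t := by
  classical
  set a := coverAngle hσ q₀
  -- The sheet through q₀ is selected by the principal argument of the angle relative to that of q₀.
  -- Restricting to angles at distance less than π keeps the argument off its cut.
  set P : ℂ → (ℂ × ℂ) × E3 := fun t =>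
    (ψ t, position σ (ψ t) (a + (angleUnit σ a (ψ t)).arg)) with hP
  have hPm : ∀ t ∈ V, P t ∈ weierstrassCover σ := fun t ht =>
    (mem_weierstrassCover_iff hσ).2 ⟨(h.map_target t ht).2.1, _,
      isAngle_add_arg hσ (h.map_target t ht).2.1, rfl⟩
  -- The default q₀ is never used on V, where P takes values in the covering.
  set inv : ℂ → weierstrassCover σ := fun t => if ht : P t ∈ weierstrassCover σ then ⟨P t, ht⟩ else q₀
  have hinv : ∀ t (ht : t ∈ V), inv t = ⟨P t, hPm t ht⟩ := fun t ht => dif_pos (hPm t ht)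
  have hψc : ContinuousOn ψ V := h.differentiableOn.continuousOn
  have hu : ContinuousOn (fun t => angleUnit σ a (ψ t)) V :=
    continuousOn_angleUnit hσ hψc fun t ht => (h.map_target t ht).2.1.2
  have hleft : ∀ q : weierstrassCover σ, coverProj σ q ∈ O → |coverAngle hσ q - a| < Real.pi →
      angleUnit σ a (ψ (c (coverProj σ q))) ∈ Complex.slitPlane ∧ inv (c (coverProj σ q)) = q := by
    intro q hq hqa
    obtain ⟨hV, hψ⟩ := h.map_source _ hq (coverProj_mem hσ q)
    obtain ⟨ha, hx⟩ := coverAngle_spec hσ q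
    have harg := arg_angleUnit hσ ha hqa
    constructor
    · rw [hψ, Complex.mem_slitPlane_iff_arg, harg]
      refine ⟨by linarith [(abs_lt.1 hqa).2], ?_⟩
      rw [angleUnit_eq hσ ha]; exact Complex.exp_ne_zero _
    · rw [hinv _ hV]
      apply Subtype.ext
      simp only [hP]
      rw [hψ, harg, add_sub_cancel, ← hx]; rfl
  refine ⟨{ toFun := fun q => c (coverProj σ q)
            invFun := inv
            source := {q | coverProj σ q ∈ O ∧ |coverAngle hσ q - a| < Real.pi}
            target := V ∩ (fun t => angleUnit σ a (ψ t)) ⁻¹' Complex.slitPlane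
            map_source' := fun q hq =>
              ⟨(h.map_source _ hq.1 (coverProj_mem hσ q)).1, (hleft q hq.1 hq.2).1⟩
            map_target' := fun t ht => ?_
            left_inv' := fun q hq => (hleft q hq.1 hq.2).2
            right_inv' := fun t ht => ?_
            open_source := ?_
            open_target := hu.isOpen_inter_preimage h.isOpen_target Complex.isOpen_slitPlane
            continuousOn_toFun := (c.continuous.comp (continuous_coverProj σ)).continuousOn
            continuousOn_invFun := ?_ }, ?_, inter_subset_left, fun t ht => ?_⟩
  · rw [hinv t ht.1]
    refine ⟨(h.map_target t ht.1).1, ?_⟩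
    rw [coverAngle_eq, add_sub_cancel_left, abs_lt]
    have := (Complex.mem_slitPlane_iff_arg.1 ht.2).1
    exact ⟨Complex.neg_pi_lt_arg _, lt_of_le_of_ne (Complex.arg_le_pi _) this⟩
  · rw [hinv t ht.1]; exact (h.map_target t ht.1).2.2
  · rw [Topology.IsInducing.subtypeVal.continuousOn_iff]
    have hψ' := hψc.mono (inter_subset_left :
      V ∩ (fun t => angleUnit σ a (ψ t)) ⁻¹' Complex.slitPlane ⊆ V)
    have harg : ContinuousOn (fun t => a + (angleUnit σ a (ψ t)).arg)
        (V ∩ (fun t => angleUnit σ a (ψ t)) ⁻¹' Complex.slitPlane) := fun t ht =>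
      continuousWithinAt_const.add (ContinuousAt.comp_continuousWithinAt
        (f := fun t => angleUnit σ a (ψ t)) (Complex.continuousAt_arg ht.2) ((hu t ht.1).mono inter_subset_left))
    refine (hψ'.prodMk (continuousOn_position hσ hψ'
      (fun t ht => (h.map_target t ht.1).2.1.2) harg)).congr fun t ht => ?_
    simp [hinv t ht.1, hP]
  · exact (h.isOpen_source.preimage (continuous_coverProj σ)).inter
      (isOpen_lt ((continuous_coverAngle hσ).sub continuous_const).abs continuous_const)
  · exact ⟨hq₀, by simp [a, Real.pi_pos]⟩
  · change coverProj σ (inv t) = ψ t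
    rw [hinv t ht.1]; rfl

theorem exists_isHeightChart (hσ : 0 < σ) (q : weierstrassCover σ) :
    ∃ e : OpenPartialHomeomorph (weierstrassCover σ) ℂ, IsHeightChart σ e ∧ q ∈ e.source := by
  obtain ⟨c, ψ, O, V, h, hq⟩ := exists_isCurveParam hσ (coverProj_mem hσ q)
  obtain ⟨e, he, heV, hes⟩ := h.exists_chart hσ q hq
  -- In the parameter t the form φ₃ is f dt. A primitive of f on a disc, restricted so as to be
  -- invertible, is the height coordinate.
  set f : ℂ → ℂ := fun t => 1 / c (flowField σ (ψ t)) with hf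
  have hfd : DifferentiableOn ℂ f e.target := fun t ht => by
    have hψ := h.differentiableOn.differentiableAt (h.isOpen_target.mem_nhds (heV ht))
    have hfl : DifferentiableAt ℂ (fun t => flowField σ (ψ t)) t := by
      refine hψ.snd.prodMk ?_
      have : DifferentiableAt ℂ (fun t => (ψ t).1) t := hψ.fst
      unfold cubicDeriv
      fun_prop
    exact ((differentiableAt_const _).div (c.differentiableAt.comp t hfl)
      (h.hasDerivAt hσ (heV ht)).1).differentiableWithinAt
  obtain ⟨r, hr, hball⟩ := Metric.isOpen_iff.1 e.open_target _ (e.map_source he)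
  obtain ⟨Ξ, hΞ⟩ := (hfd.mono hball).isExactOn_ball
  have hf0 : ∀ t ∈ e.target, f t ≠ 0 := fun t ht => one_div_ne_zero (h.hasDerivAt hσ (heV ht)).1
  obtain ⟨S, hS1, hS2, -, hS4⟩ := exists_local_inverse Metric.isOpen_ball
    (fun t ht => (hΞ t ht).differentiableAt.differentiableWithinAt) (Metric.mem_ball_self hr)
    (by rw [(hΞ _ (Metric.mem_ball_self hr)).deriv]; exact hf0 _ (e.map_source he))
  have hder : ∀ ξ ∈ (e.trans S).target, HasDerivAt (fun η => coverProj σ ((e.trans S).symm η))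
      (flowField σ (coverProj σ ((e.trans S).symm ξ))) ξ := fun ξ hξ => by
    rw [OpenPartialHomeomorph.trans_target] at hξ
    have hb := hS2 (S.map_target hξ.1)
    have h1 := hS4 ξ hξ.1
    rw [(hΞ _ hb).deriv] at h1
    have h2 := (h.hasDerivAt hσ (heV hξ.2)).2.scomp ξ h1
    have h3 : HasDerivAt (fun η => ψ (S.symm η)) (flowField σ (ψ (S.symm ξ))) ξ := by
      refine h2.congr_deriv ?_
      rw [smul_smul]
      have h4 := hf0 _ hξ.2
      simp only [hf] at h4 ⊢
      rw [inv_mul_cancel₀ h4, one_smul]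
    have h5 : ∀ η, η ∈ (e.trans S).target → coverProj σ ((e.trans S).symm η) = ψ (S.symm η) :=
      fun η hη => by
        rw [OpenPartialHomeomorph.trans_target] at hη
        exact hes _ hη.2
    have hξ' : ξ ∈ (e.trans S).target := by rw [OpenPartialHomeomorph.trans_target]; exact hξ
    rw [h5 ξ hξ']
    refine h3.congr_of_eventuallyEq ?_
    filter_upwards [(e.trans S).open_target.mem_nhds hξ'] with η hη using h5 η hη
  refine ⟨e.trans S, ⟨fun ξ hξ => (hder ξ hξ).differentiableAt.differentiableWithinAt,
    fun ξ hξ => ?_⟩, ?_⟩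
  · rw [(hder ξ hξ).deriv]
    simpa using phi3_smul_flowField hσ (coverProj_mem hσ ((e.trans S).symm ξ)) 1
  · rw [OpenPartialHomeomorph.trans_source]; exact ⟨he, hS1⟩

end RiemannMinimal

namespace RiemannMinimal

/-! ### The circles of the Riemann examples -/

/-- The positive number t = 2/(√(λ² + 4) - λ) is the positive root of t² - λ t - 1 = 0, that is, λ =
t - 1/t. Here t = √σ. -/
theorem eq_sq_two_div_iff {σ : ℝ} (hσ : 0 < σ) (lam : ℝ) :
    σ = (2 / (√(lam ^ 2 + 4) - lam)) ^ 2 ↔ lam = √σ - 1 / √σ := by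
  have ht : 0 < √σ := Real.sqrt_pos.2 hσ
  have ht2 : √σ ^ 2 = σ := Real.sq_sqrt hσ.le
  constructor
  · intro h
    have hs2 : √(lam ^ 2 + 4) ^ 2 = lam ^ 2 + 4 := Real.sq_sqrt (by positivity)
    have hs : lam < √(lam ^ 2 + 4) :=
      lt_of_le_of_lt (le_abs_self lam) (by
        rw [← Real.sqrt_sq_eq_abs]; exact Real.sqrt_lt_sqrt (sq_nonneg _) (by linarith))
    have h1 : √σ = 2 / (√(lam ^ 2 + 4) - lam) := by
      rw [h, Real.sqrt_sq]; exact div_nonneg zero_le_two (by linarith)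
    rw [h1]
    generalize √(lam ^ 2 + 4) = s at *
    have : s - lam ≠ 0 := by linarith
    field_simp
    linear_combination hs2
  · rintro rfl
    have h1 : √((√σ - 1 / √σ) ^ 2 + 4) = √σ + 1 / √σ := by
      rw [Real.sqrt_eq_iff_mul_self_eq (by positivity) (by positivity)]; field_simp; ring
    rw [h1, show √σ + 1 / √σ - (√σ - 1 / √σ) = 2 / √σ by ring, ← ht2]
    simp

/-- The parameter of the Riemann example that belongs to `σ = ρ⁴`. -/
def riemannParam (ρ : ℝ) : ℝ := ρ ^ 2 - 1 / ρ ^ 2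

/-- The angle of the circle of squared radius `q`. -/
def circleAngle (ρ q : ℝ) : ℝ := Real.pi / 2 - Real.arctan √(ρ ^ 2 * q - 1)

/-- The first coordinate of the centre of the horizontal section at angle `a`. -/
def axisFn (σ a : ℝ) : ℝ := shiftFn σ a + Real.cos a * delta σ a / (√σ * Real.sin a)

theorem hasDerivAt_delta {σ : ℝ} (hσ : 0 < σ) (a : ℝ) :
    HasDerivAt (delta σ) (σ * Real.sin a * Real.cos a / delta σ a) a := by
  refine ((((Real.hasDerivAt_sin a).pow 2).const_mul σ).const_add 1
    |>.sqrt (delta_arg_pos hσ a).ne').congr_deriv ?_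
  simp only [Pi.pow_apply]
  rw [← delta]
  have := (delta_pos hσ a).ne'
  field_simp
  push_cast; ring

/-- Adding the derivative of the centre offset to the shift integrand collapses to one term, by δ² =
1 + σ sin² a and sin² + cos² = 1. This term matches u du / √(radicand). -/
theorem hasDerivAt_axisFn {σ : ℝ} (hσ : 0 < σ) {a : ℝ} (ha : Real.sin a ≠ 0) :
    HasDerivAt (axisFn σ) (-(1 / (√σ * delta σ a * Real.sin a ^ 2))) a := by
  have h0 : √σ ≠ 0 := (Real.sqrt_pos.2 hσ).ne'
  have h1 : √σ ^ 2 = σ := Real.sq_sqrt hσ.le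
  have hd := (delta_pos hσ a).ne'
  have hd2 := delta_sq hσ a
  refine ((hasDerivAt_shiftFn hσ a).add (((Real.hasDerivAt_cos a).mul (hasDerivAt_delta hσ a)).div
    ((Real.hasDerivAt_sin a).const_mul √σ) (mul_ne_zero h0 ha))).congr_deriv ?_
  simp only [Pi.mul_apply]
  field_simp
  rw [h1]
  linear_combination (-Real.sin a ^ 2 - Real.cos a ^ 2) * hd2 +
    (-1 - σ * Real.sin a ^ 2 + σ * Real.sin a ^ 2) * Real.sin_sq_add_cos_sq a

section Circles

variable {ρ : ℝ}

theorem sqrt_four_add_riemannParam_sq (hρ : 0 < ρ) :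
    √(4 + riemannParam ρ ^ 2) = ρ ^ 2 + 1 / ρ ^ 2 := by
  rw [Real.sqrt_eq_iff_mul_self_eq (by positivity) (by positivity), riemannParam]
  field_simp; ring

theorem qMin_riemannParam (hρ : 0 < ρ) : qMin (riemannParam ρ) = 1 / ρ ^ 2 := by
  rw [qMin, sqrt_four_add_riemannParam_sq hρ, riemannParam]; ring

theorem sqrt_pow_four (ρ : ℝ) : √(ρ ^ 4) = ρ ^ 2 := by
  rw [show ρ ^ 4 = (ρ ^ 2) ^ 2 by ring, Real.sqrt_sq (sq_nonneg ρ)]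

theorem one_le_mul_of_le (hρ : 0 < ρ) {q : ℝ} (hq : 1 / ρ ^ 2 ≤ q) : 1 ≤ ρ ^ 2 * q := by
  rw [div_le_iff₀ (by positivity)] at hq; linarith

theorem cos_arctan_sqrt (hρ : 0 < ρ) {q : ℝ} (hq : 1 / ρ ^ 2 ≤ q) :
    √(1 + √(ρ ^ 2 * q - 1) ^ 2) = ρ * √q := by
  rw [Real.sq_sqrt (by linarith [one_le_mul_of_le hρ hq]), add_sub_cancel,
    Real.sqrt_mul (sq_nonneg ρ), Real.sqrt_sq hρ.le]

/-- A section of M has radius 1/(ρ² |sin a|). After scaling by ρ this must be √q, which dictates the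
angle. -/
theorem sin_circleAngle (hρ : 0 < ρ) {q : ℝ} (hq : 1 / ρ ^ 2 ≤ q) :
    Real.sin (circleAngle ρ q) = 1 / (ρ * √q) := by
  rw [circleAngle, Real.sin_pi_div_two_sub, Real.cos_arctan, cos_arctan_sqrt hρ hq]

theorem circleAngle_mem (ρ q : ℝ) : circleAngle ρ q ∈ Ioc 0 (Real.pi / 2) := by
  have h1 := Real.arctan_lt_pi_div_two √(ρ ^ 2 * q - 1)
  have h2 : 0 ≤ Real.arctan √(ρ ^ 2 * q - 1) := Real.arctan_nonneg.2 (Real.sqrt_nonneg _)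
  exact ⟨by unfold circleAngle; linarith, by unfold circleAngle; linarith⟩

theorem sin_circleAngle_pos (ρ q : ℝ) : 0 < Real.sin (circleAngle ρ q) :=
  Real.sin_pos_of_pos_of_lt_pi (circleAngle_mem ρ q).1
    (by linarith [(circleAngle_mem ρ q).2, Real.pi_pos])

theorem circleAngle_qMin (hρ : 0 < ρ) : circleAngle ρ (1 / ρ ^ 2) = Real.pi / 2 := by
  have : ρ ^ 2 * (1 / ρ ^ 2) - 1 = 0 := by field_simp; ring
  rw [circleAngle, this]; simp

theorem circleAngle_of_mem (hρ : 0 < ρ) {a : ℝ} (ha : a ∈ Ioc 0 (Real.pi / 2)) :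
    circleAngle ρ ((1 / (ρ * Real.sin a)) ^ 2) = a := by
  have hs : 0 < Real.sin a := Real.sin_pos_of_pos_of_lt_pi ha.1 (by linarith [ha.2, Real.pi_pos])
  have hc : 0 ≤ Real.cos a := Real.cos_nonneg_of_neg_pi_div_two_le_of_le
    (by linarith [ha.1, Real.pi_pos]) ha.2
  have h1 : √(ρ ^ 2 * (1 / (ρ * Real.sin a)) ^ 2 - 1) = Real.tan (Real.pi / 2 - a) := by
    rw [Real.tan_eq_sin_div_cos, Real.sin_pi_div_two_sub, Real.cos_pi_div_two_sub,
      Real.sqrt_eq_iff_mul_self_eq _ (by positivity)]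
    · field_simp
      linear_combination -Real.sin_sq_add_cos_sq a
    · have : ρ ^ 2 * (1 / (ρ * Real.sin a)) ^ 2 - 1 = (Real.cos a / Real.sin a) ^ 2 := by
        field_simp
        linear_combination -Real.sin_sq_add_cos_sq a
      rw [this]; positivity
  rw [circleAngle, h1, Real.arctan_tan (by linarith [ha.2, Real.pi_pos]) (by linarith [ha.1])]
  ring

theorem continuous_circleAngle (ρ : ℝ) : Continuous (circleAngle ρ) := by
  unfold circleAngle; fun_prop

theorem hasDerivAt_circleAngle (hρ : 0 < ρ) {q : ℝ} (hq : 1 / ρ ^ 2 < q) :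
    HasDerivAt (circleAngle ρ) (-(1 / (2 * q * √(ρ ^ 2 * q - 1)))) q := by
  have h0 : 0 < ρ ^ 2 * q - 1 := by rw [div_lt_iff₀ (by positivity)] at hq; linarith
  have hq0 : 0 < q := lt_trans (by positivity) hq
  have h1 : HasDerivAt (fun q => √(ρ ^ 2 * q - 1)) (ρ ^ 2 / (2 * √(ρ ^ 2 * q - 1))) q := by
    simpa using ((((hasDerivAt_id q).const_mul (ρ ^ 2)).sub_const 1).sqrt h0.ne')
  refine (h1.arctan.const_sub (Real.pi / 2)).congr_deriv ?_
  rw [Real.sq_sqrt h0.le, add_sub_cancel]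
  have := (Real.sqrt_pos.2 h0).ne'
  field_simp

theorem delta_circleAngle (hρ : 0 < ρ) {q : ℝ} (hq : 1 / ρ ^ 2 ≤ q) :
    delta (ρ ^ 4) (circleAngle ρ q) = √(q + ρ ^ 2) / √q := by
  have hq0 : 0 < q := lt_of_lt_of_le (by positivity) hq
  rw [delta, sin_circleAngle hρ hq, ← Real.sqrt_div (by positivity), div_pow, mul_pow,
    Real.sq_sqrt hq0.le]
  congr 1; field_simp

/-- For λ = ρ² - 1/ρ² the radicand factors as u (u + ρ²)(u - 1/ρ²). -/
theorem sqrt_radicand (hρ : 0 < ρ) {q : ℝ} (hq : 1 / ρ ^ 2 ≤ q) :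
    √(radicand (riemannParam ρ) q) = √q * √(ρ ^ 2 * q - 1) * √(q + ρ ^ 2) / ρ := by
  have hq0 : 0 < q := lt_of_lt_of_le (by positivity) hq
  have h1 := one_le_mul_of_le hρ hq
  rw [← Real.sqrt_mul hq0.le, ← Real.sqrt_mul (mul_nonneg hq0.le (by linarith)), eq_div_iff hρ.ne']
  nth_rewrite 2 [← Real.sqrt_sq hρ.le]
  rw [← Real.sqrt_mul' _ (sq_nonneg ρ)]
  congr 1
  unfold radicand riemannParam
  field_simp; ring

/-- The integrands are singular at the lower limit `qMin`. A nonnegative derivative of a function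
continuous up to the endpoints is automatically integrable. -/
theorem integral_eq_sub_of_nonneg {f g : ℝ → ℝ} {a b : ℝ} (hab : a ≤ b)
    (hc : ContinuousOn g (Icc a b)) (hd : ∀ x ∈ Ioo a b, HasDerivAt g (f x) x)
    (h0 : ∀ x ∈ Ioo a b, 0 ≤ f x) : ∫ x in a..b, f x = g b - g a :=
  intervalIntegral.integral_eq_sub_of_hasDerivAt_of_le hab hc hd
    ((intervalIntegrable_iff_integrableOn_Ioc_of_le hab).2
      (intervalIntegral.integrableOn_deriv_of_nonneg hc hd h0))

/-! ### The integrals of the Riemann example as elliptic integrals in the angle, and the point A. -/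

theorem height_eq (hρ : 0 < ρ) {q : ℝ} (hq : 1 / ρ ^ 2 ≤ q) : height (riemannParam ρ) q =
    ρ * (heightFn (ρ ^ 4) (Real.pi / 2) - heightFn (ρ ^ 4) (circleAngle ρ q)) := by
  have hσ : 0 < ρ ^ 4 := by positivity
  rw [height, qMin_riemannParam hρ, integral_eq_sub_of_nonneg
    (g := fun u => -(2 * ρ) * heightFn (ρ ^ 4) (circleAngle ρ u)) hq
    (continuous_const.mul ((contDiff_heightFn hσ).continuous.comp
      (continuous_circleAngle ρ))).continuousOn (fun u hu => ?_)
    (fun u _ => by positivity), circleAngle_qMin hρ]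
  · ring
  · have h0 : 0 < ρ ^ 2 * u - 1 := by
      have := hu.1; rw [div_lt_iff₀ (by positivity)] at this; linarith
    have hu0 : 0 < u := lt_trans (by positivity) hu.1
    refine (((hasDerivAt_heightFn hσ _).comp u (hasDerivAt_circleAngle hρ hu.1)).const_mul
      (-(2 * ρ))).congr_deriv ?_
    rw [delta_circleAngle hρ hu.1.le, sqrt_radicand hρ hu.1.le]
    have h1 := (Real.sqrt_pos.2 h0).ne'
    have h2 := (Real.sqrt_pos.2 hu0).ne'
    have h3 : √(u + ρ ^ 2) ≠ 0 := (Real.sqrt_pos.2 (by positivity)).ne'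
    have h4 : √u ^ 2 = u := Real.sq_sqrt hu0.le
    field_simp
    rw [h4]

theorem centre_eq (hρ : 0 < ρ) {q : ℝ} (hq : 1 / ρ ^ 2 ≤ q) : centre (riemannParam ρ) q =
    ρ * (shiftFn (ρ ^ 4) (Real.pi / 2) - axisFn (ρ ^ 4) (circleAngle ρ q)) := by
  have hσ : 0 < ρ ^ 4 := by positivity
  have hax : ∀ q, ContinuousAt (axisFn (ρ ^ 4)) (circleAngle ρ q) := fun q =>
    (hasDerivAt_axisFn hσ (sin_circleAngle_pos ρ q).ne').continuousAt
  have hpi : axisFn (ρ ^ 4) (Real.pi / 2) = shiftFn (ρ ^ 4) (Real.pi / 2) := by simp [axisFn]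
  rw [centre, qMin_riemannParam hρ, integral_eq_sub_of_nonneg
    (g := fun u => (2 * ρ) * axisFn (ρ ^ 4) (circleAngle ρ u)) hq
    (continuous_const.mul (continuous_iff_continuousAt.2 fun q =>
      (hax q).comp (continuous_circleAngle ρ).continuousAt)).continuousOn (fun u hu => ?_)
    (fun u hu => ?_), circleAngle_qMin hρ, hpi]
  · ring
  · have h0 : 0 < ρ ^ 2 * u - 1 := by
      have := hu.1; rw [div_lt_iff₀ (by positivity)] at this; linarith
    have hu0 : 0 < u := lt_trans (by positivity) hu.1
    refine (((hasDerivAt_axisFn hσ (sin_circleAngle_pos ρ u).ne').comp u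
      (hasDerivAt_circleAngle hρ hu.1)).const_mul (2 * ρ)).congr_deriv ?_
    rw [delta_circleAngle hρ hu.1.le, sqrt_radicand hρ hu.1.le, sin_circleAngle hρ hu.1.le,
      sqrt_pow_four]
    have h1 := (Real.sqrt_pos.2 h0).ne'
    have h2 := (Real.sqrt_pos.2 hu0).ne'
    have h3 : √(u + ρ ^ 2) ≠ 0 := (Real.sqrt_pos.2 (by positivity)).ne'
    have h4 : √u ^ 2 = u := Real.sq_sqrt hu0.le
    field_simp
    rw [show √u ^ 4 = (√u ^ 2) ^ 2 by ring, h4]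
  · have hu0 : 0 < u := lt_trans (by positivity) hu.1
    positivity

theorem tendsto_circleAngle (hρ : 0 < ρ) : Tendsto (circleAngle ρ) atTop (𝓝 0) := by
  have h1 : Tendsto (fun q : ℝ => √(ρ ^ 2 * q - 1)) atTop atTop :=
    Real.tendsto_sqrt_atTop.comp (tendsto_atTop_add_const_right _ _
      (tendsto_id.const_mul_atTop (by positivity)))
  have h2 := (Real.tendsto_arctan_atTop.mono_right nhdsWithin_le_nhds).comp h1
  have h3 := h2.const_sub (Real.pi / 2)
  rw [sub_self] at h3
  exact h3

theorem tendsto_height (hρ : 0 < ρ) : Tendsto (height (riemannParam ρ)) atTop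
    (𝓝 (ρ * heightFn (ρ ^ 4) (Real.pi / 2))) := by
  have hσ : 0 < ρ ^ 4 := by positivity
  have h1 := ((contDiff_heightFn hσ).continuous.tendsto 0).comp (tendsto_circleAngle hρ)
  rw [heightFn_zero] at h1
  have h2 := (h1.const_sub (heightFn (ρ ^ 4) (Real.pi / 2))).const_mul ρ
  rw [sub_zero] at h2
  refine h2.congr' ?_
  filter_upwards [eventually_ge_atTop (1 / ρ ^ 2)] with q hq using (height_eq hρ hq).symm

theorem tendsto_centre (hρ : 0 < ρ) : Tendsto (fun q => centre (riemannParam ρ) q + √q) atTop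
    (𝓝 (ρ * shiftFn (ρ ^ 4) (Real.pi / 2))) := by
  have hσ : 0 < ρ ^ 4 := by positivity
  -- Both the centre and √q diverge. Their sum contains (1 - cos a · δ)/sin a; multiplying by 1 +
  -- cos a · δ and using the oval equation leaves a quotient that is continuous at a = 0.
  set G : ℝ → ℝ := fun a => ρ * (shiftFn (ρ ^ 4) (Real.pi / 2) - shiftFn (ρ ^ 4) a -
    Real.sin a * (ρ ^ 4 - 1 - ρ ^ 4 * Real.sin a ^ 2) /
      (ρ ^ 2 * (Real.cos a * delta (ρ ^ 4) a + 1))) with hG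
  have hGc : ContinuousAt G 0 := by
    have h1 := (contDiff_shiftFn hσ).continuous
    have h2 := (contDiff_delta hσ).continuous
    refine continuousAt_const.mul ((continuousAt_const.sub h1.continuousAt).sub
      (ContinuousAt.div (by fun_prop) (by fun_prop) ?_))
    have := delta_pos hσ 0
    simp only [Real.cos_zero, one_mul]
    positivity
  have hG0 : G 0 = ρ * shiftFn (ρ ^ 4) (Real.pi / 2) := by simp [hG, shiftFn_zero]
  rw [← hG0]
  refine (hGc.tendsto.comp (tendsto_circleAngle hρ)).congr' ?_
  filter_upwards [eventually_ge_atTop (1 / ρ ^ 2)] with q hq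
  have hq0 : 0 < q := lt_of_lt_of_le (by positivity) hq
  have hs := sin_circleAngle_pos ρ q
  have hsq : √q = 1 / (ρ * Real.sin (circleAngle ρ q)) := by
    have := Real.sqrt_pos.2 hq0
    rw [sin_circleAngle hρ hq]; field_simp
  have hc : 0 ≤ Real.cos (circleAngle ρ q) := Real.cos_nonneg_of_neg_pi_div_two_le_of_le
    (by linarith [(circleAngle_mem ρ q).1, Real.pi_pos]) (circleAngle_mem ρ q).2
  rw [centre_eq hρ hq, hsq]
  simp only [hG, Function.comp, axisFn, sqrt_pow_four]
  generalize circleAngle ρ q = a at *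
  have ho := oval_of_angle hσ a
  have hd := delta_pos hσ a
  have hcd : Real.cos a * delta (ρ ^ 4) a + 1 ≠ 0 := by positivity
  generalize delta (ρ ^ 4) a = D at *
  field_simp
  linear_combination ho

theorem pointA_eq (hρ : 0 < ρ) : pointA (riemannParam ρ) =
    !₂[ρ * shiftFn (ρ ^ 4) (Real.pi / 2), 0, ρ * heightFn (ρ ^ 4) (Real.pi / 2)] := by
  rw [pointA, (tendsto_centre hρ).limUnder_eq, (tendsto_height hρ).limUnder_eq]

end Circles

end RiemannMinimal

namespace RiemannMinimal

/-! ### The surface is a Riemann example -/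

/-- `x` lies on the horizontal section at angle `a`. -/
def OnLevel (σ a : ℝ) (x : E3) : Prop :=
  x 2 = heightFn σ a ∧ IsLevel σ a (x 0 - shiftFn σ a) (x 1)

section Symmetries

variable {σ a : ℝ} {x : E3}

theorem onLevel_halfTurn_zero (hσ : 0 < σ) (h : OnLevel σ a x) : OnLevel σ (-a) (halfTurn 0 x) := by
  obtain ⟨h1, h2⟩ := h
  refine ⟨by simp [halfTurn, heightFn_neg hσ, h1], ?_⟩
  unfold IsLevel at *
  rw [shiftFn_neg hσ, delta_neg, Real.sin_neg, Real.cos_neg]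
  simp [halfTurn]
  linear_combination -h2

theorem onLevel_add_period (hσ : 0 < σ) (h : OnLevel σ a x) (k : ℤ) :
    OnLevel σ (a + k * (2 * Real.pi)) (x + k • periodVec σ) := by
  obtain ⟨h1, h2⟩ := h
  constructor
  · rw [heightFn_add_two_pi_mul hσ]; simp [periodVec, h1]
  · have e : (x + k • periodVec σ) 0 - shiftFn σ (a + k * (2 * Real.pi)) = x 0 - shiftFn σ a := by
      rw [shiftFn_add_two_pi_mul hσ]; simp [periodVec]
    have e1 : (x + k • periodVec σ) 1 = x 1 := by simp [periodVec]
    rw [e, e1]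
    unfold IsLevel delta at *
    rw [Real.sin_add_int_mul_two_pi, Real.cos_add_int_mul_two_pi]
    exact h2

theorem halfTurn_zero_halfTurn_zero (x : E3) : halfTurn 0 (halfTurn 0 x) = x := by
  ext i; fin_cases i <;> simp [halfTurn]

theorem onLevel_pos_iff (hσ : 0 < σ) (hs : Real.sin a ≠ 0) :
    OnLevel σ a x ↔ x 2 = heightFn σ a ∧
      (x 0 - axisFn σ a) ^ 2 + x 1 ^ 2 = (1 / (√σ * Real.sin a)) ^ 2 := by
  rw [OnLevel, isLevel_iff_circle hσ hs, axisFn, sub_sub]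

theorem axisFn_neg (hσ : 0 < σ) (a : ℝ) : axisFn σ (-a) = -axisFn σ a := by
  unfold axisFn
  rw [shiftFn_neg hσ, delta_neg, Real.sin_neg, Real.cos_neg, mul_neg, div_neg]; ring

theorem axisFn_add_pi (hσ : 0 < σ) (a : ℝ) :
    axisFn σ (a + Real.pi) = axisFn σ a + 2 * shiftFn σ (Real.pi / 2) := by
  unfold axisFn
  rw [shiftFn_add_pi hσ, delta_add_pi, Real.sin_add_pi, Real.cos_add_pi, mul_neg, neg_mul,
    neg_div_neg_eq]; ring

theorem exists_cos_sin {X Y r : ℝ} (hr : 0 < r) (h : X ^ 2 + Y ^ 2 = r ^ 2) :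
    ∃ v, X = r * Real.cos v ∧ Y = r * Real.sin v := by
  have hn : ‖(⟨X, Y⟩ : ℂ)‖ = r := by
    rw [Complex.norm_eq_sqrt_sq_add_sq]; simp only [h]; exact Real.sqrt_sq hr.le
  have h0 : (⟨X, Y⟩ : ℂ) ≠ 0 := norm_pos_iff.1 (by rw [hn]; exact hr)
  refine ⟨Complex.arg ⟨X, Y⟩, ?_, ?_⟩
  · rw [Complex.cos_arg h0, hn]; field_simp
  · rw [Complex.sin_arg, hn]; field_simp

end Symmetries

/-! ### Identification of the surface with the Riemann example. -/

section Comparison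

variable {ρ : ℝ}

/-- The homothety and translation that maps the surface to the Riemann example. -/
def toRiemann (ρ : ℝ) (x : E3) : E3 := ρ • x + pointA (riemannParam ρ)

theorem halfTurn_toRiemann (ρ : ℝ) (x : E3) :
    halfTurn (pointA (riemannParam ρ)) (toRiemann ρ x) = toRiemann ρ (halfTurn 0 x) := by
  have h1 : pointA (riemannParam ρ) 1 = 0 := rfl
  ext i; fin_cases i
  · simp [halfTurn, toRiemann]; ring
  · simp [halfTurn, toRiemann, h1]
  · simp [halfTurn, toRiemann]; ring

/-- Since A = ρT/4, the two axes differ by ρT/2. The half-turn about -A is therefore the one about A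
followed by the translation by -ρT. -/
theorem halfTurn_neg_toRiemann (hρ : 0 < ρ) (x : E3) :
    halfTurn (-pointA (riemannParam ρ)) (toRiemann ρ x) =
      toRiemann ρ (halfTurn 0 x + (-1 : ℤ) • periodVec (ρ ^ 4)) := by
  rw [toRiemann, toRiemann, pointA_eq hρ]
  ext i; fin_cases i
  · simp [halfTurn, periodVec]; ring
  · simp [halfTurn, periodVec]
  · simp [halfTurn, periodVec]; ring

/-- The upper circles lie below the line r through A, which has angle 0, so they carry the angles -a
with 0 < a ≤ π/2. -/
theorem upper_eq (hρ : 0 < ρ) {q : ℝ} (hq : 1 / ρ ^ 2 ≤ q) {x : E3}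
    (h : OnLevel (ρ ^ 4) (-circleAngle ρ q) x) :
    ∃ v, toRiemann ρ x = !₂[centre (riemannParam ρ) q + √q * Real.cos v, √q * Real.sin v,
      height (riemannParam ρ) q] := by
  have hσ : 0 < ρ ^ 4 := by positivity
  have hq0 : 0 < √q := Real.sqrt_pos.2 (lt_of_lt_of_le (by positivity) hq)
  have hs : Real.sin (-circleAngle ρ q) ≠ 0 := by
    rw [Real.sin_neg]; exact neg_ne_zero.2 (sin_circleAngle_pos ρ q).ne'
  rw [onLevel_pos_iff hσ hs, axisFn_neg hσ, heightFn_neg hσ, Real.sin_neg, sin_circleAngle hρ hq,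
    sqrt_pow_four] at h
  have hr : (1 / (ρ ^ 2 * -(1 / (ρ * √q)))) ^ 2 = (√q / ρ) ^ 2 := by field_simp
  rw [hr] at h
  obtain ⟨h1, h2⟩ := h
  obtain ⟨v, hX, hY⟩ := exists_cos_sin (by positivity) h2
  refine ⟨v, ?_⟩
  have hX' : x 0 = √q / ρ * Real.cos v - axisFn (ρ ^ 4) (circleAngle ρ q) := by linarith
  rw [toRiemann, pointA_eq hρ, centre_eq hρ hq, height_eq hρ hq]
  ext i; fin_cases i
  · simp [hX']; field_simp; ring
  · simp [hY]; field_simp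
  · simp [h1]; ring

theorem onLevel_of_upper (hρ : 0 < ρ) {q : ℝ} (hq : 1 / ρ ^ 2 ≤ q) {x : E3} {v : ℝ}
    (h : toRiemann ρ x = !₂[centre (riemannParam ρ) q + √q * Real.cos v, √q * Real.sin v,
      height (riemannParam ρ) q]) : OnLevel (ρ ^ 4) (-circleAngle ρ q) x := by
  have hσ : 0 < ρ ^ 4 := by positivity
  have hq0 : 0 < √q := Real.sqrt_pos.2 (lt_of_lt_of_le (by positivity) hq)
  have hs : Real.sin (-circleAngle ρ q) ≠ 0 := by
    rw [Real.sin_neg]; exact neg_ne_zero.2 (sin_circleAngle_pos ρ q).ne'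
  rw [toRiemann, pointA_eq hρ, centre_eq hρ hq, height_eq hρ hq] at h
  have h0 := congrFun (congrArg WithLp.ofLp h) 0
  have h1 := congrFun (congrArg WithLp.ofLp h) 1
  have h2 := congrFun (congrArg WithLp.ofLp h) 2
  simp at h0 h1 h2
  rw [onLevel_pos_iff hσ hs, axisFn_neg hσ, heightFn_neg hσ, Real.sin_neg, sin_circleAngle hρ hq,
    sqrt_pow_four]
  have e0 : ρ * (x 0 - -axisFn (ρ ^ 4) (circleAngle ρ q)) = √q * Real.cos v := by linarith
  constructor
  · apply mul_left_cancel₀ hρ.ne'; linarith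
  · apply mul_left_cancel₀ (pow_ne_zero 2 hρ.ne')
    have hr : ρ ^ 2 * (1 / (ρ ^ 2 * -(1 / (ρ * √q)))) ^ 2 = √q ^ 2 := by field_simp
    rw [hr, mul_add, ← mul_pow, ← mul_pow, e0, h1]
    linear_combination √q ^ 2 * Real.sin_sq_add_cos_sq v

/-- The lower circles have reflected centre and height; they lie above the line r', which has angle
-π, at the angles a - π. -/
theorem lower_eq (hρ : 0 < ρ) {q : ℝ} (hq : 1 / ρ ^ 2 ≤ q) {x : E3}
    (h : OnLevel (ρ ^ 4) (circleAngle ρ q - Real.pi) x) :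
    ∃ v, toRiemann ρ x = !₂[-centre (riemannParam ρ) q + √q * Real.cos v, √q * Real.sin v,
      -height (riemannParam ρ) q] := by
  have hσ : 0 < ρ ^ 4 := by positivity
  have hq0 : 0 < √q := Real.sqrt_pos.2 (lt_of_lt_of_le (by positivity) hq)
  have hs : Real.sin (circleAngle ρ q - Real.pi) ≠ 0 := by
    rw [Real.sin_sub_pi]; exact neg_ne_zero.2 (sin_circleAngle_pos ρ q).ne'
  have hax := axisFn_add_pi hσ (circleAngle ρ q - Real.pi)
  have hht := heightFn_add_pi hσ (circleAngle ρ q - Real.pi)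
  rw [sub_add_cancel] at hax hht
  rw [onLevel_pos_iff hσ hs, Real.sin_sub_pi, sin_circleAngle hρ hq, sqrt_pow_four] at h
  have hr : (1 / (ρ ^ 2 * -(1 / (ρ * √q)))) ^ 2 = (√q / ρ) ^ 2 := by field_simp
  rw [hr] at h
  obtain ⟨h1, h2⟩ := h
  obtain ⟨v, hX, hY⟩ := exists_cos_sin (by positivity) h2
  refine ⟨v, ?_⟩
  have hX' : x 0 = √q / ρ * Real.cos v + axisFn (ρ ^ 4) (circleAngle ρ q - Real.pi) := by linarith
  rw [toRiemann, pointA_eq hρ, centre_eq hρ hq, height_eq hρ hq, hax, hht]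
  ext i; fin_cases i
  · simp [hX']; field_simp; ring
  · simp [hY]; field_simp
  · simp [h1]; ring

theorem onLevel_of_lower (hρ : 0 < ρ) {q : ℝ} (hq : 1 / ρ ^ 2 ≤ q) {x : E3} {v : ℝ}
    (h : toRiemann ρ x = !₂[-centre (riemannParam ρ) q + √q * Real.cos v, √q * Real.sin v,
      -height (riemannParam ρ) q]) : OnLevel (ρ ^ 4) (circleAngle ρ q - Real.pi) x := by
  have hσ : 0 < ρ ^ 4 := by positivity
  have hq0 : 0 < √q := Real.sqrt_pos.2 (lt_of_lt_of_le (by positivity) hq)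
  have hs : Real.sin (circleAngle ρ q - Real.pi) ≠ 0 := by
    rw [Real.sin_sub_pi]; exact neg_ne_zero.2 (sin_circleAngle_pos ρ q).ne'
  have hax := axisFn_add_pi hσ (circleAngle ρ q - Real.pi)
  have hht := heightFn_add_pi hσ (circleAngle ρ q - Real.pi)
  rw [sub_add_cancel] at hax hht
  rw [toRiemann, pointA_eq hρ, centre_eq hρ hq, height_eq hρ hq, hax, hht] at h
  have h0 := congrFun (congrArg WithLp.ofLp h) 0
  have h1 := congrFun (congrArg WithLp.ofLp h) 1
  have h2 := congrFun (congrArg WithLp.ofLp h) 2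
  simp at h0 h1 h2
  rw [onLevel_pos_iff hσ hs, Real.sin_sub_pi, sin_circleAngle hρ hq, sqrt_pow_four]
  have e0 : ρ * (x 0 - axisFn (ρ ^ 4) (circleAngle ρ q - Real.pi)) = √q * Real.cos v := by linarith
  constructor
  · apply mul_left_cancel₀ hρ.ne'; linarith
  · apply mul_left_cancel₀ (pow_ne_zero 2 hρ.ne')
    have hr : ρ ^ 2 * (1 / (ρ ^ 2 * -(1 / (ρ * √q)))) ^ 2 = √q ^ 2 := by field_simp
    rw [hr, mul_add, ← mul_pow, ← mul_pow, e0, h1]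
    linear_combination √q ^ 2 * Real.sin_sq_add_cos_sq v

theorem toRiemann_surjective (hρ : 0 < ρ) : Function.Surjective (toRiemann ρ) := fun y =>
  ⟨ρ⁻¹ • (y - pointA (riemannParam ρ)), by simp [toRiemann, smul_smul, hρ.ne']⟩

/-- By induction: the generators have angles in [-π, 0], and the half-turns send the angle a to -a
and to -a - 2π. -/
theorem exists_onLevel_of_memRiemann (hρ : 0 < ρ) {y : E3}
    (h : MemRiemann (riemannParam ρ) y) : ∃ x a, toRiemann ρ x = y ∧ OnLevel (ρ ^ 4) a x := by
  have hσ : 0 < ρ ^ 4 := by positivity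
  induction h with
  | upper q v hq =>
    rw [qMin_riemannParam hρ] at hq
    obtain ⟨x, hx⟩ := toRiemann_surjective hρ _
    exact ⟨x, _, hx, onLevel_of_upper hρ hq hx⟩
  | lower q v hq =>
    rw [qMin_riemannParam hρ] at hq
    obtain ⟨x, hx⟩ := toRiemann_surjective hρ _
    exact ⟨x, _, hx, onLevel_of_lower hρ hq hx⟩
  | line s =>
    refine ⟨!₂[0, s / ρ, 0], 0, ?_, ?_, ?_⟩
    · rw [toRiemann, add_comm]
      congr 1
      ext i; fin_cases i <;> simp; field_simp
    · simp [heightFn_zero]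
    · rw [isLevel_iff_line hσ Real.sin_zero]; simp [shiftFn_zero]
  | line' s =>
    have h1 := heightFn_add_pi hσ (-Real.pi)
    have h2 := shiftFn_add_pi hσ (-Real.pi)
    rw [neg_add_cancel, heightFn_zero] at h1
    rw [neg_add_cancel, shiftFn_zero] at h2
    refine ⟨!₂[shiftFn (ρ ^ 4) (-Real.pi), s / ρ, heightFn (ρ ^ 4) (-Real.pi)], -Real.pi,
      ?_, ?_, ?_⟩
    · rw [toRiemann, pointA_eq hρ]
      ext i; fin_cases i
      · simp; linear_combination -ρ * h2
      · simp; field_simp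
      · simp; linear_combination -ρ * h1
    · simp
    · rw [isLevel_iff_line hσ (by simp)]; simp
  | turn y _ ih =>
    obtain ⟨x, a, rfl, h⟩ := ih
    exact ⟨_, _, (halfTurn_toRiemann ρ x).symm, onLevel_halfTurn_zero hσ h⟩
  | turn' y _ ih =>
    obtain ⟨x, a, rfl, h⟩ := ih
    exact ⟨_, _, (halfTurn_neg_toRiemann hρ x).symm,
      onLevel_add_period hσ (onLevel_halfTurn_zero hσ h) (-1)⟩

theorem memRiemann_halfTurn {x : E3} (h : MemRiemann (riemannParam ρ) (toRiemann ρ x)) :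
    MemRiemann (riemannParam ρ) (toRiemann ρ (halfTurn 0 x)) := by
  rw [← halfTurn_toRiemann]; exact h.turn

/-- Composing the half-turns about the two lines gives a translation by the period; the order
determines its sign. -/
theorem memRiemann_sub_period (hρ : 0 < ρ) {x : E3}
    (h : MemRiemann (riemannParam ρ) (toRiemann ρ x)) :
    MemRiemann (riemannParam ρ) (toRiemann ρ (x - periodVec (ρ ^ 4))) := by
  have h1 := (memRiemann_halfTurn h).turn'
  rw [halfTurn_neg_toRiemann hρ, halfTurn_zero_halfTurn_zero, neg_one_zsmul, ← sub_eq_add_neg] at h1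
  exact h1

theorem memRiemann_add_period (hρ : 0 < ρ) {x : E3}
    (h : MemRiemann (riemannParam ρ) (toRiemann ρ x)) :
    MemRiemann (riemannParam ρ) (toRiemann ρ (x + periodVec (ρ ^ 4))) := by
  have h1 := h.turn'
  rw [halfTurn_neg_toRiemann hρ] at h1
  have h2 := memRiemann_halfTurn h1
  have e : halfTurn 0 (halfTurn 0 x + (-1 : ℤ) • periodVec (ρ ^ 4)) = x + periodVec (ρ ^ 4) := by
    ext i; fin_cases i <;> simp [halfTurn, periodVec, add_comm]
  rwa [e] at h2

theorem memRiemann_of_add_zsmul (hρ : 0 < ρ) {x : E3} (k : ℤ)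
    (h : MemRiemann (riemannParam ρ) (toRiemann ρ (x + k • periodVec (ρ ^ 4)))) :
    MemRiemann (riemannParam ρ) (toRiemann ρ x) := by
  induction k using Int.induction_on with
  | zero => simpa using h
  | succ n ih =>
    apply ih
    have := memRiemann_sub_period hρ h
    rwa [add_smul, one_smul, ← add_assoc, add_sub_cancel_right] at this
  | pred n ih =>
    apply ih
    have := memRiemann_add_period hρ h
    rwa [sub_smul, one_smul, add_assoc, sub_add_cancel] at this

theorem le_one_div_sq (hρ : 0 < ρ) {a : ℝ} (ha : a ∈ Ioc 0 (Real.pi / 2)) :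
    1 / ρ ^ 2 ≤ (1 / (ρ * Real.sin a)) ^ 2 := by
  have hs : 0 < Real.sin a := Real.sin_pos_of_pos_of_lt_pi ha.1 (by linarith [ha.2, Real.pi_pos])
  rw [div_pow, one_pow, mul_pow]
  apply one_div_le_one_div_of_le (by positivity)
  nlinarith [Real.sin_sq_le_one a, sq_nonneg ρ]

/-- The interval [-π, 0] of angles is half a period: its endpoints are the lines r' and r, and its
two halves are the lower and the upper circles. The parameter q is the squared radius after scaling.
-/
theorem memRiemann_of_onLevel_of_mem (hρ : 0 < ρ) {a : ℝ} {x : E3} (h : OnLevel (ρ ^ 4) a x)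
    (ha : a ∈ Icc (-Real.pi) 0) : MemRiemann (riemannParam ρ) (toRiemann ρ x) := by
  have hσ : 0 < ρ ^ 4 := by positivity
  rcases eq_or_lt_of_le ha.2 with rfl | ha0
  · obtain ⟨h1, h2⟩ := h
    rw [isLevel_iff_line hσ Real.sin_zero, shiftFn_zero, sub_zero] at h2
    rw [heightFn_zero] at h1
    have : toRiemann ρ x = pointA (riemannParam ρ) + !₂[0, ρ * x 1, 0] := by
      rw [toRiemann, add_comm]
      congr 1
      ext i; fin_cases i <;> simp [h1, h2]
    rw [this]; exact .line _
  rcases eq_or_lt_of_le ha.1 with rfl | ha1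
  · obtain ⟨h1, h2⟩ := h
    rw [isLevel_iff_line hσ (by simp)] at h2
    have h3 := heightFn_add_pi hσ (-Real.pi)
    have h4 := shiftFn_add_pi hσ (-Real.pi)
    rw [neg_add_cancel, heightFn_zero] at h3
    rw [neg_add_cancel, shiftFn_zero] at h4
    have : toRiemann ρ x = -pointA (riemannParam ρ) + !₂[0, ρ * x 1, 0] := by
      rw [toRiemann, pointA_eq hρ]
      ext i; fin_cases i
      · simp; linear_combination ρ * h2 - ρ * h4
      · simp
      · simp; linear_combination ρ * h1 - ρ * h3
    rw [this]; exact .line' _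
  rcases le_or_gt (-(Real.pi / 2)) a with ha2 | ha2
  · have hm : -a ∈ Ioc 0 (Real.pi / 2) := ⟨by linarith, by linarith⟩
    have hq := le_one_div_sq hρ hm
    rw [show a = -circleAngle ρ ((1 / (ρ * Real.sin (-a))) ^ 2) by
      rw [circleAngle_of_mem hρ hm, neg_neg]] at h
    obtain ⟨v, hv⟩ := upper_eq hρ hq h
    rw [hv]
    exact .upper _ v (by rwa [qMin_riemannParam hρ])
  · have hm : a + Real.pi ∈ Ioc 0 (Real.pi / 2) := ⟨by linarith, by linarith⟩
    have hq := le_one_div_sq hρ hm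
    rw [show a = circleAngle ρ ((1 / (ρ * Real.sin (a + Real.pi))) ^ 2) - Real.pi by
      rw [circleAngle_of_mem hρ hm]; ring] at h
    obtain ⟨v, hv⟩ := lower_eq hρ hq h
    rw [hv]
    exact .lower _ v (by rwa [qMin_riemannParam hρ])

/-- Translations bring the angle into (-π, π], and the half-turn about r carries nonnegative angles
into [-π, 0]. -/
theorem memRiemann_of_onLevel (hρ : 0 < ρ) {a : ℝ} {x : E3} (h : OnLevel (ρ ^ 4) a x) :
    MemRiemann (riemannParam ρ) (toRiemann ρ x) := by
  have hσ : 0 < ρ ^ 4 := by positivity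
  obtain ⟨k, hk, -⟩ := existsUnique_add_zsmul_mem_Ioc Real.two_pi_pos a (-Real.pi)
  simp only [zsmul_eq_mul] at hk
  apply memRiemann_of_add_zsmul hρ k
  have h1 := onLevel_add_period hσ h k
  rcases le_total (a + k * (2 * Real.pi)) 0 with h0 | h0
  · exact memRiemann_of_onLevel_of_mem hρ h1 ⟨hk.1.le, h0⟩
  · rw [← halfTurn_zero_halfTurn_zero (x + k • periodVec (ρ ^ 4))]
    exact memRiemann_halfTurn (memRiemann_of_onLevel_of_mem hρ (onLevel_halfTurn_zero hσ h1)
      ⟨by linarith [hk.2], by linarith⟩)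

theorem surfaceM_eq_image_riemannExample {σ : ℝ} (hσ : 0 < σ) :
    surfaceM σ = (fun x => σ ^ (-1 / 4 : ℝ) • (x - pointA (√σ - 1 / √σ))) ''
      riemannExample (√σ - 1 / √σ) := by
  obtain ⟨ρ, hρ, rfl⟩ : ∃ ρ, 0 < ρ ∧ σ = ρ ^ 4 := ⟨√√σ, by positivity, by
    rw [show √√σ ^ 4 = (√√σ ^ 2) ^ 2 by ring, Real.sq_sqrt (Real.sqrt_nonneg _),
      Real.sq_sqrt hσ.le]⟩
  have hpow : (ρ ^ 4 : ℝ) ^ (-1 / 4 : ℝ) = ρ⁻¹ := by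
    rw [← Real.rpow_natCast, ← Real.rpow_mul hρ.le]
    norm_num
    exact Real.rpow_neg_one ρ
  rw [hpow, sqrt_pow_four, show ρ ^ 2 - 1 / ρ ^ 2 = riemannParam ρ from rfl]
  have key : ∀ x, ρ⁻¹ • (toRiemann ρ x - pointA (riemannParam ρ)) = x := fun x => by
    simp [toRiemann, smul_smul, hρ.ne']
  ext x
  rw [mem_surfaceM_iff hσ]
  constructor
  · rintro ⟨a, h⟩
    exact ⟨toRiemann ρ x, memRiemann_of_onLevel hρ h, key x⟩
  · rintro ⟨y, hy, rfl⟩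
    obtain ⟨z, a, rfl, h⟩ := exists_onLevel_of_memRiemann hρ hy
    simp only [key]
    exact ⟨a, h⟩

theorem image_add_periodVec_surfaceM {σ : ℝ} (hσ : 0 < σ) :
    (fun x => x + periodVec σ) '' surfaceM σ = surfaceM σ := by
  ext x
  simp only [mem_image, mem_surfaceM_iff hσ]
  constructor
  · rintro ⟨y, ⟨a, h⟩, rfl⟩
    have h1 := onLevel_add_period hσ h 1
    rw [one_smul] at h1
    exact ⟨_, h1⟩
  · rintro ⟨a, h⟩
    have h1 := onLevel_add_period hσ h (-1)
    rw [neg_one_zsmul, ← sub_eq_add_neg] at h1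
    exact ⟨x - periodVec σ, ⟨_, h1⟩, sub_add_cancel _ _⟩

end Comparison

end RiemannMinimal

end

theorem mainTheorem3 (σ : ℝ) (hσ : 0 < σ) :
    -- the periods form an infinite cyclic group, so that `X` is well defined on an infinite cyclic
    -- covering with deck transformations `(p, x) ↦ (p, x + k T)`, and the surface is periodic
    (∃ T : RiemannMinimal.E3, T ≠ 0 ∧ T 1 = 0 ∧
      RiemannMinimal.periods σ = (AddSubgroup.zmultiples T : Set RiemannMinimal.E3) ∧
      (∀ p ∈ RiemannMinimal.puncturedCurve σ,
        ∃ x, (p, x) ∈ RiemannMinimal.weierstrassCover σ ∧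
          ∀ y, (p, y) ∈ RiemannMinimal.weierstrassCover σ ↔ ∃ k : ℤ, y = x + k • T) ∧
      (fun x => x + T) '' RiemannMinimal.surfaceM σ = RiemannMinimal.surfaceM σ) ∧
    -- there are coordinates with `φ₃ = dξ` near every point
    (∀ q : RiemannMinimal.weierstrassCover σ,
      ∃ e : OpenPartialHomeomorph (RiemannMinimal.weierstrassCover σ) ℂ,
        RiemannMinimal.IsHeightChart σ e ∧ q ∈ e.source) ∧
    -- in all of them the immersion is conformal and minimal, and the Shiffman function is zero
    (∀ e : OpenPartialHomeomorph (RiemannMinimal.weierstrassCover σ) ℂ,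
      RiemannMinimal.IsHeightChart σ e →
        RiemannMinimal.IsMinimalImmersionOn (RiemannMinimal.inChart σ e) e.target ∧
        RiemannMinimal.IsConformalHeightOn (RiemannMinimal.inChart σ e) e.target ∧
        ∀ ξ ∈ e.target, RiemannMinimal.shiffman (RiemannMinimal.inChart σ e) ξ = 0) ∧
    RiemannMinimal.IsCompleteSurface σ ∧
    RiemannMinimal.FoliatedByCirclesAndLines (RiemannMinimal.surfaceM σ) ∧
    -- up to homothety and translation the surface is the Riemann example
    (∃! lam : ℝ, σ = (2 / (√(lam ^ 2 + 4) - lam)) ^ 2) ∧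
    (∀ lam : ℝ, σ = (2 / (√(lam ^ 2 + 4) - lam)) ^ 2 →
      RiemannMinimal.surfaceM σ =
        (fun x => σ ^ (-1 / 4 : ℝ) • (x - RiemannMinimal.pointA lam)) ''
          RiemannMinimal.riemannExample lam) := by
  refine ⟨⟨RiemannMinimal.periodVec σ, RiemannMinimal.periodVec_ne_zero hσ, rfl,
    RiemannMinimal.periods_eq hσ, fun p hp => RiemannMinimal.weierstrassCover_fibre hσ hp,
    RiemannMinimal.image_add_periodVec_surfaceM hσ⟩, RiemannMinimal.exists_isHeightChart hσ,
    fun e he => ⟨he.isMinimalImmersionOn hσ, he.isConformalHeightOn hσ,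
      fun ξ hξ => he.shiffman_eq_zero hσ hξ⟩, RiemannMinimal.isCompleteSurface hσ,
    RiemannMinimal.foliatedByCirclesAndLines_surfaceM hσ, ?_, fun lam hlam => ?_⟩
  · simp only [RiemannMinimal.eq_sq_two_div_iff hσ]
    exact existsUnique_eq
  · rw [(RiemannMinimal.eq_sq_two_div_iff hσ lam).1 hlam]
    exact RiemannMinimal.surfaceM_eq_image_riemannExample hσ
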